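/- Let $H,K,L,M$ be finite-dimensional Hilbert spaces, let $A\subseteq\mathcal L(H)$, $B\subseteq\mathcal L(K)$, $C\subseteq\mathcal L(L)$, $D\subseteq\mathcal L(M)$ be nondegenerate $C^*$-algebras, and let $\phi\colon A\to C$, $\psi\colon B\to D$ be unital $*$-homomorphisms. Let $N$ be a $C^*$-algebra with a faithful state $\mu$ and injective unital $*$-homomorphisms $\rho\colon N^{op}\to A$, $\sigma\colon N\to B$, $\upsilon\colon N^{op}\to C$, $\omega\colon N\to D$. Let $(H_\mu,\pi_\mu,\zeta_\mu)$ be a GNS-representation for $\mu$, with $H_\mu$ finite-dimensional, let $J_\mu$ be its modular conjugation (the antiunitary part in the polar decomposition of $\pi_\mu(b)\zeta_\mu\mapsto\pi_\mu(b^*)\zeta_\mu$), and put $\pi_\mu^{op}(b^{op})=J_\mu\pi_\mu(b)^*J_\mu$. Let $(\mathfrak H,\mathfrak B,\mathfrak B^\dagger)$ be a finite-dimensional $C^*$-base, that is, $\mathfrak B,\mathfrak B^\dagger\subseteq\mathcal L(\mathfrak H)$ are commuting nondegenerate $C^*$-algebras on a finite-dimensional Hilbert space, and let $\zeta\in\mathfrak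 H$ be cyclic for $\mathfrak B$ and for $\mathfrak B^\dagger$. A $C^*$-factorization of $H$ with respect to $(\mathfrak H,\mathfrak B,\mathfrak B^\dagger)$ is a subspace $\alpha\subseteq\mathcal L(\mathfrak H,H)$ with $[\alpha^*\alpha]=\mathfrak B$, $[\alpha\mathfrak B]=\alpha$, $[\alpha\mathfrak H]=H$, where $[\,\cdot\,]$ denotes the closed linear span; it defines a representation $\rho_\alpha$ of $\mathfrak B^\dagger$ on $H$ by $\rho_\alpha(b^\dagger)\xi z=\xi b^\dagger z$ $(\xi\in\alpha,\ z\in\mathfrak H)$, and it is a $C^*$-factorization of $A$ if $\rho_\alpha(\mathfrak B^\dagger)\subseteq A$. Let $\alpha,\gamma$ be $C^*$-factorizations of $A$, $C$ with respect to $(\mathfrak H,\mathfrak B,\mathfrak B^\dagger)$ and $\beta,\delta$ be $C^*$-factorizations of $B$, $D$ with respect to $(\mathfrak H,\mathfrak B^\dagger,\mathfrak B)$. Let $U\colon\mathfrak H\to H_\mu$ be a unitary with $U\mathfrak BU^*=\pi_\mu(N)$, $U\mathfrak B^\dagger U^*=\pi_\mu^{op}(N^{op})$, $U\zeta=\zeta_\mu$,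 and assume, with $\mathrm{Ad}_{U^*}(T)=U^*TU$, $$\rho=\rho_\alpha\circ\mathrm{Ad}_{U^*}\circ\pi_\mu^{op},\quad \sigma=\rho_\beta\circ\mathrm{Ad}_{U^*}\circ\pi_\mu,\quad \upsilon=\rho_\gamma\circ\mathrm{Ad}_{U^*}\circ\pi_\mu^{op},\quad \omega=\rho_\delta\circ\mathrm{Ad}_{U^*}\circ\pi_\mu .$$ *Classical side.* For $\xi\in H$, $\eta\in K$ let $R^\rho(\xi)\colon H_\mu\to H$, $\pi_\mu^{op}(b^{op})\zeta_\mu\mapsto\rho(b^{op})\xi$, and $R^\sigma(\eta)\colon H_\mu\to K$, $\pi_\mu(b)\zeta_\mu\mapsto\sigma(b)\eta$. The relative tensor product $H\otimes_\mu K$ is the Hilbert space obtained from $H\otimes K$ with the form $\langle\xi\otimes\eta|\xi'\otimes\eta'\rangle_\mu=\langle R^\rho(\xi')^*R^\rho(\xi)\zeta_\mu|R^\sigma(\eta)^*R^\sigma(\eta')\zeta_\mu\rangle$ by factoring out the null space; $A*_\mu B$ is the commutant of $\{S\otimes_\mu T: S\in A',\,T\in B'\}$, where $(S\otimes_\mu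 T)(\xi\otimes_\mu\eta)=S\xi\otimes_\mu T\eta$. Define $L\otimes_\mu M$ and $C*_\mu D$ in the same way from $\upsilon,\omega$. *Spatial side.* $H\otimes_{\mathfrak H}K$ is the internal tensor product of $\alpha$, $\mathfrak H$ and $\beta$, with $\langle\xi\otimes z\otimes\eta|\xi'\otimes z'\otimes\eta'\rangle=\langle z|\xi^*\xi'\eta^*\eta'z'\rangle$. For $\xi\in\alpha$, $\eta\in\beta$ let $|\xi\rangle_1\colon K\to H\otimes_{\mathfrak H}K$, $\eta' z\mapsto\xi\otimes z\otimes\eta'$ $(\eta'\in\beta)$, and $|\eta\rangle_2\colon H\to H\otimes_{\mathfrak H}K$, $\xi' z\mapsto\xi'\otimes z\otimes\eta$ $(\xi'\in\alpha)$; write $|\alpha\rangle_1$, $|\beta\rangle_2$ for the sets of these operators. Then $A*_{\mathfrak H}B$ consists of all operators $T$ on $H\otimes_{\mathfrak H}K$ such that $T|\alpha\rangle_1,\,T^*|\alpha\rangle_1\subseteq[|\alpha\rangle_1B]$ and $T|\beta\rangle_2,\,T^*|\beta\rangle_2\subseteq[|\beta\rangle_2A]$. Define $L\otimes_{\mathfrak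 H}M$ and $C*_{\mathfrak H}D$ in the same way from $\gamma,\delta$. Write $\mathcal L^\phi(H,L)=\{X\in\mathcal L(H,L): Xa=\phi(a)X\ \text{for all } a\in A\}$, and similarly $\mathcal L^\psi(K,M)$. Assume that one of the following two conditions holds: (i) $\phi\circ\rho=\upsilon$ and $\psi\circ\sigma=\omega$; (ii) $\phi$ and $\psi$ are morphisms, that is, $\gamma=[I_\phi\alpha]$ with $I_\phi=\{V\in\mathcal L^\phi(H,L): V\alpha\subseteq\gamma,\ V^*\gamma\subseteq\alpha\}$, and likewise $\delta=[I_\psi\beta]$. Then the following holds. 1. There are unitaries $\Phi_{\alpha,\beta}\colon H\otimes_\mu K\to H\otimes_{\mathfrak H}K$, $\xi\otimes_\mu\eta\mapsto R^\rho(\xi)U\otimes\zeta\otimes R^\sigma(\eta)U$, and, given by the corresponding formula, $\Phi_{\gamma,\delta}\colon L\otimes_\mu M\to L\otimes_{\mathfrak H}M$. Conjugation by them gives $*$-isomorphisms $\phi^{U,\zeta}_{\alpha,\beta}\colon A*_\mu B\to A*_{\mathfrak H}B$ and $\phi^{U,\zeta}_{\gamma,\delta}\colon C*_\mu D\to C*_{\mathfrak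 H}D$. 2. There are unique $*$-homomorphisms $\phi*_\mu\psi\colon A*_\mu B\to C*_\mu D$ and $\phi*_{\mathfrak H}\psi\colon A*_{\mathfrak H}B\to C*_{\mathfrak H}D$ such that $(\phi*_\mu\psi)(S)(X\otimes_\mu Y)=(X\otimes_\mu Y)S$ and $(\phi*_{\mathfrak H}\psi)(T)(X\otimes_{\mathfrak H}Y)=(X\otimes_{\mathfrak H}Y)T$ for all $X\in\mathcal L^\phi(H,L)$, $Y\in\mathcal L^\psi(K,M)$, $S\in A*_\mu B$, $T\in A*_{\mathfrak H}B$. Here $X\otimes_\mu Y\colon\xi\otimes_\mu\eta\mapsto X\xi\otimes_\mu Y\eta$ and $X\otimes_{\mathfrak H}Y\colon\xi\otimes z\otimes\eta\mapsto X\xi\otimes z\otimes Y\eta$. 3. These maps correspond to each other under the isomorphisms in 1: $$\phi^{U,\zeta}_{\gamma,\delta}\circ(\phi*_\mu\psi)=(\phi*_{\mathfrak H}\psi)\circ\phi^{U,\zeta}_{\alpha,\beta}.$$ -/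

import Mathlib

open scoped InnerProductSpace TensorProduct ComplexOrder
open ContinuousLinearMap (adjoint)
noncomputable section

/-- A faithful state on a unital `C^*`-algebra `N`. -/
structure FaithfulState (N : Type*) [CStarAlgebra N] where
  toLinearMap : N →ₗ[ℂ] ℂ
  nonneg : ∀ a, 0 ≤ toLinearMap (star a * a)
  map_one : toLinearMap 1 = 1
  faithful : ∀ a, toLinearMap (star a * a) = 0 → a = 0

/-- A GNS representation `(E, π, ζ)` for the state `μ` on a finite-dimensional Hilbert space `E`
(so that cyclicity of `ζ` needs no closure). -/
structure GNSRep {N : Type*} [CStarAlgebra N] (μ : FaithfulState N)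
    (E : Type*) [NormedAddCommGroup E] [InnerProductSpace ℂ E] [CompleteSpace E] where
  π : N →⋆ₐ[ℂ] (E →L[ℂ] E)
  ζ : E
  cyclic : Submodule.span ℂ (Set.range fun a => π a ζ) = ⊤
  inner_eq : ∀ a, ⟪ζ, π a ζ⟫_ℂ = μ.toLinearMap a

section polar
variable {E : Type*} [NormedAddCommGroup E] [InnerProductSpace ℂ E]

theorem apply_eq_of_sq {P : E →L[ℂ] E} (hP : P.IsPositive) {t : ℝ} (ht : 0 < t) {v : E}
    (h : P (P v) = ((t ^ 2 : ℝ) : ℂ) • v) : P v = (t : ℂ) • v := by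
  rw [← sub_eq_zero]
  set w := P v - (t : ℂ) • v with hw
  have h1 : P w = (-t : ℂ) • w := by
    rw [hw, map_sub, map_smul, h, smul_sub, smul_smul]
    push_cast
    rw [sq, neg_mul, neg_smul, neg_smul]
    abel
  have h2 := hP.re_inner_nonneg_right w
  rw [h1, inner_smul_right, inner_self_eq_norm_sq_to_K] at h2
  have h3 : RCLike.re ((-t : ℂ) * (‖w‖ : ℂ) ^ 2) = - (t * ‖w‖ ^ 2) := by
    rw [← Complex.ofReal_pow, ← Complex.ofReal_neg, ← Complex.ofReal_mul]
    change -t * ‖w‖ ^ 2 = _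
    ring
  have h4 : (0 : ℝ) ≤ - (t * ‖w‖ ^ 2) := by
    rw [← h3]; exact h2
  have h5 : ‖w‖ ^ 2 ≤ 0 := by
    by_contra hh
    push Not at hh
    have := mul_pos ht hh
    linarith
  have : ‖w‖ = 0 := by nlinarith [norm_nonneg w]
  exact norm_eq_zero.mp this

theorem conj_isometry_inner (J : E ≃ₗᵢ⋆[ℂ] E) (x y : E) : ⟪J x, J y⟫_ℂ = ⟪y, x⟫_ℂ := by
  have hre : ∀ x y, (⟪J x, J y⟫_ℂ).re = (⟪y, x⟫_ℂ).re := by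
    intro x y
    have h1 := norm_add_sq (𝕜 := ℂ) (J x) (J y)
    have h2 := norm_add_sq (𝕜 := ℂ) y x
    rw [← map_add, J.norm_map, J.norm_map, J.norm_map, add_comm x y] at h1
    have : RCLike.re ⟪J x, J y⟫_ℂ = RCLike.re ⟪y, x⟫_ℂ := by linarith
    exact this
  apply Complex.ext (hre x y)
  have h := hre x (Complex.I • y)
  rw [map_smulₛₗ, inner_smul_right, inner_smul_left] at h
  simp at h
  linarith

theorem polar_unique [CompleteSpace E] {J J' : E ≃ₗᵢ⋆[ℂ] E} {P P' : E →L[ℂ] E} (hP : P.IsPositive)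
    (hP' : P'.IsPositive) (hsurj : Function.Surjective P) (h : ∀ x, J (P x) = J' (P' x)) :
    J = J' ∧ P = P' := by
  have hsq : P * P = P' * P' := by
    ext x
    refine ext_inner_left ℂ fun y => ?_
    change ⟪y, P (P x)⟫_ℂ = ⟪y, P' (P' x)⟫_ℂ
    rw [← hP.isSymmetric.apply_clm, ← hP'.isSymmetric.apply_clm]
    rw [← conj_isometry_inner J, h, h, conj_isometry_inner]
  have h0 : 0 ≤ P := by rwa [ContinuousLinearMap.nonneg_iff_isPositive]
  have h0' : 0 ≤ P' := by rwa [ContinuousLinearMap.nonneg_iff_isPositive]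
  have hPP : P = P' := by
    rw [← CFC.sqrt_unique rfl h0, ← CFC.sqrt_unique hsq.symm h0']
  refine ⟨?_, hPP⟩
  ext x
  obtain ⟨y, rfl⟩ := hsurj x
  rw [h, hPP]

theorem exists_polar [CompleteSpace E] [FiniteDimensional ℂ E] (S : E →ₗ⋆[ℂ] E) (hS : Function.Bijective S) :
    ∃ J : E ≃ₗᵢ⋆[ℂ] E, ∃ P : E →L[ℂ] E, P.IsPositive ∧ ∀ x, J (P x) = S x := by
  let e := stdOrthonormalBasis ℂ E
  let Δ₀ : E →ₗ[ℂ] E :=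
    { toFun := fun y => ∑ i, ⟪S y, S (e i)⟫_ℂ • e i
      map_add' := fun y z => by simp [add_smul, Finset.sum_add_distrib]
      map_smul' := fun c y => by simp [smul_smul, Finset.smul_sum, mul_comm] }
  let Δ : E →L[ℂ] E := LinearMap.toContinuousLinearMap Δ₀
  have hΔ : ∀ x y, ⟪x, Δ y⟫_ℂ = ⟪S y, S x⟫_ℂ := by
    intro x y
    change ⟪x, ∑ i, ⟪S y, S (e i)⟫_ℂ • e i⟫_ℂ = _
    conv_rhs => rw [← e.sum_repr' x]
    simp [map_smulₛₗ, mul_comm]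
  have hpos : Δ.IsPositive := by
    rw [ContinuousLinearMap.isPositive_def']
    constructor
    · rw [ContinuousLinearMap.isSelfAdjoint_iff_isSymmetric]
      intro x y
      change ⟪Δ x, y⟫_ℂ = ⟪x, Δ y⟫_ℂ
      rw [← inner_conj_symm, hΔ, hΔ, inner_conj_symm]
    · intro x
      rw [ContinuousLinearMap.reApplyInnerSelf_apply, ← inner_conj_symm, hΔ, inner_conj_symm]
      exact inner_self_nonneg
  have h0 : 0 ≤ Δ := by rwa [ContinuousLinearMap.nonneg_iff_isPositive]
  let P : E →L[ℂ] E := CFC.sqrt Δ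
  have hP : P.IsPositive := by
    rw [← ContinuousLinearMap.nonneg_iff_isPositive]; exact CFC.sqrt_nonneg Δ
  have hPP : P * P = Δ := CFC.sqrt_mul_sqrt_self Δ h0
  have hnorm : ∀ x, ‖P x‖ = ‖S x‖ := by
    intro x
    have h1 : ⟪P x, P x⟫_ℂ = ⟪S x, S x⟫_ℂ := by
      rw [hP.isSymmetric.apply_clm, ← hΔ, ← hPP]; rfl
    rw [inner_self_eq_norm_sq_to_K, inner_self_eq_norm_sq_to_K] at h1
    have h2 : ‖P x‖ ^ 2 = ‖S x‖ ^ 2 := by exact_mod_cast h1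
    exact (sq_eq_sq₀ (norm_nonneg _) (norm_nonneg _)).mp h2
  have hinj : Function.Injective P := by
    rw [injective_iff_map_eq_zero]
    intro x hx
    have := hnorm x
    rw [hx, norm_zero] at this
    have h := norm_eq_zero.mp this.symm
    exact hS.1 (h.trans (map_zero S).symm)
  let Pe : E ≃ₗ[ℂ] E := LinearEquiv.ofInjectiveEndo (P : E →ₗ[ℂ] E) hinj
  have hPe : ∀ x, P (Pe.symm x) = x := fun x => Pe.apply_symm_apply x
  let J₀ : E →ₗᵢ⋆[ℂ] E :=
    { toLinearMap := S.comp Pe.symm.toLinearMap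
      norm_map' := fun x => by
        change ‖S (Pe.symm x)‖ = ‖x‖
        rw [← hnorm, hPe] }
  have hJ₀ : Function.Surjective J₀ := by
    intro y
    obtain ⟨x, rfl⟩ := hS.2 y
    refine ⟨P x, ?_⟩
    change S (Pe.symm (Pe x)) = S x
    rw [Pe.symm_apply_apply]
  refine ⟨LinearIsometryEquiv.ofSurjective J₀ hJ₀, P, hP, fun x => ?_⟩
  change S (Pe.symm (Pe x)) = S x
  rw [Pe.symm_apply_apply]

end polar

namespace GNSRep
variable {N : Type*} [CStarAlgebra N] {μ : FaithfulState N}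
  {E : Type*} [NormedAddCommGroup E] [InnerProductSpace ℂ E] [CompleteSpace E]
  (G : GNSRep μ E)

theorem inner_π (a : N) (x y : E) : ⟪G.π a x, y⟫_ℂ = ⟪x, G.π (star a) y⟫_ℂ := by
  rw [map_star, ContinuousLinearMap.star_eq_adjoint, ContinuousLinearMap.adjoint_inner_right]

theorem π_mul (a b : N) (x : E) : G.π (a * b) x = G.π a (G.π b x) := by
  rw [map_mul]; rfl

theorem inner_π_π (a b : N) :
    ⟪G.π a G.ζ, G.π b G.ζ⟫_ℂ = μ.toLinearMap (star a * b) := by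
  rw [inner_π, ← π_mul, G.inner_eq]

/-- The map `a ↦ π(a)ζ`. -/
def orbit₀ : N →ₗ[ℂ] E where
  toFun a := G.π a G.ζ
  map_add' a b := by simp
  map_smul' c a := by simp

theorem orbit₀_bijective : Function.Bijective G.orbit₀ := by
  constructor
  · rw [injective_iff_map_eq_zero]
    intro a ha
    apply μ.faithful
    rw [← G.inner_π_π]
    change ⟪G.orbit₀ a, G.orbit₀ a⟫_ℂ = 0
    rw [ha, inner_zero_left]
  · rw [← LinearMap.range_eq_top, eq_top_iff, ← G.cyclic, Submodule.span_le]
    rintro _ ⟨a, rfl⟩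
    exact ⟨a, rfl⟩

/-- The linear isomorphism `N → E`, `a ↦ π(a)ζ`. -/
def orbit : N ≃ₗ[ℂ] E := LinearEquiv.ofBijective G.orbit₀ G.orbit₀_bijective

theorem orbit_apply (a : N) : G.orbit a = G.π a G.ζ := rfl

theorem π_orbit_symm (x : E) : G.π (G.orbit.symm x) G.ζ = x := G.orbit.apply_symm_apply x

/-- The conjugate-linear map `S : π(a)ζ ↦ π(a^*)ζ`. -/
def S : E →ₗ⋆[ℂ] E where
  toFun x := G.π (star (G.orbit.symm x)) G.ζ
  map_add' x y := by simp
  map_smul' c x := by simp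

theorem S_apply (a : N) : G.S (G.π a G.ζ) = G.π (star a) G.ζ := by
  change G.π (star (G.orbit.symm (G.orbit a))) G.ζ = _
  rw [LinearEquiv.symm_apply_apply]

theorem S_S (x : E) : G.S (G.S x) = x := by
  obtain ⟨a, rfl⟩ := G.orbit.surjective x
  rw [orbit_apply, S_apply, S_apply, star_star]

theorem S_bijective : Function.Bijective G.S :=
  Function.Involutive.bijective G.S_S

theorem ext_π {x y : E} (h : ∀ c, ⟪G.π c G.ζ, x⟫_ℂ = ⟪G.π c G.ζ, y⟫_ℂ) : x = y := by
  refine ext_inner_left ℂ fun v => ?_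
  rw [← G.π_orbit_symm v]; exact h _

theorem S_ζ : G.S G.ζ = G.ζ := by
  have := G.S_apply 1
  simpa using this

variable [FiniteDimensional ℂ E]

theorem existsUnique_modularConj :
    ∃! J : E ≃ₗᵢ⋆[ℂ] E, ∃ P : E →L[ℂ] E, P.IsPositive ∧
      ∀ a, J (P (G.π a G.ζ)) = G.π (star a) G.ζ := by
  obtain ⟨J, P, hP, h⟩ := exists_polar G.S G.S_bijective
  refine ⟨J, ⟨P, hP, fun a => by rw [h, S_apply]⟩, ?_⟩
  rintro J' ⟨P', hP', h'⟩
  have hsurj : Function.Surjective P := by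
    intro y
    obtain ⟨x, hx⟩ := G.S_bijective.2 (J y)
    refine ⟨x, J.injective ?_⟩
    rw [h, hx]
  refine (polar_unique hP hP' hsurj fun x => ?_).1.symm
  obtain ⟨a, rfl⟩ := G.orbit.surjective x
  rw [orbit_apply, h', h, S_apply]

/-- The modular conjugation: the antiunitary part of the polar decomposition of
`π(a)ζ ↦ π(a^*)ζ`. -/
def modularConj : E ≃ₗᵢ⋆[ℂ] E := G.existsUnique_modularConj.choose

/-- The positive part of the polar decomposition of `π(a)ζ ↦ π(a^*)ζ`. -/
def modularAbs : E →L[ℂ] E := G.existsUnique_modularConj.choose_spec.1.choose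


theorem modularAbs_pos : G.modularAbs.IsPositive :=
  G.existsUnique_modularConj.choose_spec.1.choose_spec.1

theorem modular_apply (x : E) : G.modularConj (G.modularAbs x) = G.S x := by
  obtain ⟨a, rfl⟩ := G.orbit.surjective x
  rw [orbit_apply, S_apply]
  exact G.existsUnique_modularConj.choose_spec.1.choose_spec.2 a

theorem modularAbs_injective : Function.Injective G.modularAbs := by
  intro x y h
  apply G.S_bijective.1
  rw [← modular_apply, ← modular_apply, h]

theorem modularAbs_surjective : Function.Surjective G.modularAbs :=
  (LinearMap.injective_iff_surjective (f := (G.modularAbs : E →ₗ[ℂ] E))).mp G.modularAbs_injective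

theorem inner_sq (x y : E) : ⟪x, G.modularAbs (G.modularAbs y)⟫_ℂ = ⟪G.S y, G.S x⟫_ℂ := by
  rw [← G.modularAbs_pos.isSymmetric.apply_clm, ← conj_isometry_inner G.modularConj, modular_apply,
    modular_apply]

theorem inner_sq_π (c d : N) :
    ⟪G.π c G.ζ, G.modularAbs (G.modularAbs (G.π d G.ζ))⟫_ℂ = μ.toLinearMap (d * star c) := by
  rw [inner_sq, S_apply, S_apply, inner_π_π, star_star]

theorem modularAbs_ζ : G.modularAbs G.ζ = G.ζ := by
  have := apply_eq_of_sq G.modularAbs_pos one_pos (v := G.ζ) (by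
    refine G.ext_π fun c => ?_
    have h := G.inner_sq_π c 1
    rw [map_one, one_mul] at h
    change ⟪_, G.modularAbs (G.modularAbs G.ζ)⟫_ℂ = _ at h
    rw [h, ← G.inner_eq, inner_π]
    simp)
  simpa using this

theorem modularConj_ζ : G.modularConj G.ζ = G.ζ := by
  conv_lhs => rw [← G.modularAbs_ζ]
  rw [modular_apply, S_ζ]

theorem modularConj_modularConj (x : E) : G.modularConj (G.modularConj x) = x := by
  let Pe : E ≃ₗ[ℂ] E := LinearEquiv.ofInjectiveEndo (G.modularAbs : E →ₗ[ℂ] E) G.modularAbs_injective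
  let Q₀ : E →ₗ[ℂ] E :=
    { toFun := fun x => G.modularConj (Pe.symm (G.modularConj.symm x))
      map_add' := by simp
      map_smul' := fun c x => by simp [map_smulₛₗ] }
  let Q : E →L[ℂ] E := LinearMap.toContinuousLinearMap Q₀
  have hQa : ∀ x, Q (G.modularConj (G.modularAbs x)) = G.modularConj x := by
    intro x
    change G.modularConj (Pe.symm (G.modularConj.symm (G.modularConj (Pe x)))) = G.modularConj x
    simp
  have hsurj : ∀ x, ∃ y, G.modularConj (G.modularAbs y) = x := by
    intro x
    obtain ⟨y, hy⟩ := G.modularAbs_surjective (G.modularConj.symm x)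
    exact ⟨y, by simp [hy]⟩
  have hQ : Q.IsPositive := by
    constructor
    · intro x y
      obtain ⟨x, rfl⟩ := hsurj x
      obtain ⟨y, rfl⟩ := hsurj y
      change ⟪Q _, _⟫_ℂ = ⟪_, Q _⟫_ℂ
      rw [hQa, hQa, conj_isometry_inner, conj_isometry_inner]
      exact G.modularAbs_pos.isSymmetric _ _
    · intro x
      obtain ⟨x, rfl⟩ := hsurj x
      change 0 ≤ RCLike.re ⟪Q _, _⟫_ℂ
      rw [hQa, conj_isometry_inner]
      exact G.modularAbs_pos.re_inner_nonneg_left x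
  have key := polar_unique (J := G.modularConj) (J' := G.modularConj.symm) G.modularAbs_pos hQ
    G.modularAbs_surjective (by
      intro x
      obtain ⟨y, rfl⟩ := hsurj x
      rw [hQa, modular_apply, modular_apply, S_S]
      simp)
  conv_lhs => rw [key.1]
  rw [← key.1]
  have := G.modularConj.symm_apply_apply x
  rw [← key.1] at this
  exact this

theorem modularConj_symm : G.modularConj.symm = G.modularConj := by
  ext x
  apply G.modularConj.injective
  simp [modularConj_modularConj]

theorem modularConj_inner (x y : E) : ⟪G.modularConj x, y⟫_ℂ = ⟪G.modularConj y, x⟫_ℂ := by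
  conv_lhs => rw [← G.modularConj_modularConj y]
  rw [conj_isometry_inner]

theorem modularAbs_π {a : N} {s : ℝ} (hs : 0 < s) (ha : G.modularAbs (G.π a G.ζ) = (s : ℂ) • G.π a G.ζ)
    (x : E) : G.modularAbs (G.π a x) = (s : ℂ) • G.π a (G.modularAbs x) := by
  have h1 : ∀ c, μ.toLinearMap (a * c) = ((s ^ 2 : ℝ) : ℂ) * μ.toLinearMap (c * a) := by
    intro c
    have h := G.inner_sq_π (star c) a
    rw [star_star] at h
    rw [← h, ha, map_smul, ha, smul_smul, inner_smul_right, inner_π_π, star_star]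
    push_cast; ring
  have h2 : ∀ x, G.modularAbs (G.modularAbs (G.π a x)) = ((s ^ 2 : ℝ) : ℂ) • G.π a (G.modularAbs (G.modularAbs x)) := by
    intro x
    obtain ⟨d, rfl⟩ := G.orbit.surjective x
    refine G.ext_π fun c => ?_
    rw [orbit_apply, ← π_mul, inner_sq_π, mul_assoc, h1, inner_smul_right]
    congr 1
    rw [← star_star a, ← inner_π, ← π_mul, inner_sq_π, star_mul, mul_assoc, star_star]
  have hsymm : (G.modularAbs : E →ₗ[ℂ] E).IsSymmetric := G.modularAbs_pos.isSymmetric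
  let e := hsymm.eigenvectorBasis rfl
  have he : ∀ i, G.modularAbs (e i) = ((hsymm.eigenvalues rfl i : ℝ) : ℂ) • e i :=
    fun i => hsymm.apply_eigenvectorBasis rfl i
  have hlin : (G.modularAbs ∘L (G.π a)) = (s : ℂ) • ((G.π a) ∘L G.modularAbs) := by
    have : ((G.modularAbs ∘L (G.π a)) : E →ₗ[ℂ] E) = ((s : ℂ) • ((G.π a) ∘L G.modularAbs) : E →L[ℂ] E) := by
      refine e.toBasis.ext fun i => ?_
      rw [OrthonormalBasis.coe_toBasis]
      change G.modularAbs (G.π a (e i)) = (s : ℂ) • G.π a (G.modularAbs (e i))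
      set t := hsymm.eigenvalues rfl i with ht
      have hei := he i
      rw [← ht] at hei
      have hnorm : ‖e i‖ = 1 := e.orthonormal.1 i
      have ht0 : 0 ≤ t := by
        have h := G.modularAbs_pos.re_inner_nonneg_right (e i)
        rw [hei, inner_smul_right, inner_self_eq_norm_sq_to_K, hnorm] at h
        simpa using h
      have htne : t ≠ 0 := by
        intro h0
        rw [h0] at hei
        have : e i = 0 := G.modularAbs_injective (by rw [hei]; simp)
        rw [this] at hnorm
        simp at hnorm
      have htp : 0 < t := lt_of_le_of_ne ht0 (Ne.symm htne)
      rw [apply_eq_of_sq G.modularAbs_pos (mul_pos hs htp), hei, map_smul, smul_smul]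
      · push_cast; rfl
      · rw [h2, hei, map_smul, hei, map_smul, map_smul, smul_smul, smul_smul]
        push_cast; congr 1; ring
    ext x
    exact congrArg (fun f => f x) this
  exact congrArg (fun f => f x) hlin

theorem conj_π_commute (a c : N) (y : E) :
    G.modularConj (G.π a (G.modularConj (G.π c y))) = G.π c (G.modularConj (G.π a (G.modularConj y))) := by
  have hsymm : (G.modularAbs : E →ₗ[ℂ] E).IsSymmetric := G.modularAbs_pos.isSymmetric
  let e := hsymm.eigenvectorBasis rfl
  have he : ∀ i, G.modularAbs (e i) = ((hsymm.eigenvalues rfl i : ℝ) : ℂ) • e i :=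
    fun i => hsymm.apply_eigenvectorBasis rfl i
  have main : ∀ (a : N) (s : ℝ), 0 < s → G.modularAbs (G.π a G.ζ) = (s : ℂ) • G.π a G.ζ → ∀ y,
      G.modularConj (G.π a (G.modularConj (G.π c y))) = G.π c (G.modularConj (G.π a (G.modularConj y))) := by
    intro a s hs ha
    have hS : ∀ x, (s : ℂ) • G.modularConj (G.π a (G.modularConj x)) = G.S (G.π a (G.S x)) := by
      intro x
      rw [← modular_apply, G.modularAbs_π hs ha, map_smulₛₗ]
      have : G.modularAbs (G.S x) = G.modularConj x := by
        apply G.modularConj.injective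
        rw [modular_apply, S_S, modularConj_modularConj]
      rw [this]
      simp
    intro y
    have hs' : (s : ℂ) ≠ 0 := by exact_mod_cast hs.ne'
    apply smul_right_injective E hs'
    change (s : ℂ) • _ = (s : ℂ) • _
    rw [hS, ← map_smul, hS]
    obtain ⟨d, rfl⟩ := G.orbit.surjective y
    rw [orbit_apply, ← π_mul, S_apply, S_apply, ← π_mul, ← π_mul, S_apply, S_apply, ← π_mul]
    simp [mul_assoc]
  revert y
  obtain ⟨x, rfl⟩ := G.orbit.symm.surjective a
  have hx : x ∈ Submodule.span ℂ (Set.range e.toBasis) := by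
    rw [e.toBasis.span_eq]; trivial
  induction hx using Submodule.span_induction with
  | mem x hx =>
    obtain ⟨i, rfl⟩ := hx
    rw [OrthonormalBasis.coe_toBasis]
    have hne : e i ≠ 0 := e.orthonormal.ne_zero i
    set t := hsymm.eigenvalues rfl i with ht
    have hei := he i
    rw [← ht] at hei
    have hnorm : ‖e i‖ = 1 := e.orthonormal.1 i
    have ht0 : 0 ≤ t := by
      have h := G.modularAbs_pos.re_inner_nonneg_right (e i)
      rw [hei, inner_smul_right, inner_self_eq_norm_sq_to_K, hnorm] at h
      simpa using h
    have htne : t ≠ 0 := by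
      intro h0
      rw [h0] at hei
      exact hne (G.modularAbs_injective (by rw [hei]; simp))
    refine main _ t (lt_of_le_of_ne ht0 (Ne.symm htne)) ?_
    rw [π_orbit_symm, hei]
  | zero => intro y; simp
  | add u v _ _ hu hv => intro y; simp [hu, hv]
  | smul k u _ hu => intro y; simp [map_smulₛₗ, hu]

/-- `π^{op}(b^{op}) = J π(b)^* J`. -/
def πop (b : Nᵐᵒᵖ) : E →L[ℂ] E :=
  G.modularConj.toContinuousLinearEquiv.toContinuousLinearMap.comp
    ((adjoint (G.π b.unop)).comp G.modularConj.toContinuousLinearEquiv.toContinuousLinearMap)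

theorem πop_apply (b : Nᵐᵒᵖ) (x : E) : G.πop b x = G.modularConj (adjoint (G.π b.unop) (G.modularConj x)) := rfl


theorem πop_mul (b c : Nᵐᵒᵖ) (x : E) : G.πop (b * c) x = G.πop b (G.πop c x) := by
  simp only [πop_apply, modularConj_modularConj, MulOpposite.unop_mul, map_mul]
  rw [← ContinuousLinearMap.star_eq_adjoint, star_mul]
  rfl

theorem inner_πop (b : Nᵐᵒᵖ) (x y : E) : ⟪G.πop b x, y⟫_ℂ = ⟪x, G.πop (star b) y⟫_ℂ := by
  rw [πop_apply, πop_apply, modularConj_inner, ContinuousLinearMap.adjoint_inner_right]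
  rw [← inner_conj_symm x, modularConj_inner, inner_conj_symm]
  rw [MulOpposite.unop_star, map_star, ContinuousLinearMap.star_eq_adjoint,
    ContinuousLinearMap.adjoint_adjoint, ← inner_conj_symm, ← inner_conj_symm]

theorem πop_π (b : Nᵐᵒᵖ) (a : N) (x : E) :
    G.πop b (G.π a x) = G.π a (G.πop b x) := by
  rw [πop_apply, πop_apply, ← ContinuousLinearMap.star_eq_adjoint, ← map_star, conj_π_commute]

theorem πop_ζ (b : Nᵐᵒᵖ) :
    G.πop b G.ζ = G.modularConj (G.π (star b.unop) G.ζ) := by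
  rw [πop_apply, modularConj_ζ, ← ContinuousLinearMap.star_eq_adjoint, ← map_star]

/-- The linear isomorphism `N^{op} → E`, `b ↦ π^{op}(b)ζ`. -/
def orbitOp : Nᵐᵒᵖ ≃ₗ[ℂ] E where
  toFun b := G.πop b G.ζ
  map_add' b c := by simp [πop_ζ]
  map_smul' k b := by simp [πop_ζ, map_smulₛₗ]
  invFun x := MulOpposite.op (star (G.orbit.symm (G.modularConj x)))
  left_inv b := by
    change MulOpposite.op (star (G.orbit.symm (G.modularConj (G.πop b G.ζ)))) = b
    rw [πop_ζ, modularConj_modularConj, ← orbit_apply]; simp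
  right_inv x := by
    change G.πop (MulOpposite.op (star (G.orbit.symm (G.modularConj x)))) G.ζ = x
    rw [πop_ζ]; simp [π_orbit_symm, modularConj_modularConj]

theorem orbitOp_apply (b : Nᵐᵒᵖ) : G.orbitOp b = G.πop b G.ζ := rfl

end GNSRep

section Hilb
variable {V : Type*} [AddCommGroup V] [Module ℂ V]

/-- A vector space with a positive semidefinite inner product, as a seminormed space. -/
def PreHilb (_c : PreInnerProductSpace.Core ℂ V) : Type _ := V

variable (c : PreInnerProductSpace.Core ℂ V)
instance : SeminormedAddCommGroup (PreHilb c) :=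
  @InnerProductSpace.Core.toSeminormedAddCommGroup ℂ V _ _ _ c
instance : InnerProductSpace ℂ (PreHilb c) := @InnerProductSpace.ofCore ℂ V _ _ _ c

/-- The Hilbert space obtained from a finite-dimensional space with a positive semidefinite inner
product by factoring out the null space of the seminorm. -/
def Hilb : Type _ := SeparationQuotient (PreHilb c)
instance : NormedAddCommGroup (Hilb c) := inferInstanceAs (NormedAddCommGroup (SeparationQuotient (PreHilb c)))
instance : InnerProductSpace ℂ (Hilb c) := inferInstanceAs (InnerProductSpace ℂ (SeparationQuotient (PreHilb c)))

/-- The quotient map. -/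
def Hilb.mk : V →ₗ[ℂ] Hilb c where
  toFun v := (SeparationQuotient.mk : PreHilb c → SeparationQuotient (PreHilb c)) v
  map_add' _ _ := rfl
  map_smul' _ _ := rfl

theorem Hilb.mk_surjective : Function.Surjective (Hilb.mk c) := fun x => Quotient.inductionOn' x fun v => ⟨v, rfl⟩

theorem Hilb.inner_mk (v w : V) : ⟪Hilb.mk c v, Hilb.mk c w⟫_ℂ = c.inner v w := rfl

instance [FiniteDimensional ℂ V] : FiniteDimensional ℂ (Hilb c) :=
  Module.Finite.of_surjective (Hilb.mk c) (Hilb.mk_surjective c)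
instance [FiniteDimensional ℂ V] : CompleteSpace (Hilb c) := FiniteDimensional.complete ℂ _
end Hilb

section pos
variable {E H K : Type*} [NormedAddCommGroup E] [InnerProductSpace ℂ E] [CompleteSpace E]
  [NormedAddCommGroup H] [InnerProductSpace ℂ H] [CompleteSpace H]
  [NormedAddCommGroup K] [InnerProductSpace ℂ K] [CompleteSpace K]

/-- If the operators `x_i^* x_j` commute with the operators `y_k^* y_l`, then
`∑ ⟨z_i | x_i^* x_j y_i^* y_j z_j⟩ ≥ 0`. -/
theorem re_sum_inner_nonneg {ι : Type*} [Fintype ι] (x : ι → E →L[ℂ] H) (y : ι → E →L[ℂ] K)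
    (z : ι → E)
    (hc : ∀ i j k l, Commute (adjoint (x i) ∘L x j) (adjoint (y k) ∘L y l)) :
    0 ≤ (∑ i, ∑ j, ⟪z i, (adjoint (x i) ∘L x j) ((adjoint (y i) ∘L y j) (z j))⟫_ℂ).re := by
  classical
  let F := PiLp 2 (fun _ : ι => E)
  let p : ι → F →L[ℂ] E := fun i => PiLp.proj 2 (fun _ : ι => E) i
  let s : ι → E →L[ℂ] F := fun i => adjoint (p i)
  have hs : ∀ i w, s i w = WithLp.toLp 2 (Pi.single i w) := by
    intro i w
    refine ext_inner_left ℂ fun v => ?_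
    rw [ContinuousLinearMap.adjoint_inner_right, PiLp.inner_apply, Finset.sum_eq_single i]
    · simp only [Pi.single_eq_same]; rfl
    · intro j _ hj; simp [hj]
    · simp
  have hps : ∀ i j w, p i (s j w) = if i = j then w else 0 := by
    intro i j w
    rw [hs]
    change (Pi.single j w : ι → E) i = _
    rw [Pi.single_apply]
  have hsp : ∀ v : F, ∑ i, s i (p i v) = v := by
    intro v
    ext k
    change p k (∑ i, s i (p i v)) = p k v
    rw [map_sum]
    simp [hps]
  let T : F →L[ℂ] H := ∑ j, x j ∘L p j
  let X : F →L[ℂ] F := adjoint T ∘L T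
  have hTs : ∀ j w, T (s j w) = x j w := by
    intro j w
    simp only [T, sum_apply, ContinuousLinearMap.comp_apply, hps]
    rw [Finset.sum_eq_single j] <;> simp +contextual
  have hXs : ∀ i j w, p i (X (s j w)) = (adjoint (x i) ∘L x j) w := by
    intro i j w
    refine ext_inner_left ℂ fun v => ?_
    rw [← ContinuousLinearMap.adjoint_inner_left (p i)]
    change ⟪s i v, adjoint T (T (s j w))⟫_ℂ = ⟪v, adjoint (x i) (x j w)⟫_ℂ
    rw [ContinuousLinearMap.adjoint_inner_right, ContinuousLinearMap.adjoint_inner_right, hTs, hTs]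
  have hX0 : 0 ≤ X := by
    rw [ContinuousLinearMap.nonneg_iff_isPositive]
    exact ContinuousLinearMap.isPositive_adjoint_comp_self T
  let R : F →L[ℂ] F := CFC.sqrt X
  have hRR : R * R = X := CFC.sqrt_mul_sqrt_self X hX0
  have hR0 : 0 ≤ R := CFC.sqrt_nonneg X
  have hRsa : adjoint R = R := by
    have := IsSelfAdjoint.of_nonneg hR0
    exact this
  -- diagonal operators
  let D : (E →L[ℂ] E) → (F →L[ℂ] F) := fun d => ∑ i, s i ∘L d ∘L p i
  have hpD : ∀ d i v, p i (D d v) = d (p i v) := by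
    intro d i v
    simp only [D, sum_apply, ContinuousLinearMap.comp_apply, map_sum, hps]
    simp
  have hDs : ∀ d i v, D d (s i v) = s i (d v) := by
    intro d i v
    simp only [D, sum_apply, ContinuousLinearMap.comp_apply, hps]
    rw [Finset.sum_eq_single i] <;> simp +contextual
  have hFext : ∀ v w : F, (∀ i, p i v = p i w) → v = w := by
    intro v w h
    rw [← hsp v, ← hsp w]; simp only [h]
  have hcomm : ∀ k l, Commute R (D (adjoint (y k) ∘L y l)) := by
    intro k l
    have hXD : Commute X (D (adjoint (y k) ∘L y l)) := by
      ext1 v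
      refine hFext _ _ fun i => ?_
      change p i (X (D _ v)) = p i (D _ (X v))
      rw [hpD]
      conv_lhs => rw [← hsp v]
      conv_rhs => rw [← hsp v]
      simp only [map_sum, hDs, hXs]
      refine Finset.sum_congr rfl fun j _ => ?_
      exact congrArg (fun f => f (p j v)) (hc i j k l)
    have : R = cfc NNReal.sqrt X := CFC.sqrt_eq_cfc
    rw [this]
    exact hXD.cfc_nnreal _
  let u : ι → ι → E := fun l i => p l (R (s i (z i)))
  have key : ∀ i j, ⟪z i, (adjoint (x i) ∘L x j) ((adjoint (y i) ∘L y j) (z j))⟫_ℂ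
      = ∑ l, ⟪y i (u l i), y j (u l j)⟫_ℂ := by
    intro i j
    set d := adjoint (y i) ∘L y j with hd
    rw [← hXs, ← ContinuousLinearMap.adjoint_inner_left (p i), ← hRR]
    change ⟪s i (z i), R (R (s j (d (z j))))⟫_ℂ = _
    rw [← ContinuousLinearMap.adjoint_inner_left, hRsa, ← hDs]
    have : R (D d (s j (z j))) = D d (R (s j (z j))) :=
      congrArg (fun f => f (s j (z j))) (hcomm i j)
    rw [this, PiLp.inner_apply]
    refine Finset.sum_congr rfl fun l _ => ?_
    change ⟪u l i, p l (D d (R (s j (z j))))⟫_ℂ = _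
    rw [hpD, hd]
    change ⟪u l i, adjoint (y i) (y j (u l j))⟫_ℂ = _
    rw [ContinuousLinearMap.adjoint_inner_right]
  have : ∑ i, ∑ j, ⟪z i, (adjoint (x i) ∘L x j) ((adjoint (y i) ∘L y j) (z j))⟫_ℂ
      = ∑ l, ⟪∑ i, y i (u l i), ∑ j, y j (u l j)⟫_ℂ := by
    simp only [key, sum_inner, inner_sum]
    rw [Finset.sum_comm]
    rw [Finset.sum_comm]
    rw [Finset.sum_congr rfl fun i _ => Finset.sum_comm]
    rw [Finset.sum_comm]
    exact Finset.sum_congr rfl fun l _ => Finset.sum_comm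
  rw [this, Complex.re_sum]
  refine Finset.sum_nonneg fun l _ => ?_
  exact inner_self_nonneg (𝕜 := ℂ)
end pos

section forms
variable {P Q M M' W V : Type*} [AddCommGroup P] [Module ℂ P] [AddCommGroup Q] [Module ℂ Q]
  [AddCommGroup M] [Module ℂ M] [AddCommGroup M'] [Module ℂ M'] [AddCommGroup W] [Module ℂ W]
  [AddCommGroup V] [Module ℂ V]

/-- The sesquilinear map `(p ⊗ q, p' ⊗ q') ↦ m(A(p, p'), B(q, q'))`. -/
def pairForm (A : P →ₗ⋆[ℂ] P →ₗ[ℂ] M) (B : Q →ₗ⋆[ℂ] Q →ₗ[ℂ] M') (m : M →ₗ[ℂ] M' →ₗ[ℂ] W) :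
    P ⊗[ℂ] Q →ₗ⋆[ℂ] P ⊗[ℂ] Q →ₗ[ℂ] W :=
  (TensorProduct.lift (TensorProduct.mapBilinear (.id ℂ) P Q M M')).compr₂ (TensorProduct.lift m)
    ∘ₛₗ TensorProduct.map A B

theorem pairForm_tmul (A : P →ₗ⋆[ℂ] P →ₗ[ℂ] M) (B : Q →ₗ⋆[ℂ] Q →ₗ[ℂ] M')
    (m : M →ₗ[ℂ] M' →ₗ[ℂ] W) (p p' : P) (q q' : Q) :
    pairForm A B m (p ⊗ₜ q) (p' ⊗ₜ q') = m (A p p') (B q q') := rfl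

/-- A positive semidefinite Hermitian sesquilinear form as a pre-inner product. -/
@[reducible]
def coreOfForm (B : V →ₗ⋆[ℂ] V →ₗ[ℂ] ℂ) (hs : ∀ v w, starRingEnd ℂ (B w v) = B v w)
    (hp : ∀ v, 0 ≤ (B v v).re) : PreInnerProductSpace.Core ℂ V where
  inner v w := B v w
  conj_inner_symm := hs
  re_inner_nonneg := hp
  add_left u v w := by simp
  smul_left u v c := by simp

variable {Z : Type*} [AddCommGroup Z] [Module ℂ Z]

/-- Two biadditive maps that agree on elementary tensors agree. -/
theorem triple_ext {B B' : (P ⊗[ℂ] Z) ⊗[ℂ] Q → (P ⊗[ℂ] Z) ⊗[ℂ] Q → ℂ}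
    (h₁ : ∀ s t u, B (s + t) u = B s u + B t u) (h₂ : ∀ s t u, B s (t + u) = B s t + B s u)
    (h₁' : ∀ s t u, B' (s + t) u = B' s u + B' t u)
    (h₂' : ∀ s t u, B' s (t + u) = B' s t + B' s u)
    (h : ∀ p z q p' z' q', B (p ⊗ₜ z ⊗ₜ q) (p' ⊗ₜ z' ⊗ₜ q') = B' (p ⊗ₜ z ⊗ₜ q) (p' ⊗ₜ z' ⊗ₜ q'))
    (s t : (P ⊗[ℂ] Z) ⊗[ℂ] Q) : B s t = B' s t := by
  have z₁ : ∀ u, B 0 u = 0 := fun u => by simpa using h₁ 0 0 u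
  have z₂ : ∀ u, B u 0 = 0 := fun u => by simpa using h₂ u 0 0
  have z₁' : ∀ u, B' 0 u = 0 := fun u => by simpa using h₁' 0 0 u
  have z₂' : ∀ u, B' u 0 = 0 := fun u => by simpa using h₂' u 0 0
  induction s using TensorProduct.induction_on with
  | zero => rw [z₁, z₁']
  | add a b ha hb => rw [h₁, h₁', ha, hb]
  | tmul a q =>
    induction a using TensorProduct.induction_on with
    | zero => rw [TensorProduct.zero_tmul, z₁, z₁']
    | add a b ha hb => rw [TensorProduct.add_tmul, h₁, h₁', ha, hb]
    | tmul p z =>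
      induction t using TensorProduct.induction_on with
      | zero => rw [z₂, z₂']
      | add a b ha hb => rw [h₂, h₂', ha, hb]
      | tmul a' q' =>
        induction a' using TensorProduct.induction_on with
        | zero => rw [TensorProduct.zero_tmul, z₂, z₂']
        | add a b ha hb => rw [TensorProduct.add_tmul, h₂, h₂', ha, hb]
        | tmul p' z' => exact h p z q p' z' q'

theorem exists_triple_list (t : (P ⊗[ℂ] Z) ⊗[ℂ] Q) :
    ∃ l : List (P × Z × Q), t = (l.map fun u => (u.1 ⊗ₜ[ℂ] u.2.1) ⊗ₜ[ℂ] u.2.2).sum := by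
  induction t using TensorProduct.induction_on with
  | zero => exact ⟨[], by simp⟩
  | add a b ha hb =>
    obtain ⟨l, rfl⟩ := ha
    obtain ⟨l', rfl⟩ := hb
    exact ⟨l ++ l', by simp⟩
  | tmul a q =>
    induction a using TensorProduct.induction_on with
    | zero => exact ⟨[], by simp⟩
    | add a b ha hb =>
      obtain ⟨l, hl⟩ := ha
      obtain ⟨l', hl'⟩ := hb
      exact ⟨l ++ l', by rw [TensorProduct.add_tmul, hl, hl']; simp⟩
    | tmul p z => exact ⟨[(p, z, q)], by simp⟩

theorem exists_triple_sum (t : (P ⊗[ℂ] Z) ⊗[ℂ] Q) :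
    ∃ (n : ℕ) (p : Fin n → P) (z : Fin n → Z) (q : Fin n → Q),
      t = ∑ i, (p i ⊗ₜ[ℂ] z i) ⊗ₜ[ℂ] q i := by
  obtain ⟨l, rfl⟩ := exists_triple_list t
  refine ⟨l.length, fun i => l[i].1, fun i => l[i].2.1, fun i => l[i].2.2, ?_⟩
  conv_lhs => rw [← List.ofFn_getElem (xs := l)]
  rw [List.map_ofFn, List.sum_ofFn]
  rfl

variable {E H K : Type*} [NormedAddCommGroup E] [InnerProductSpace ℂ E] [CompleteSpace E]
  [NormedAddCommGroup H] [InnerProductSpace ℂ H] [CompleteSpace H]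
  [NormedAddCommGroup K] [InnerProductSpace ℂ K] [CompleteSpace K]

/-- `(p, p') ↦ x(p)^* x(p')` for a linear map `x` into operators. -/
def gram (x : P →ₗ[ℂ] (E →L[ℂ] H)) : P →ₗ⋆[ℂ] P →ₗ[ℂ] (E →L[ℂ] E) :=
  LinearMap.mk₂'ₛₗ (starRingEnd ℂ) (RingHom.id ℂ) (fun p p' => adjoint (x p) ∘L x p')
    (by intros; simp) (by intros; ext; simp [map_smulₛₗ]) (by intros; simp) (by intros; simp)

theorem gram_apply (x : P →ₗ[ℂ] (E →L[ℂ] H)) (p p' : P) :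
    gram x p p' = adjoint (x p) ∘L x p' := rfl

/-- `(z, z') ↦ (T ↦ ⟨z | T z'⟩)`. -/
def vecForm (E : Type*) [NormedAddCommGroup E] [InnerProductSpace ℂ E] :
    E →ₗ⋆[ℂ] E →ₗ[ℂ] ((E →L[ℂ] E) →ₗ[ℂ] ℂ) :=
  LinearMap.mk₂'ₛₗ (starRingEnd ℂ) (RingHom.id ℂ)
    (fun z z' =>
      { toFun := fun T => ⟪z, T z'⟫_ℂ
        map_add' := fun S T => by simp
        map_smul' := fun c T => by simp })
    (by intros; ext; simp) (by intros; ext; simp [mul_comm])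
    (by intros; ext; simp) (by intros; ext; simp)

/-- `(S, f) ↦ (T ↦ f(S T))`. -/
def precompForm (E : Type*) [NormedAddCommGroup E] [InnerProductSpace ℂ E] :
    (E →L[ℂ] E) →ₗ[ℂ] ((E →L[ℂ] E) →ₗ[ℂ] ℂ) →ₗ[ℂ] ((E →L[ℂ] E) →ₗ[ℂ] ℂ) :=
  LinearMap.mk₂ ℂ (fun S f => f ∘ₗ LinearMap.mulLeft ℂ S)
    (by intros; ext; simp [add_mul]) (by intros; ext; simp) (by intros; ext; simp)
    (by intros; ext; simp)

/-- The sesquilinear form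
`⟨p ⊗ z ⊗ q | p' ⊗ z' ⊗ q'⟩ = ⟨z | x(p)^* x(p') y(q)^* y(q') z'⟩`. -/
def tripleForm (x : P →ₗ[ℂ] (E →L[ℂ] H)) (y : Q →ₗ[ℂ] (E →L[ℂ] K)) :
    (P ⊗[ℂ] E) ⊗[ℂ] Q →ₗ⋆[ℂ] (P ⊗[ℂ] E) ⊗[ℂ] Q →ₗ[ℂ] ℂ :=
  pairForm (pairForm (gram x) (vecForm E) (precompForm E)) (gram y) LinearMap.id

theorem tripleForm_tmul (x : P →ₗ[ℂ] (E →L[ℂ] H)) (y : Q →ₗ[ℂ] (E →L[ℂ] K))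
    (p p' : P) (z z' : E) (q q' : Q) :
    tripleForm x y (p ⊗ₜ z ⊗ₜ q) (p' ⊗ₜ z' ⊗ₜ q')
      = ⟪z, adjoint (x p) (x p' (adjoint (y q) (y q' z')))⟫_ℂ := rfl

variable (x : P →ₗ[ℂ] (E →L[ℂ] H)) (y : Q →ₗ[ℂ] (E →L[ℂ] K))

theorem tripleForm_symm (hc : ∀ p p' q q', Commute (gram x p p') (gram y q q')) (s t) :
    starRingEnd ℂ (tripleForm x y t s) = tripleForm x y s t := by
  refine triple_ext (B := fun s t => starRingEnd ℂ (tripleForm x y t s))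
    (B' := fun s t => tripleForm x y s t) (by intros; simp) (by intros; simp) (by intros; simp)
    (by intros; simp) ?_ s t
  intro p z q p' z' q'
  simp only [tripleForm_tmul]
  have h := congrArg (fun f => f z') (hc p p' q q')
  simp only [gram_apply] at h
  change adjoint (x p) (x p' (adjoint (y q) (y q' z')))
    = adjoint (y q) (y q' (adjoint (x p) (x p' z'))) at h
  rw [h, inner_conj_symm, ContinuousLinearMap.adjoint_inner_left,
    ← ContinuousLinearMap.adjoint_inner_right, ContinuousLinearMap.adjoint_inner_left,
    ← ContinuousLinearMap.adjoint_inner_right]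

theorem tripleForm_nonneg (hc : ∀ p p' q q', Commute (gram x p p') (gram y q q')) (t) :
    0 ≤ (tripleForm x y t t).re := by
  obtain ⟨n, p, z, q, rfl⟩ := exists_triple_sum t
  have := re_sum_inner_nonneg (fun i => x (p i)) (fun i => y (q i)) z
    (fun i j k l => hc _ _ _ _)
  simp only [map_sum, LinearMap.sum_apply, tripleForm_tmul]
  rw [Finset.sum_comm]
  exact this
end forms

namespace GNSRep
variable {N : Type*} [CStarAlgebra N] {μ : FaithfulState N}
  {E : Type*} [NormedAddCommGroup E] [InnerProductSpace ℂ E] [CompleteSpace E]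
  [FiniteDimensional ℂ E] (G : GNSRep μ E)
  {H : Type*} [NormedAddCommGroup H] [InnerProductSpace ℂ H] [CompleteSpace H]
  {K : Type*} [NormedAddCommGroup K] [InnerProductSpace ℂ K] [CompleteSpace K]
  {L : Type*} [NormedAddCommGroup L] [InnerProductSpace ℂ L] [CompleteSpace L]
  {M : Type*} [NormedAddCommGroup M] [InnerProductSpace ℂ M] [CompleteSpace M]
  (ρ : Nᵐᵒᵖ →⋆ₐ[ℂ] (H →L[ℂ] H)) (σ : N →⋆ₐ[ℂ] (K →L[ℂ] K))
  (υ : Nᵐᵒᵖ →⋆ₐ[ℂ] (L →L[ℂ] L)) (ω : N →⋆ₐ[ℂ] (M →L[ℂ] M))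

/-- The operators `R^ρ(ξ) : π^{op}(b)ζ ↦ ρ(b)ξ`. -/
def Rop : H →ₗ[ℂ] (E →L[ℂ] H) where
  toFun ξ := LinearMap.toContinuousLinearMap
    { toFun := fun x => ρ (G.orbitOp.symm x) ξ
      map_add' := fun x y => by simp
      map_smul' := fun c x => by simp }
  map_add' ξ η := by ext; simp
  map_smul' c ξ := by ext; simp

/-- The operators `R^σ(η) : π(b)ζ ↦ σ(b)η`. -/
def R : K →ₗ[ℂ] (E →L[ℂ] K) where
  toFun η := LinearMap.toContinuousLinearMap
    { toFun := fun x => σ (G.orbit.symm x) η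
      map_add' := fun x y => by simp
      map_smul' := fun c x => by simp }
  map_add' ξ η := by ext; simp
  map_smul' c ξ := by ext; simp

theorem Rop_apply (ξ : H) (b : Nᵐᵒᵖ) : G.Rop ρ ξ (G.πop b G.ζ) = ρ b ξ := by
  change ρ (G.orbitOp.symm (G.orbitOp b)) ξ = _
  rw [LinearEquiv.symm_apply_apply]

theorem R_apply (η : K) (b : N) : G.R σ η (G.π b G.ζ) = σ b η := by
  change σ (G.orbit.symm (G.orbit b)) η = _
  rw [LinearEquiv.symm_apply_apply]

theorem Rop_πop (ξ : H) (b : Nᵐᵒᵖ) (x : E) : G.Rop ρ ξ (G.πop b x) = ρ b (G.Rop ρ ξ x) := by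
  obtain ⟨c, rfl⟩ := G.orbitOp.surjective x
  rw [orbitOp_apply, ← πop_mul, Rop_apply, Rop_apply, map_mul]; rfl

theorem R_π (η : K) (b : N) (x : E) : G.R σ η (G.π b x) = σ b (G.R σ η x) := by
  obtain ⟨c, rfl⟩ := G.orbit.surjective x
  rw [orbit_apply, ← π_mul, R_apply, R_apply, map_mul]; rfl

theorem gram_Rop_πop (ξ ξ' : H) (b : Nᵐᵒᵖ) (x : E) :
    gram (G.Rop ρ) ξ ξ' (G.πop b x) = G.πop b (gram (G.Rop ρ) ξ ξ' x) := by
  refine ext_inner_left ℂ fun v => ?_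
  change ⟪v, adjoint _ (G.Rop ρ ξ' (G.πop b x))⟫_ℂ = ⟪v, G.πop b (adjoint _ (G.Rop ρ ξ' x))⟫_ℂ
  rw [ContinuousLinearMap.adjoint_inner_right, Rop_πop, ← star_star b, ← inner_πop,
    ContinuousLinearMap.adjoint_inner_right, Rop_πop, map_star,
    ContinuousLinearMap.star_eq_adjoint, ContinuousLinearMap.adjoint_inner_right]

theorem gram_R_π (η η' : K) (b : N) (x : E) :
    gram (G.R σ) η η' (G.π b x) = G.π b (gram (G.R σ) η η' x) := by
  refine ext_inner_left ℂ fun v => ?_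
  change ⟪v, adjoint _ (G.R σ η' (G.π b x))⟫_ℂ = ⟪v, G.π b (adjoint _ (G.R σ η' x))⟫_ℂ
  rw [ContinuousLinearMap.adjoint_inner_right, R_π, ← star_star b, ← inner_π,
    ContinuousLinearMap.adjoint_inner_right, R_π, map_star,
    ContinuousLinearMap.star_eq_adjoint, ContinuousLinearMap.adjoint_inner_right]

theorem gram_commute (ξ ξ' : H) (η η' : K) :
    Commute (gram (G.Rop ρ) ξ ξ') (gram (G.R σ) η η') := by
  obtain ⟨a, ha⟩ := G.orbit.surjective (gram (G.Rop ρ) ξ ξ' G.ζ)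
  have h : gram (G.Rop ρ) ξ ξ' = G.π a := by
    ext x
    obtain ⟨b, rfl⟩ := G.orbitOp.surjective x
    rw [orbitOp_apply, gram_Rop_πop, ← ha, orbit_apply, πop_π]
  rw [h]
  ext x
  exact (G.gram_R_π σ η η' a x).symm

/-- `(S, T) ↦ ⟨S^*ζ | Tζ⟩`. -/
def stateForm : (E →L[ℂ] E) →ₗ[ℂ] (E →L[ℂ] E) →ₗ[ℂ] ℂ :=
  LinearMap.mk₂ ℂ (fun S T => ⟪adjoint S G.ζ, T G.ζ⟫_ℂ)
    (by intros; simp) (by intros; simp [map_smulₛₗ, mul_comm])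
    (by intros; simp) (by intros; simp)

/-- The sesquilinear form
`⟨ξ ⊗ η | ξ' ⊗ η'⟩ = ⟨R^ρ(ξ')^* R^ρ(ξ) ζ | R^σ(η)^* R^σ(η') ζ⟩` on `H ⊗ K`. -/
def relForm : H ⊗[ℂ] K →ₗ⋆[ℂ] H ⊗[ℂ] K →ₗ[ℂ] ℂ :=
  pairForm (gram (G.Rop ρ)) (gram (G.R σ)) G.stateForm

theorem relForm_tmul (ξ ξ' : H) (η η' : K) :
    G.relForm ρ σ (ξ ⊗ₜ η) (ξ' ⊗ₜ η')
      = ⟪adjoint (G.Rop ρ ξ') (G.Rop ρ ξ G.ζ), adjoint (G.R σ η) (G.R σ η' G.ζ)⟫_ℂ := by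
  change ⟪adjoint (adjoint (G.Rop ρ ξ) ∘L G.Rop ρ ξ') G.ζ, _⟫_ℂ = _
  rw [ContinuousLinearMap.adjoint_comp, ContinuousLinearMap.adjoint_adjoint]
  rfl

/-- `ξ ⊗ η ↦ ξ ⊗ ζ ⊗ η`. -/
def insertVec (H K : Type*) [AddCommGroup H] [Module ℂ H] [AddCommGroup K] [Module ℂ K] :
    H ⊗[ℂ] K →ₗ[ℂ] (H ⊗[ℂ] E) ⊗[ℂ] K :=
  LinearMap.rTensor K ((TensorProduct.mk ℂ H E).flip G.ζ)

theorem relForm_eq (s t : H ⊗[ℂ] K) :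
    G.relForm ρ σ s t
      = tripleForm (G.Rop ρ) (G.R σ) (G.insertVec H K s) (G.insertVec H K t) := by
  induction s using TensorProduct.induction_on with
  | zero => simp
  | add a b ha hb => simp [ha, hb]
  | tmul ξ η =>
    induction t using TensorProduct.induction_on with
    | zero => simp
    | add a b ha hb => simp [ha, hb]
    | tmul ξ' η' =>
      change _ = tripleForm (G.Rop ρ) (G.R σ) (ξ ⊗ₜ G.ζ ⊗ₜ η) (ξ' ⊗ₜ G.ζ ⊗ₜ η')
      rw [relForm_tmul, tripleForm_tmul, ContinuousLinearMap.adjoint_inner_left,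
        ContinuousLinearMap.adjoint_inner_right]

/-- The form `relForm` as a pre-inner product on `H ⊗ K`. -/
@[reducible]
def relCore : PreInnerProductSpace.Core ℂ (H ⊗[ℂ] K) :=
  coreOfForm (G.relForm ρ σ)
    (fun s t => by
      rw [relForm_eq, relForm_eq]
      exact tripleForm_symm _ _ (G.gram_commute ρ σ) _ _)
    (fun s => by
      rw [relForm_eq]
      exact tripleForm_nonneg _ _ (G.gram_commute ρ σ) _)

/-- The relative tensor product of `H` and `K` with respect to `μ`, `ρ`, `σ`. -/
abbrev RelTensor : Type _ := Hilb (G.relCore ρ σ)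

/-- The image of `ξ ⊗ η` in the relative tensor product. -/
def rtmul (ξ : H) (η : K) : G.RelTensor ρ σ := Hilb.mk (G.relCore ρ σ) (ξ ⊗ₜ η)

theorem inner_rtmul (ξ ξ' : H) (η η' : K) :
    ⟪G.rtmul ρ σ ξ η, G.rtmul ρ σ ξ' η'⟫_ℂ
      = ⟪adjoint (G.Rop ρ ξ') (G.Rop ρ ξ G.ζ), adjoint (G.R σ η) (G.R σ η' G.ζ)⟫_ℂ := by
  rw [rtmul, rtmul, Hilb.inner_mk]
  exact G.relForm_tmul ρ σ ξ ξ' η η'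

theorem rel_eq_zero {x : G.RelTensor ρ σ} (h : ∀ ξ η, ⟪G.rtmul ρ σ ξ η, x⟫_ℂ = 0) : x = 0 := by
  rw [← inner_self_eq_zero (𝕜 := ℂ)]
  suffices ∀ y : G.RelTensor ρ σ, ⟪y, x⟫_ℂ = 0 from this x
  intro y
  obtain ⟨t, rfl⟩ := Hilb.mk_surjective _ y
  induction t using TensorProduct.induction_on with
  | zero => simp
  | add a b ha hb => rw [map_add, inner_add_left, ha, hb, add_zero]
  | tmul ξ η => exact h ξ η

variable {ρ υ} in
theorem Rop_intertwine {X : H →L[ℂ] L} (hX : ∀ n, X ∘L ρ n = υ n ∘L X) (ξ : H) :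
    G.Rop υ (X ξ) = X ∘L G.Rop ρ ξ := by
  ext x
  obtain ⟨b, rfl⟩ := G.orbitOp.surjective x
  rw [orbitOp_apply, Rop_apply, ContinuousLinearMap.comp_apply, Rop_apply]
  exact congrArg (fun f => f ξ) (hX b).symm

variable {σ ω} in
theorem R_intertwine {Y : K →L[ℂ] M} (hY : ∀ n, Y ∘L σ n = ω n ∘L Y) (η : K) :
    G.R ω (Y η) = Y ∘L G.R σ η := by
  ext x
  obtain ⟨b, rfl⟩ := G.orbit.surjective x
  rw [orbit_apply, R_apply, ContinuousLinearMap.comp_apply, R_apply]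
  exact congrArg (fun f => f η) (hY b).symm

end GNSRep

theorem exists_clm_of_surjective {V W X : Type*} [AddCommGroup V] [Module ℂ V]
    [NormedAddCommGroup W] [NormedSpace ℂ W] [FiniteDimensional ℂ W]
    [NormedAddCommGroup X] [NormedSpace ℂ X] (f : V →ₗ[ℂ] W) (hf : Function.Surjective f)
    (g : V →ₗ[ℂ] X) (h : ∀ v, f v = 0 → g v = 0) : ∃ T : W →L[ℂ] X, ∀ v, T (f v) = g v := by
  obtain ⟨s, hs⟩ := f.exists_rightInverse_of_surjective (LinearMap.range_eq_top.mpr hf)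
  refine ⟨LinearMap.toContinuousLinearMap (g ∘ₗ s), fun v => ?_⟩
  change g (s (f v)) = g v
  rw [← sub_eq_zero, ← map_sub]
  apply h
  have : f (s (f v)) = f v := congrArg (fun k => k (f v)) hs
  rw [map_sub, this, sub_self]

theorem adjoint_intertwine {n H L : Type*} [Star n]
    [NormedAddCommGroup H] [InnerProductSpace ℂ H] [CompleteSpace H]
    [NormedAddCommGroup L] [InnerProductSpace ℂ L] [CompleteSpace L]
    {ρ : n → (H →L[ℂ] H)} {υ : n → (L →L[ℂ] L)} (hρ : ∀ x, ρ (star x) = adjoint (ρ x))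
    (hυ : ∀ x, υ (star x) = adjoint (υ x)) {X : H →L[ℂ] L}
    (hX : ∀ x, X ∘L ρ (star x) = υ (star x) ∘L X) (x : n) :
    adjoint X ∘L υ x = ρ x ∘L adjoint X := by
  have h := congrArg adjoint (hX x)
  rw [hρ, hυ, ContinuousLinearMap.adjoint_comp, ContinuousLinearMap.adjoint_comp,
    ContinuousLinearMap.adjoint_adjoint, ContinuousLinearMap.adjoint_adjoint] at h
  exact h.symm

namespace GNSRep
variable {N : Type*} [CStarAlgebra N] {μ : FaithfulState N}
  {E : Type*} [NormedAddCommGroup E] [InnerProductSpace ℂ E] [CompleteSpace E]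
  [FiniteDimensional ℂ E] (G : GNSRep μ E)
  {H : Type*} [NormedAddCommGroup H] [InnerProductSpace ℂ H] [CompleteSpace H]
  [FiniteDimensional ℂ H]
  {K : Type*} [NormedAddCommGroup K] [InnerProductSpace ℂ K] [CompleteSpace K]
  [FiniteDimensional ℂ K]
  {L : Type*} [NormedAddCommGroup L] [InnerProductSpace ℂ L] [CompleteSpace L]
  {M : Type*} [NormedAddCommGroup M] [InnerProductSpace ℂ M] [CompleteSpace M]
  {ρ : Nᵐᵒᵖ →⋆ₐ[ℂ] (H →L[ℂ] H)} {σ : N →⋆ₐ[ℂ] (K →L[ℂ] K)}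
  {υ : Nᵐᵒᵖ →⋆ₐ[ℂ] (L →L[ℂ] L)} {ω : N →⋆ₐ[ℂ] (M →L[ℂ] M)}

theorem exists_relMap {X : H →L[ℂ] L} {Y : K →L[ℂ] M} (hX : ∀ n, X ∘L ρ n = υ n ∘L X)
    (hY : ∀ n, Y ∘L σ n = ω n ∘L Y) :
    ∃ Z : G.RelTensor ρ σ →L[ℂ] G.RelTensor υ ω,
      ∀ ξ η, Z (G.rtmul ρ σ ξ η) = G.rtmul υ ω (X ξ) (Y η) := by
  have hX' : ∀ n, adjoint X ∘L υ n = ρ n ∘L adjoint X :=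
    adjoint_intertwine (fun x => map_star ρ x) (fun x => map_star υ x) (fun x => hX _)
  have hY' : ∀ n, adjoint Y ∘L ω n = σ n ∘L adjoint Y :=
    adjoint_intertwine (fun x => map_star σ x) (fun x => map_star ω x) (fun x => hY _)
  obtain ⟨Z, hZ⟩ := exists_clm_of_surjective (Hilb.mk (G.relCore ρ σ)) (Hilb.mk_surjective _)
    (Hilb.mk (G.relCore υ ω) ∘ₗ TensorProduct.map (X : H →ₗ[ℂ] L) (Y : K →ₗ[ℂ] M)) (by
      intro v hv
      refine G.rel_eq_zero υ ω fun ξ' η' => ?_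
      have key : ⟪G.rtmul υ ω ξ' η', (Hilb.mk (G.relCore υ ω) ∘ₗ
          TensorProduct.map (X : H →ₗ[ℂ] L) (Y : K →ₗ[ℂ] M)) v⟫_ℂ
          = ⟪G.rtmul ρ σ (adjoint X ξ') (adjoint Y η'), Hilb.mk (G.relCore ρ σ) v⟫_ℂ := by
        clear hv
        induction v using TensorProduct.induction_on with
        | zero => simp
        | add a b ha hb => rw [map_add, inner_add_right, ha, hb, map_add, inner_add_right]
        | tmul ξ η =>
          change ⟪G.rtmul υ ω ξ' η', G.rtmul υ ω (X ξ) (Y η)⟫_ℂ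
            = ⟪G.rtmul ρ σ (adjoint X ξ') (adjoint Y η'), G.rtmul ρ σ ξ η⟫_ℂ
          rw [inner_rtmul, inner_rtmul, G.Rop_intertwine hX, G.Rop_intertwine hX',
            G.R_intertwine hY, G.R_intertwine hY', ContinuousLinearMap.adjoint_comp,
            ContinuousLinearMap.adjoint_comp, ContinuousLinearMap.adjoint_adjoint]
          rfl
      rw [key, hv, inner_zero_right])
  exact ⟨Z, fun ξ η => hZ (ξ ⊗ₜ η)⟩

variable (ρ σ υ ω) in
open Classical in
/-- The operator `ξ ⊗ η ↦ Xξ ⊗ Yη` between relative tensor products, for `X` and `Y` intertwining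
the given representations (and `0` if they do not). -/
def relMap (X : H →L[ℂ] L) (Y : K →L[ℂ] M) : G.RelTensor ρ σ →L[ℂ] G.RelTensor υ ω :=
  if h : (∀ n, X ∘L ρ n = υ n ∘L X) ∧ (∀ n, Y ∘L σ n = ω n ∘L Y) then
    (G.exists_relMap h.1 h.2).choose
  else 0

theorem relMap_rtmul {X : H →L[ℂ] L} {Y : K →L[ℂ] M} (hX : ∀ n, X ∘L ρ n = υ n ∘L X)
    (hY : ∀ n, Y ∘L σ n = ω n ∘L Y) (ξ : H) (η : K) :
    G.relMap ρ σ υ ω X Y (G.rtmul ρ σ ξ η) = G.rtmul υ ω (X ξ) (Y η) := by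
  rw [relMap, dif_pos ⟨hX, hY⟩]
  exact (G.exists_relMap hX hY).choose_spec ξ η

/-- The fiber product of `A` and `B` with respect to `μ`, `ρ`, `σ`: the commutant of all operators
`S ⊗ T` with `S ∈ A'` and `T ∈ B'`. -/
def fiberProduct {A : StarSubalgebra ℂ (H →L[ℂ] H)} {B : StarSubalgebra ℂ (K →L[ℂ] K)}
    (ρ : Nᵐᵒᵖ →⋆ₐ[ℂ] A) (σ : N →⋆ₐ[ℂ] B) :
    StarSubalgebra ℂ (G.RelTensor (A.subtype.comp ρ) (B.subtype.comp σ) →L[ℂ]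
      G.RelTensor (A.subtype.comp ρ) (B.subtype.comp σ)) :=
  StarSubalgebra.centralizer ℂ
    {Z | ∃ S ∈ StarSubalgebra.centralizer ℂ (A : Set (H →L[ℂ] H)),
      ∃ T ∈ StarSubalgebra.centralizer ℂ (B : Set (K →L[ℂ] K)),
        Z = G.relMap (A.subtype.comp ρ) (B.subtype.comp σ) (A.subtype.comp ρ) (B.subtype.comp σ)
          S T}

end GNSRep

/-- A `C^*`-base `(𝔥, B, B†)` on a finite-dimensional Hilbert space `𝔥`: two commuting nondegenerate
`C^*`-algebras of operators. In finite dimension, these are the commuting `*`-subalgebras containing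
the identity. -/
structure CStarBase (𝔥 : Type*) [NormedAddCommGroup 𝔥] [InnerProductSpace ℂ 𝔥]
    [CompleteSpace 𝔥] where
  B : StarSubalgebra ℂ (𝔥 →L[ℂ] 𝔥)
  Bd : StarSubalgebra ℂ (𝔥 →L[ℂ] 𝔥)
  comm : ∀ b ∈ B, ∀ c ∈ Bd, Commute b c

namespace CStarBase
variable {𝔥 : Type*} [NormedAddCommGroup 𝔥] [InnerProductSpace ℂ 𝔥] [CompleteSpace 𝔥]

/-- The base `(𝔥, B†, B)`. -/
def flip (𝔟 : CStarBase 𝔥) : CStarBase 𝔥 where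
  B := 𝔟.Bd
  Bd := 𝔟.B
  comm b hb c hc := (𝔟.comm c hc b hb).symm

/-- A vector that is cyclic for `B` and for `B†`. -/
def IsBicyclic (𝔟 : CStarBase 𝔥) (ζ : 𝔥) : Prop :=
  Submodule.span ℂ {v | ∃ b ∈ 𝔟.B, v = b ζ} = ⊤ ∧ Submodule.span ℂ {v | ∃ b ∈ 𝔟.Bd, v = b ζ} = ⊤

end CStarBase

/-- A `C^*`-factorization of `H` with respect to `(𝔥, B, B†)`, for finite-dimensional `𝔥` and `H`
(so that linear spans are closed). -/
structure CFact {𝔥 : Type*} [NormedAddCommGroup 𝔥] [InnerProductSpace ℂ 𝔥] [CompleteSpace 𝔥]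
    (𝔟 : CStarBase 𝔥) (H : Type*) [NormedAddCommGroup H] [InnerProductSpace ℂ H]
    [CompleteSpace H] where
  space : Submodule ℂ (𝔥 →L[ℂ] H)
  span_star_mul : Submodule.span ℂ {T | ∃ ξ ∈ space, ∃ ξ' ∈ space, T = adjoint ξ ∘L ξ'}
    = Subalgebra.toSubmodule 𝔟.B.toSubalgebra
  span_mul : Submodule.span ℂ {T | ∃ ξ ∈ space, ∃ b ∈ 𝔟.B, T = ξ ∘L b} = space
  span_apply : Submodule.span ℂ {v | ∃ ξ ∈ space, ∃ z, v = ξ z} = ⊤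

section spatial
variable {𝔥 : Type*} [NormedAddCommGroup 𝔥] [InnerProductSpace ℂ 𝔥] [CompleteSpace 𝔥]
  {𝔟 : CStarBase 𝔥}
  {H : Type*} [NormedAddCommGroup H] [InnerProductSpace ℂ H] [CompleteSpace H]
  {K : Type*} [NormedAddCommGroup K] [InnerProductSpace ℂ K] [CompleteSpace K]
  {L : Type*} [NormedAddCommGroup L] [InnerProductSpace ℂ L] [CompleteSpace L]
  {M : Type*} [NormedAddCommGroup M] [InnerProductSpace ℂ M] [CompleteSpace M]

namespace CFact

theorem star_mul_mem (α : CFact 𝔟 H) {ξ ξ' : 𝔥 →L[ℂ] H} (h : ξ ∈ α.space) (h' : ξ' ∈ α.space) :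
    adjoint ξ ∘L ξ' ∈ 𝔟.B := by
  have : adjoint ξ ∘L ξ' ∈ Subalgebra.toSubmodule 𝔟.B.toSubalgebra := by
    rw [← α.span_star_mul]
    exact Submodule.subset_span ⟨ξ, h, ξ', h', rfl⟩
  exact this

/-- The elements of `α`, as a type. -/
def Elt (α : CFact 𝔟 H) : Type _ := α.space

instance (α : CFact 𝔟 H) : AddCommGroup α.Elt := inferInstanceAs (AddCommGroup α.space)

instance (α : CFact 𝔟 H) : Module ℂ α.Elt := inferInstanceAs (Module ℂ α.space)

instance (α : CFact 𝔟 H) [FiniteDimensional ℂ 𝔥] [FiniteDimensional ℂ H] :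
    FiniteDimensional ℂ α.Elt := inferInstanceAs (FiniteDimensional ℂ α.space)

/-- The inclusion of `α` into the operators `𝔥 → H`. -/
def op (α : CFact 𝔟 H) : α.Elt →ₗ[ℂ] (𝔥 →L[ℂ] H) := α.space.subtype

/-- An operator in `α`, as an element of `α`. -/
def elt (α : CFact 𝔟 H) (ξ : 𝔥 →L[ℂ] H) (h : ξ ∈ α.space) : α.Elt := ⟨ξ, h⟩

theorem op_mem (α : CFact 𝔟 H) (ξ : α.Elt) : α.op ξ ∈ α.space := ξ.2

theorem op_elt (α : CFact 𝔟 H) {ξ : 𝔥 →L[ℂ] H} (h : ξ ∈ α.space) : α.op (α.elt ξ h) = ξ := rfl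

theorem op_injective (α : CFact 𝔟 H) : Function.Injective α.op := α.space.subtype_injective

/-- The evaluation map `ξ ⊗ z ↦ ξ z`. -/
def eval (α : CFact 𝔟 H) : α.Elt ⊗[ℂ] 𝔥 →ₗ[ℂ] H :=
  TensorProduct.lift (ContinuousLinearMap.coeLM ℂ ∘ₗ α.op)

theorem eval_tmul (α : CFact 𝔟 H) (ξ : α.Elt) (z : 𝔥) :
    α.eval (ξ ⊗ₜ z) = (α.op ξ) z := rfl

theorem eval_surjective (α : CFact 𝔟 H) : Function.Surjective α.eval := by
  rw [← LinearMap.range_eq_top, eq_top_iff, ← α.span_apply, Submodule.span_le]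
  rintro _ ⟨ξ, hξ, z, rfl⟩
  exact ⟨(α.elt ξ hξ) ⊗ₜ z, rfl⟩

theorem ext_eval (α : CFact 𝔟 H) {x y : H}
    (h : ∀ ξ ∈ α.space, ∀ z, ⟪ξ z, x⟫_ℂ = ⟪ξ z, y⟫_ℂ) : x = y := by
  refine ext_inner_left ℂ fun v => ?_
  obtain ⟨t, rfl⟩ := α.eval_surjective v
  induction t using TensorProduct.induction_on with
  | zero => simp
  | add a b ha hb => rw [map_add, inner_add_left, inner_add_left, ha, hb]
  | tmul ξ z => exact h _ (α.op_mem ξ) z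

theorem exists_rep [FiniteDimensional ℂ H] (α : CFact 𝔟 H) {b : 𝔥 →L[ℂ] 𝔥} (hb : b ∈ 𝔟.Bd) :
    ∃ T : H →L[ℂ] H, ∀ ξ ∈ α.space, T ∘L ξ = ξ ∘L b := by
  obtain ⟨T, hT⟩ := exists_clm_of_surjective α.eval α.eval_surjective
    (α.eval ∘ₗ LinearMap.lTensor α.Elt (b : 𝔥 →ₗ[ℂ] 𝔥)) (by
      intro v hv
      refine α.ext_eval fun ξ' hξ' z' => ?_
      have key : ⟪ξ' z', α.eval (LinearMap.lTensor α.Elt (b : 𝔥 →ₗ[ℂ] 𝔥) v)⟫_ℂ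
          = ⟪z', b (adjoint ξ' (α.eval v))⟫_ℂ := by
        clear hv
        induction v using TensorProduct.induction_on with
        | zero => simp
        | add u w hu hw =>
          rw [map_add, map_add, inner_add_right, hu, hw, map_add, map_add, map_add,
            inner_add_right]
        | tmul ξ z =>
          have h := congrArg (fun f => f z) (𝔟.comm _ (α.star_mul_mem hξ' (α.op_mem ξ)) b hb)
          change adjoint ξ' ((α.op ξ) (b z)) = b (adjoint ξ' ((α.op ξ) z)) at h
          rw [eval_tmul, ← h, ContinuousLinearMap.adjoint_inner_right]
          rfl
      rw [LinearMap.comp_apply, key, hv]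
      simp)
  refine ⟨T, fun ξ hξ => ?_⟩
  ext z
  exact hT ((α.elt ξ hξ) ⊗ₜ z)

open Classical in
/-- The representation `ρ_α` of `B†` on `H`, given by `ρ_α(b†) ξ z = ξ b† z` for `ξ ∈ α`, `z ∈ 𝔥`
(and by `0` on operators outside of `B†`). -/
def rep [FiniteDimensional ℂ H] (α : CFact 𝔟 H) (b : 𝔥 →L[ℂ] 𝔥) : H →L[ℂ] H :=
  if h : b ∈ 𝔟.Bd then (α.exists_rep h).choose else 0

theorem rep_comp [FiniteDimensional ℂ H] (α : CFact 𝔟 H) {b : 𝔥 →L[ℂ] 𝔥} (hb : b ∈ 𝔟.Bd)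
    {ξ : 𝔥 →L[ℂ] H} (hξ : ξ ∈ α.space) : α.rep b ∘L ξ = ξ ∘L b := by
  rw [rep, dif_pos hb]
  exact (α.exists_rep hb).choose_spec ξ hξ

/-- `α` is a `C^*`-factorization of the algebra `A`: the image of `ρ_α` is contained in `A`. -/
def IsFactOf [FiniteDimensional ℂ H] (α : CFact 𝔟 H) (A : StarSubalgebra ℂ (H →L[ℂ] H)) : Prop :=
  ∀ b ∈ 𝔟.Bd, α.rep b ∈ A

variable (α : CFact 𝔟 H) (β : CFact 𝔟.flip K) (γ : CFact 𝔟 L) (δ : CFact 𝔟.flip M)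

theorem gram_commute (ξ ξ' : α.Elt) (η η' : β.Elt) :
    Commute (gram α.op ξ ξ') (gram β.op η η') :=
  𝔟.comm _ (α.star_mul_mem (α.op_mem ξ) (α.op_mem ξ')) _
    (β.star_mul_mem (β.op_mem η) (β.op_mem η'))

/-- The pre-inner product
`⟨ξ ⊗ z ⊗ η | ξ' ⊗ z' ⊗ η'⟩ = ⟨z | (ξ^* ξ') (η^* η') z'⟩` on `α ⊗ 𝔥 ⊗ β`. -/
@[reducible]
def tensorCore : PreInnerProductSpace.Core ℂ ((α.Elt ⊗[ℂ] 𝔥) ⊗[ℂ] β.Elt) :=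
  coreOfForm (tripleForm α.op β.op)
    (tripleForm_symm _ _ (gram_commute α β)) (tripleForm_nonneg _ _ (gram_commute α β))

/-- The `C^*`-relative tensor product of `H` and `K`: the internal tensor product of
`α`, `𝔥` and `β`. -/
abbrev Tensor : Type _ := Hilb (tensorCore α β)

/-- The elementary tensor `ξ ⊗ z ⊗ η`. -/
def tmul (ξ : α.Elt) (z : 𝔥) (η : β.Elt) : Tensor α β :=
  Hilb.mk (tensorCore α β) (ξ ⊗ₜ z ⊗ₜ η)

variable {α β}

theorem inner_tmul (ξ ξ' : α.Elt) (z z' : 𝔥) (η η' : β.Elt) :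
    ⟪tmul α β ξ z η, tmul α β ξ' z' η'⟫_ℂ
      = ⟪z, adjoint (α.op ξ) ((α.op ξ')
          (adjoint (β.op η) ((β.op η') z')))⟫_ℂ := rfl

theorem inner_tmul' (ξ ξ' : α.Elt) (z z' : 𝔥) (η η' : β.Elt) :
    ⟪tmul α β ξ z η, tmul α β ξ' z' η'⟫_ℂ
      = ⟪z, adjoint (β.op η) ((β.op η')
          (adjoint (α.op ξ) ((α.op ξ') z')))⟫_ℂ := by
  rw [inner_tmul]
  exact congrArg (fun f : 𝔥 →L[ℂ] 𝔥 => ⟪z, f z'⟫_ℂ) (gram_commute α β ξ ξ' η η')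

theorem tensor_eq_zero {x : Tensor α β} (h : ∀ ξ z η, ⟪tmul α β ξ z η, x⟫_ℂ = 0) : x = 0 := by
  rw [← inner_self_eq_zero (𝕜 := ℂ)]
  suffices ∀ y : Tensor α β, ⟪y, x⟫_ℂ = 0 from this x
  intro y
  obtain ⟨t, rfl⟩ := Hilb.mk_surjective _ y
  induction t using TensorProduct.induction_on with
  | zero => simp
  | add a b ha hb => rw [map_add, inner_add_left, ha, hb, add_zero]
  | tmul a η =>
    induction a using TensorProduct.induction_on with
    | zero => simp
    | add a b ha hb => rw [TensorProduct.add_tmul, map_add, inner_add_left, ha, hb, add_zero]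
    | tmul ξ z => exact h ξ z η

theorem exists_ket₁ [FiniteDimensional ℂ K] (ξ : α.Elt) :
    ∃ T : K →L[ℂ] Tensor α β, ∀ (z : 𝔥) (η : β.Elt),
      T ((β.op η) z) = tmul α β ξ z η := by
  let g : β.Elt ⊗[ℂ] 𝔥 →ₗ[ℂ] Tensor α β :=
    Hilb.mk (tensorCore α β) ∘ₗ
      (LinearMap.rTensor β.Elt (TensorProduct.mk ℂ α.Elt 𝔥 ξ)) ∘ₗ
        (TensorProduct.comm ℂ β.Elt 𝔥).toLinearMap
  have hg : ∀ η z, g (η ⊗ₜ z) = tmul α β ξ z η := fun η z => rfl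
  obtain ⟨T, hT⟩ := exists_clm_of_surjective β.eval β.eval_surjective g (by
    intro v hv
    refine tensor_eq_zero fun ξ' z' η' => ?_
    have key : ⟪tmul α β ξ' z' η', g v⟫_ℂ
        = ⟪z', adjoint (α.op ξ') ((α.op ξ)
          (adjoint (β.op η') (β.eval v)))⟫_ℂ := by
      clear hv
      induction v using TensorProduct.induction_on with
      | zero => simp
      | add u w hu hw => simp only [map_add, inner_add_right, hu, hw]
      | tmul η z => rw [hg, inner_tmul, eval_tmul]
    rw [key, hv]
    simp)
  exact ⟨T, fun z η => hT (η ⊗ₜ z)⟩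

theorem exists_ket₂ [FiniteDimensional ℂ H] (η : β.Elt) :
    ∃ T : H →L[ℂ] Tensor α β, ∀ (z : 𝔥) (ξ : α.Elt),
      T ((α.op ξ) z) = tmul α β ξ z η := by
  let g : α.Elt ⊗[ℂ] 𝔥 →ₗ[ℂ] Tensor α β :=
    Hilb.mk (tensorCore α β) ∘ₗ (TensorProduct.mk ℂ (α.Elt ⊗[ℂ] 𝔥) β.Elt).flip η
  have hg : ∀ ξ z, g (ξ ⊗ₜ z) = tmul α β ξ z η := fun ξ z => rfl
  obtain ⟨T, hT⟩ := exists_clm_of_surjective α.eval α.eval_surjective g (by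
    intro v hv
    refine tensor_eq_zero fun ξ' z' η' => ?_
    have key : ⟪tmul α β ξ' z' η', g v⟫_ℂ
        = ⟪z', adjoint (β.op η') ((β.op η)
          (adjoint (α.op ξ') (α.eval v)))⟫_ℂ := by
      clear hv
      induction v using TensorProduct.induction_on with
      | zero => simp
      | add u w hu hw => simp only [map_add, inner_add_right, hu, hw]
      | tmul ξ z => rw [hg, inner_tmul', eval_tmul]
    rw [key, hv]
    simp)
  exact ⟨T, fun z ξ => hT (ξ ⊗ₜ z)⟩

/-- The operator `|ξ⟩₁ : K → H ⊗ K`, `ηz ↦ ξ ⊗ z ⊗ η`. -/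
def ket₁ [FiniteDimensional ℂ K] (ξ : α.Elt) : K →L[ℂ] Tensor α β := (exists_ket₁ ξ).choose

/-- The operator `|η⟩₂ : H → H ⊗ K`, `ξz ↦ ξ ⊗ z ⊗ η`. -/
def ket₂ [FiniteDimensional ℂ H] (η : β.Elt) : H →L[ℂ] Tensor α β := (exists_ket₂ η).choose

theorem ket₁_apply [FiniteDimensional ℂ K] (ξ : α.Elt) (z : 𝔥) (η : β.Elt) :
    ket₁ (β := β) ξ ((β.op η) z) = tmul α β ξ z η := (exists_ket₁ ξ).choose_spec z η

theorem ket₂_apply [FiniteDimensional ℂ H] (ξ : α.Elt) (z : 𝔥) (η : β.Elt) :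
    ket₂ (α := α) η ((α.op ξ) z) = tmul α β ξ z η := (exists_ket₂ η).choose_spec z ξ

variable {γ δ}

/-- `X` maps `α` to `γ` and `X^*` maps `γ` to `α`. -/
def Compatible {𝔟 : CStarBase 𝔥} (α : CFact 𝔟 H) (γ : CFact 𝔟 L) (X : H →L[ℂ] L) : Prop :=
  (∀ ξ ∈ α.space, X ∘L ξ ∈ γ.space) ∧ ∀ ξ ∈ γ.space, adjoint X ∘L ξ ∈ α.space

/-- The map `α → γ`, `ξ ↦ Xξ`. -/
def push {𝔟 : CStarBase 𝔥} {α : CFact 𝔟 H} {γ : CFact 𝔟 L} (X : H →L[ℂ] L)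
    (h : ∀ ξ ∈ α.space, X ∘L ξ ∈ γ.space) : α.Elt →ₗ[ℂ] γ.Elt where
  toFun ξ := γ.elt (X ∘L α.op ξ) (h _ (α.op_mem ξ))
  map_add' ξ ξ' := γ.op_injective (by simp [op_elt])
  map_smul' c ξ := γ.op_injective (by simp [op_elt])

theorem exists_tensorMap [FiniteDimensional ℂ 𝔥] [FiniteDimensional ℂ H] [FiniteDimensional ℂ K]
    {X : H →L[ℂ] L} {Y : K →L[ℂ] M} (hX : Compatible α γ X) (hY : Compatible β δ Y) :
    ∃ Z : Tensor α β →L[ℂ] Tensor γ δ, ∀ ξ z η,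
      Z (tmul α β ξ z η) = tmul γ δ (push X hX.1 ξ) z (push Y hY.1 η) := by
  let g₀ : (α.Elt ⊗[ℂ] 𝔥) ⊗[ℂ] β.Elt →ₗ[ℂ] (γ.Elt ⊗[ℂ] 𝔥) ⊗[ℂ] δ.Elt :=
    TensorProduct.map (LinearMap.rTensor 𝔥 (push X hX.1)) (push Y hY.1)
  let g : (α.Elt ⊗[ℂ] 𝔥) ⊗[ℂ] β.Elt →ₗ[ℂ] Tensor γ δ := Hilb.mk (tensorCore γ δ) ∘ₗ g₀
  have hg : ∀ ξ z η, g (ξ ⊗ₜ z ⊗ₜ η) = tmul γ δ (push X hX.1 ξ) z (push Y hY.1 η) :=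
    fun ξ z η => rfl
  obtain ⟨Z, hZ⟩ := exists_clm_of_surjective (Hilb.mk (tensorCore α β)) (Hilb.mk_surjective _) g (by
    intro v hv
    refine tensor_eq_zero fun ξ' z' η' => ?_
    have key : ⟪tmul γ δ ξ' z' η', g v⟫_ℂ
        = ⟪tmul α β (push _ hX.2 ξ') z' (push _ hY.2 η'), Hilb.mk (tensorCore α β) v⟫_ℂ := by
      clear hv
      induction v using TensorProduct.induction_on with
      | zero => simp
      | add u w hu hw => simp only [map_add, inner_add_right, hu, hw]
      | tmul a η =>
        induction a using TensorProduct.induction_on with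
        | zero => simp
        | add u w hu hw => simp only [map_add, TensorProduct.add_tmul, inner_add_right, hu, hw]
        | tmul ξ z =>
          change ⟪_, tmul γ δ (push X hX.1 ξ) z (push Y hY.1 η)⟫_ℂ
            = ⟪_, tmul α β ξ z η⟫_ℂ
          rw [inner_tmul, inner_tmul]
          change ⟪z', adjoint (γ.op ξ') (X ((α.op ξ)
              (adjoint (δ.op η') (Y ((β.op η) z)))))⟫_ℂ
            = ⟪z', adjoint (adjoint X ∘L (γ.op ξ')) ((α.op ξ)
              (adjoint (adjoint Y ∘L (δ.op η')) ((β.op η) z)))⟫_ℂ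
          rw [ContinuousLinearMap.adjoint_comp, ContinuousLinearMap.adjoint_comp,
            ContinuousLinearMap.adjoint_adjoint, ContinuousLinearMap.adjoint_adjoint]
          rfl
    rw [key, hv, inner_zero_right])
  exact ⟨Z, fun ξ z η => hZ (ξ ⊗ₜ z ⊗ₜ η)⟩

open Classical in
variable (α β γ δ) in
/-- The operator `ξ ⊗ z ⊗ η ↦ Xξ ⊗ z ⊗ Yη` between `C^*`-relative tensor products, for `X` and `Y`
that are compatible with the factorizations (and `0` if they are not). -/
def tensorMap [FiniteDimensional ℂ 𝔥] [FiniteDimensional ℂ H] [FiniteDimensional ℂ K]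
    (X : H →L[ℂ] L) (Y : K →L[ℂ] M) : Tensor α β →L[ℂ] Tensor γ δ :=
  if h : Compatible α γ X ∧ Compatible β δ Y then (exists_tensorMap h.1 h.2).choose else 0

theorem tensorMap_tmul [FiniteDimensional ℂ 𝔥] [FiniteDimensional ℂ H] [FiniteDimensional ℂ K]
    {X : H →L[ℂ] L} {Y : K →L[ℂ] M} (hX : Compatible α γ X) (hY : Compatible β δ Y) (ξ z η) :
    tensorMap α β γ δ X Y (tmul α β ξ z η) = tmul γ δ (push X hX.1 ξ) z (push Y hY.1 η) := by
  rw [tensorMap, dif_pos ⟨hX, hY⟩]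
  exact (exists_tensorMap hX hY).choose_spec ξ z η

variable (α β) in
/-- `[|α⟩₁ B]`, the span of the operators `|ξ⟩₁ b` with `ξ ∈ α` and `b ∈ B`. -/
def ketSpan₁ [FiniteDimensional ℂ K] (B : StarSubalgebra ℂ (K →L[ℂ] K)) :
    Submodule ℂ (K →L[ℂ] Tensor α β) :=
  Submodule.span ℂ {T | ∃ ξ : α.Elt, ∃ b ∈ B, T = ket₁ ξ ∘L b}

variable (α β) in
/-- `[|β⟩₂ A]`, the span of the operators `|η⟩₂ a` with `η ∈ β` and `a ∈ A`. -/
def ketSpan₂ [FiniteDimensional ℂ H] (A : StarSubalgebra ℂ (H →L[ℂ] H)) :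
    Submodule ℂ (H →L[ℂ] Tensor α β) :=
  Submodule.span ℂ {T | ∃ η : β.Elt, ∃ a ∈ A, T = ket₂ η ∘L a}

theorem comp_mem_ketSpan₁ [FiniteDimensional ℂ K] {B : StarSubalgebra ℂ (K →L[ℂ] K)}
    {S : Tensor α β →L[ℂ] Tensor α β} (hS : ∀ ξ : α.Elt, S ∘L ket₁ ξ ∈ ketSpan₁ α β B)
    {T : K →L[ℂ] Tensor α β} (hT : T ∈ ketSpan₁ α β B) : S ∘L T ∈ ketSpan₁ α β B := by
  have mul : ∀ T ∈ ketSpan₁ α β B, ∀ b ∈ B, T ∘L b ∈ ketSpan₁ α β B := by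
    intro T hT b hb
    induction hT using Submodule.span_induction with
    | mem T hT =>
      obtain ⟨ξ, c, hc, rfl⟩ := hT
      exact Submodule.subset_span ⟨ξ, c * b, mul_mem hc hb, rfl⟩
    | zero => simp
    | add u v _ _ hu hv => rw [ContinuousLinearMap.add_comp]; exact add_mem hu hv
    | smul k u _ hu => rw [ContinuousLinearMap.smul_comp]; exact Submodule.smul_mem _ _ hu
  induction hT using Submodule.span_induction with
  | mem T hT =>
    obtain ⟨ξ, c, hc, rfl⟩ := hT
    exact mul _ (hS ξ) c hc
  | zero => simp
  | add u v _ _ hu hv => rw [ContinuousLinearMap.comp_add]; exact add_mem hu hv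
  | smul k u _ hu => rw [ContinuousLinearMap.comp_smul]; exact Submodule.smul_mem _ _ hu

theorem comp_mem_ketSpan₂ [FiniteDimensional ℂ H] {A : StarSubalgebra ℂ (H →L[ℂ] H)}
    {S : Tensor α β →L[ℂ] Tensor α β} (hS : ∀ η : β.Elt, S ∘L ket₂ η ∈ ketSpan₂ α β A)
    {T : H →L[ℂ] Tensor α β} (hT : T ∈ ketSpan₂ α β A) : S ∘L T ∈ ketSpan₂ α β A := by
  have mul : ∀ T ∈ ketSpan₂ α β A, ∀ b ∈ A, T ∘L b ∈ ketSpan₂ α β A := by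
    intro T hT b hb
    induction hT using Submodule.span_induction with
    | mem T hT =>
      obtain ⟨ξ, c, hc, rfl⟩ := hT
      exact Submodule.subset_span ⟨ξ, c * b, mul_mem hc hb, rfl⟩
    | zero => simp
    | add u v _ _ hu hv => rw [ContinuousLinearMap.add_comp]; exact add_mem hu hv
    | smul k u _ hu => rw [ContinuousLinearMap.smul_comp]; exact Submodule.smul_mem _ _ hu
  induction hT using Submodule.span_induction with
  | mem T hT =>
    obtain ⟨ξ, c, hc, rfl⟩ := hT
    exact mul _ (hS ξ) c hc
  | zero => simp
  | add u v _ _ hu hv => rw [ContinuousLinearMap.comp_add]; exact add_mem hu hv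
  | smul k u _ hu => rw [ContinuousLinearMap.comp_smul]; exact Submodule.smul_mem _ _ hu

variable [FiniteDimensional ℂ H] [FiniteDimensional ℂ K]

/-- `S |α⟩₁ ⊆ [|α⟩₁ B]` and `S |β⟩₂ ⊆ [|β⟩₂ A]`. -/
def PreservesKets (α : CFact 𝔟 H) (β : CFact 𝔟.flip K) (A : StarSubalgebra ℂ (H →L[ℂ] H))
    (B : StarSubalgebra ℂ (K →L[ℂ] K)) (S : Tensor α β →L[ℂ] Tensor α β) : Prop :=
  (∀ ξ : α.Elt, S ∘L ket₁ ξ ∈ ketSpan₁ α β B) ∧ ∀ η : β.Elt, S ∘L ket₂ η ∈ ketSpan₂ α β A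

theorem PreservesKets.mul {A : StarSubalgebra ℂ (H →L[ℂ] H)} {B : StarSubalgebra ℂ (K →L[ℂ] K)}
    {S T : Tensor α β →L[ℂ] Tensor α β} (hS : PreservesKets α β A B S)
    (hT : PreservesKets α β A B T) : PreservesKets α β A B (S * T) := by
  refine ⟨fun ξ => ?_, fun η => ?_⟩
  · rw [ContinuousLinearMap.mul_def, ContinuousLinearMap.comp_assoc]
    exact comp_mem_ketSpan₁ hS.1 (hT.1 ξ)
  · rw [ContinuousLinearMap.mul_def, ContinuousLinearMap.comp_assoc]
    exact comp_mem_ketSpan₂ hS.2 (hT.2 η)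

theorem PreservesKets.add {A : StarSubalgebra ℂ (H →L[ℂ] H)} {B : StarSubalgebra ℂ (K →L[ℂ] K)}
    {S T : Tensor α β →L[ℂ] Tensor α β} (hS : PreservesKets α β A B S)
    (hT : PreservesKets α β A B T) : PreservesKets α β A B (S + T) := by
  refine ⟨fun ξ => ?_, fun η => ?_⟩
  · rw [ContinuousLinearMap.add_comp]; exact add_mem (hS.1 ξ) (hT.1 ξ)
  · rw [ContinuousLinearMap.add_comp]; exact add_mem (hS.2 η) (hT.2 η)

theorem preservesKets_algebraMap (A : StarSubalgebra ℂ (H →L[ℂ] H))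
    (B : StarSubalgebra ℂ (K →L[ℂ] K)) (c : ℂ) :
    PreservesKets α β A B (algebraMap ℂ (Tensor α β →L[ℂ] Tensor α β) c) := by
  rw [Algebra.algebraMap_eq_smul_one]
  refine ⟨fun ξ => ?_, fun η => ?_⟩
  · rw [ContinuousLinearMap.smul_comp]
    exact Submodule.smul_mem _ _ (Submodule.subset_span ⟨ξ, 1, one_mem B, rfl⟩)
  · rw [ContinuousLinearMap.smul_comp]
    exact Submodule.smul_mem _ _ (Submodule.subset_span ⟨η, 1, one_mem A, rfl⟩)

variable [FiniteDimensional ℂ 𝔥] in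
/-- The spatial fiber product of `A` and `B`: the operators `S` such that `S` and `S^*` map
`|α⟩₁` into `[|α⟩₁ B]` and `|β⟩₂` into `[|β⟩₂ A]`. -/
def spatialFiberProduct (α : CFact 𝔟 H) (β : CFact 𝔟.flip K) (A : StarSubalgebra ℂ (H →L[ℂ] H))
    (B : StarSubalgebra ℂ (K →L[ℂ] K)) : StarSubalgebra ℂ (Tensor α β →L[ℂ] Tensor α β) where
  carrier := {S | PreservesKets α β A B S ∧ PreservesKets α β A B (star S)}
  mul_mem' := fun {S T} hS hT => ⟨hS.1.mul hT.1, by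
    rw [star_mul]; exact hT.2.mul hS.2⟩
  add_mem' := fun {S T} hS hT => ⟨hS.1.add hT.1, by
    rw [star_add]; exact hS.2.add hT.2⟩
  algebraMap_mem' := fun c => ⟨preservesKets_algebraMap A B c, by
    rw [← algebraMap_star_comm]; exact preservesKets_algebraMap A B _⟩
  star_mem' := fun {S} hS => ⟨hS.2, by rw [star_star]; exact hS.1⟩

end CFact

/-- `X ∈ L^φ(H, L)`, that is, `X a = φ(a) X` for all `a ∈ A`. -/
def Intertwines {A : StarSubalgebra ℂ (H →L[ℂ] H)} {C : StarSubalgebra ℂ (L →L[ℂ] L)}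
    (φ : A →⋆ₐ[ℂ] C) (X : H →L[ℂ] L) : Prop :=
  ∀ a : A, X ∘L (a : H →L[ℂ] H) = (φ a : L →L[ℂ] L) ∘L X

/-- `φ` is a morphism from `(H, A, α)` to `(L, C, γ)`: `γ = [I_φ α]`, where `I_φ` consists of all
`V ∈ L^φ(H, L)` with `V α ⊆ γ` and `V^* γ ⊆ α`. -/
def IsMorphism {A : StarSubalgebra ℂ (H →L[ℂ] H)} {C : StarSubalgebra ℂ (L →L[ℂ] L)}
    (α : CFact 𝔟 H) (γ : CFact 𝔟 L) (φ : A →⋆ₐ[ℂ] C) : Prop :=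
  Submodule.span ℂ {T | ∃ V : H →L[ℂ] L, Intertwines φ V ∧ CFact.Compatible α γ V ∧
    ∃ ξ ∈ α.space, T = V ∘L ξ} = γ.space

end spatial

/-- The unitary that identifies the relative tensor product with the `C^*`-relative tensor
product: `ξ ⊗ η ↦ R^ρ(ξ)U ⊗ ζ ⊗ R^σ(η)U`. -/
def IsComparison {N : Type*} [CStarAlgebra N] {μ : FaithfulState N}
    {E : Type*} [NormedAddCommGroup E] [InnerProductSpace ℂ E] [CompleteSpace E]
    [FiniteDimensional ℂ E] (G : GNSRep μ E)
    {𝔥 : Type*} [NormedAddCommGroup 𝔥] [InnerProductSpace ℂ 𝔥] [CompleteSpace 𝔥]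
    {𝔟 : CStarBase 𝔥} (ζ : 𝔥) (U : 𝔥 ≃ₗᵢ[ℂ] E)
    {H : Type*} [NormedAddCommGroup H] [InnerProductSpace ℂ H] [CompleteSpace H]
    {K : Type*} [NormedAddCommGroup K] [InnerProductSpace ℂ K] [CompleteSpace K]
    {ρ : Nᵐᵒᵖ →⋆ₐ[ℂ] (H →L[ℂ] H)} {σ : N →⋆ₐ[ℂ] (K →L[ℂ] K)}
    {α : CFact 𝔟 H} {β : CFact 𝔟.flip K}
    (Φ : G.RelTensor ρ σ ≃ₗᵢ[ℂ] CFact.Tensor α β) : Prop :=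
  ∀ (ξ : H) (η : K), ∃ (a : α.Elt) (b : β.Elt),
    α.op a = G.Rop ρ ξ ∘L (U : 𝔥 →L[ℂ] E) ∧ β.op b = G.R σ η ∘L (U : 𝔥 →L[ℂ] E) ∧
      Φ (G.rtmul ρ σ ξ η) = CFact.tmul α β a ζ b

/-- Conjugation `T ↦ V T V^*` by a unitary `V`. -/
def Ad {X Y : Type*} [NormedAddCommGroup X] [InnerProductSpace ℂ X] [NormedAddCommGroup Y]
    [InnerProductSpace ℂ Y] (V : X ≃ₗᵢ[ℂ] Y) (T : X →L[ℂ] X) : Y →L[ℂ] Y :=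
  (V : X →L[ℂ] Y) ∘L T ∘L (V.symm : Y →L[ℂ] X)

/-- `F = φ *_μ ψ`: for all `X ∈ L^φ(H, L)`, `Y ∈ L^ψ(K, M)` and all `S` in the fiber product,
`F(S) (X ⊗ Y) = (X ⊗ Y) S`. -/
def IsClassicalFiberMap {N : Type*} [CStarAlgebra N] {μ : FaithfulState N}
    {E : Type*} [NormedAddCommGroup E] [InnerProductSpace ℂ E] [CompleteSpace E]
    [FiniteDimensional ℂ E] (G : GNSRep μ E)
    {H : Type*} [NormedAddCommGroup H] [InnerProductSpace ℂ H] [CompleteSpace H]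
    [FiniteDimensional ℂ H]
    {K : Type*} [NormedAddCommGroup K] [InnerProductSpace ℂ K] [CompleteSpace K]
    [FiniteDimensional ℂ K]
    {L : Type*} [NormedAddCommGroup L] [InnerProductSpace ℂ L] [CompleteSpace L]
    [FiniteDimensional ℂ L]
    {M : Type*} [NormedAddCommGroup M] [InnerProductSpace ℂ M] [CompleteSpace M]
    [FiniteDimensional ℂ M]
    {A : StarSubalgebra ℂ (H →L[ℂ] H)} {B : StarSubalgebra ℂ (K →L[ℂ] K)}
    {C : StarSubalgebra ℂ (L →L[ℂ] L)} {D : StarSubalgebra ℂ (M →L[ℂ] M)}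
    (φ : A →⋆ₐ[ℂ] C) (ψ : B →⋆ₐ[ℂ] D)
    {ρ : Nᵐᵒᵖ →⋆ₐ[ℂ] A} {σ : N →⋆ₐ[ℂ] B} {υ : Nᵐᵒᵖ →⋆ₐ[ℂ] C} {ω : N →⋆ₐ[ℂ] D}
    (F : G.fiberProduct ρ σ →⋆ₙₐ[ℂ] G.fiberProduct υ ω) : Prop :=
  ∀ (X : H →L[ℂ] L) (Y : K →L[ℂ] M), Intertwines φ X → Intertwines ψ Y →
    ∀ S : G.fiberProduct ρ σ,
      (F S : G.RelTensor (C.subtype.comp υ) (D.subtype.comp ω) →L[ℂ]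
          G.RelTensor (C.subtype.comp υ) (D.subtype.comp ω)) ∘L
        G.relMap (A.subtype.comp ρ) (B.subtype.comp σ) (C.subtype.comp υ) (D.subtype.comp ω) X Y
      = G.relMap (A.subtype.comp ρ) (B.subtype.comp σ) (C.subtype.comp υ) (D.subtype.comp ω) X Y ∘L
        (S : G.RelTensor (A.subtype.comp ρ) (B.subtype.comp σ) →L[ℂ]
          G.RelTensor (A.subtype.comp ρ) (B.subtype.comp σ))

/-- `F = φ *_𝔥 ψ`: for all `X ∈ L^φ(H, L)`, `Y ∈ L^ψ(K, M)` and all `T` in the spatial fiber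
product, `F(T) (X ⊗ Y) = (X ⊗ Y) T`. -/
def IsSpatialFiberMap
    {𝔥 : Type*} [NormedAddCommGroup 𝔥] [InnerProductSpace ℂ 𝔥] [CompleteSpace 𝔥]
    [FiniteDimensional ℂ 𝔥] {𝔟 : CStarBase 𝔥}
    {H : Type*} [NormedAddCommGroup H] [InnerProductSpace ℂ H] [CompleteSpace H]
    [FiniteDimensional ℂ H]
    {K : Type*} [NormedAddCommGroup K] [InnerProductSpace ℂ K] [CompleteSpace K]
    [FiniteDimensional ℂ K]
    {L : Type*} [NormedAddCommGroup L] [InnerProductSpace ℂ L] [CompleteSpace L]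
    [FiniteDimensional ℂ L]
    {M : Type*} [NormedAddCommGroup M] [InnerProductSpace ℂ M] [CompleteSpace M]
    [FiniteDimensional ℂ M]
    {A : StarSubalgebra ℂ (H →L[ℂ] H)} {B : StarSubalgebra ℂ (K →L[ℂ] K)}
    {C : StarSubalgebra ℂ (L →L[ℂ] L)} {D : StarSubalgebra ℂ (M →L[ℂ] M)}
    (φ : A →⋆ₐ[ℂ] C) (ψ : B →⋆ₐ[ℂ] D)
    {α : CFact 𝔟 H} {β : CFact 𝔟.flip K} {γ : CFact 𝔟 L} {δ : CFact 𝔟.flip M}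
    (F : CFact.spatialFiberProduct α β A B →⋆ₙₐ[ℂ] CFact.spatialFiberProduct γ δ C D) : Prop :=
  ∀ (X : H →L[ℂ] L) (Y : K →L[ℂ] M), Intertwines φ X → Intertwines ψ Y →
    ∀ T : CFact.spatialFiberProduct α β A B,
      (F T : CFact.Tensor γ δ →L[ℂ] CFact.Tensor γ δ) ∘L CFact.tensorMap α β γ δ X Y
      = CFact.tensorMap α β γ δ X Y ∘L (T : CFact.Tensor α β →L[ℂ] CFact.Tensor α β)

end

/-!
The bicyclic vector `ζ` makes the factorizations rigid: an operator `𝔥 → H` that intertwines `B†`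
with `ρ_α(B†)` is determined by its value at `ζ`, and `α ζ = α B ζ = α 𝔥` is all of `H`. Hence `α`
consists of all such intertwiners (`CFact.mem_space_of_intertwines`), `ξ ↦ R^ρ(ξ)U` is the inverse
of the bijection `α → H`, `a ↦ a ζ` (`CFact.ofVec`, `CFact.op_ofVec_eq_Rop`), and every operator
`H → L` that intertwines the two representations of `B†` maps `α` to `γ`, as does its adjoint from
`γ` to `α` (`CFact.Equivariant.compatible`). The formula for the comparison map therefore makes
sense, it preserves inner products, and it is onto because an element `b` of the base can be moved
from the middle leg of `ξ ⊗ bζ ⊗ η` to the first one (`exists_comparison`). It intertwines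
`X ⊗_μ Y` with `X ⊗_𝔥 Y` (`tensorMap_comparison`).

The spatial fiber product is, like the classical one, the commutant of all `X ⊗ Y` with `X ∈ A'` and
`Y ∈ B'` (`CFact.mem_spatialFiberProduct_iff`). Indeed, `1` is a linear combination of operators
`ξ ξ'^*` with `ξ, ξ' ∈ α`, hence `1` on the tensor product is one of operators `|ξ⟩₁⟨ξ'|₁`; if `T`
commutes with `1 ⊗ B'`, then `⟨ξ'|₁ T |ξ''⟩₁` lies in `B'' = B`, and so `T |ξ''⟩₁` lies in
`[|α⟩₁ B]` (`commute_iff_comp_mem_span`). The double commutant theorem follows from the Jacobson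
density theorem, since invariant subspaces have invariant orthogonal complements. Conjugation by the
comparison unitaries thus identifies the fiber products.

For the functoriality, the ranges of the intertwiners in `L^φ(H, L)` span `L`, as `H` is a faithful
semisimple `A`-module (`span_intertwines_apply`); so the operators `X ⊗ Y` have total range, and
since the products `(X ⊗ Y)^* (X' ⊗ Y')` lie in `A' ⊗ B'`, the relation `F(S) (X ⊗ Y) = (X ⊗ Y) S`
determines a `*`-homomorphism on the commutant (`existsUnique_starHom_comp_eq`). The spatial map is
the conjugate of the classical one by the comparison unitaries. All of this uses that
`φ ∘ ρ = υ` and `ψ ∘ σ = ω`, which the morphism condition implies (`IsMorphism.apply_eq_rep`).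
-/

/-! ### Finite-dimensional operator algebras -/

section commutant
variable {H : Type*} [NormedAddCommGroup H] [InnerProductSpace ℂ H] [CompleteSpace H]
  {L : Type*} [NormedAddCommGroup L] [InnerProductSpace ℂ L] [CompleteSpace L]

theorem StarSubalgebra.mem_centralizer_iff_commute {A : StarSubalgebra ℂ (H →L[ℂ] H)}
    {T : H →L[ℂ] H} :
    T ∈ StarSubalgebra.centralizer ℂ (A : Set (H →L[ℂ] H)) ↔ ∀ a ∈ A, Commute T a := by
  rw [StarSubalgebra.mem_centralizer_iff]
  exact ⟨fun h a ha => (h a ha).1.symm, fun h a ha => ⟨(h a ha).symm, (h _ (star_mem ha)).symm⟩⟩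

variable [FiniteDimensional ℂ H]

/-- The orthogonal complement of an invariant subspace of a `*`-algebra is invariant. -/
instance StarSubalgebra.isSemisimpleModule (A : StarSubalgebra ℂ (H →L[ℂ] H)) :
    IsSemisimpleModule A H where
  exists_isCompl W := by
    let V : Submodule ℂ H :=
      { W.toAddSubmonoid with
        smul_mem' := fun c x hx => W.smul_mem (algebraMap ℂ A c) hx }
    let V' : Submodule A H :=
      { Vᗮ.toAddSubmonoid with
        smul_mem' := fun a x hx => by
          intro w hw
          change ⟪w, (a : H →L[ℂ] H) x⟫_ℂ = 0
          rw [← ContinuousLinearMap.adjoint_inner_left]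
          exact hx _ (W.smul_mem (star a) hw) }
    refine ⟨V', ?_⟩
    have h : IsCompl V Vᗮ := V.isCompl_orthogonal
    constructor
    · rw [Submodule.disjoint_def]
      intro x hx hx'
      exact Submodule.disjoint_def.mp h.disjoint x hx hx'
    · rw [codisjoint_iff]
      refine Submodule.eq_top_iff'.mpr fun x => ?_
      have hx : x ∈ V ⊔ Vᗮ := by rw [h.sup_eq_top]; trivial
      obtain ⟨y, hy, z, hz, rfl⟩ := Submodule.mem_sup.mp hx
      exact Submodule.add_mem_sup hy hz

/-- The double commutant theorem in finite dimension. -/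
theorem StarSubalgebra.mem_of_commute_centralizer (A : StarSubalgebra ℂ (H →L[ℂ] H))
    {T : H →L[ℂ] H}
    (hT : ∀ Y ∈ StarSubalgebra.centralizer ℂ (A : Set (H →L[ℂ] H)), Commute T Y) : T ∈ A := by
  classical
  let f : Module.End (Module.End A H) H :=
    { toFun := T
      map_add' := T.map_add
      map_smul' := fun g x => by
        let Y : H →L[ℂ] H := LinearMap.toContinuousLinearMap
          { toFun := g
            map_add' := g.map_add
            map_smul' := fun c x => g.map_smul (algebraMap ℂ A c) x }
        have hY : Y ∈ StarSubalgebra.centralizer ℂ (A : Set (H →L[ℂ] H)) := by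
          rw [StarSubalgebra.mem_centralizer_iff_commute]
          intro a ha
          ext x
          exact g.map_smul (⟨a, ha⟩ : A) x
        exact congrArg (fun S => S x) (hT Y hY) }
  let b := Module.finBasis ℂ H
  obtain ⟨r, hr⟩ := jacobson_density f (Finset.univ.image b)
  have : (T : H →ₗ[ℂ] H) = (r : H →L[ℂ] H) :=
    b.ext fun i => hr (b i) (Finset.mem_image_of_mem _ (Finset.mem_univ i))
  rw [ContinuousLinearMap.coe_injective this]
  exact r.2

/-- Every vector `w ∈ L` is a sum of vectors `X v` with `X ∈ L^φ(H, L)`: if `(e_i)` is a basis of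
`H`, then `a ↦ (a e_i)_i` embeds `A` into a power of `H`, and the module map `a ↦ φ(a) w` extends
to this power. -/
theorem span_intertwines_apply {A : StarSubalgebra ℂ (H →L[ℂ] H)}
    {C : StarSubalgebra ℂ (L →L[ℂ] L)} (φ : A →⋆ₐ[ℂ] C) :
    Submodule.span ℂ {w | ∃ X : H →L[ℂ] L, Intertwines φ X ∧ ∃ v, w = X v} = ⊤ := by
  rw [eq_top_iff]
  intro w _
  let _ : Module A L := Module.compHom L (φ : A →+* C)
  have hφ : ∀ (a : A) (y : L), a • y = (φ a : L →L[ℂ] L) y := fun a y => rfl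
  have hc : ∀ (c : ℂ) (y : L), (algebraMap ℂ A c) • y = c • y := fun c y => by
    rw [hφ, AlgHomClass.commutes]; rfl
  let b := Module.finBasis ℂ H
  let f : A →ₗ[A] (Fin (Module.finrank ℂ H) → H) := LinearMap.toSpanSingleton A _ b
  have hf : Function.Injective f := by
    intro a a' h
    refine Subtype.ext (ContinuousLinearMap.coe_injective (b.ext fun i => ?_))
    exact congrFun h i
  obtain ⟨h, hh⟩ := IsSemisimpleModule.extension_property f hf (LinearMap.toSpanSingleton A L w)
  have hw : h b = w := by
    have := congrArg (fun k => k 1) hh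
    simpa [f] using this
  let X : Fin (Module.finrank ℂ H) → (H →L[ℂ] L) := fun i => LinearMap.toContinuousLinearMap
    { toFun := fun v => h (Pi.single i v)
      map_add' := fun u v => by rw [Pi.single_add, map_add]
      map_smul' := fun c v => by
        have : (Pi.single i (c • v) : Fin (Module.finrank ℂ H) → H)
            = (algebraMap ℂ A c) • Pi.single i v := by
          rw [← Pi.single_smul]; rfl
        rw [this, map_smul, hc]; rfl }
  have hX : ∀ i, Intertwines φ (X i) := fun i a => by
    ext v
    change h (Pi.single i (a • v)) = (φ a : L →L[ℂ] L) (h (Pi.single i v))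
    rw [Pi.single_smul, map_smul, hφ]
  have hsum : w = ∑ i, X i (b i) := by
    conv_lhs => rw [← hw, ← Finset.univ_sum_single (b : Fin (Module.finrank ℂ H) → H), map_sum]
    rfl
  rw [hsum]
  exact Submodule.sum_mem _ fun i _ => Submodule.subset_span ⟨X i, hX i, b i, rfl⟩

end commutant

section kets
variable {H : Type*} [NormedAddCommGroup H] [InnerProductSpace ℂ H] [CompleteSpace H]
  {K : Type*} [NormedAddCommGroup K] [InnerProductSpace ℂ K] [CompleteSpace K]
  [FiniteDimensional ℂ K]

/-- Let `k p : K → H` be operators that intertwine the action of `B'` on `K` with operators `τ Y`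
on `H`, such that `1` is a linear combination of the operators `k p (k q)^*`. Then `T` commutes
with all `τ Y` if and only if `T (k p)` lies in the span of the operators `(k q) b` with
`b ∈ B`. -/
theorem commute_iff_comp_mem_span {ι : Type*} {B : StarSubalgebra ℂ (K →L[ℂ] K)}
    {k : ι → K →L[ℂ] H} {τ : (K →L[ℂ] K) → (H →L[ℂ] H)}
    (hk : ∀ Y ∈ StarSubalgebra.centralizer ℂ (B : Set (K →L[ℂ] K)), ∀ p, τ Y ∘L k p = k p ∘L Y)
    (hτ : ∀ Y ∈ StarSubalgebra.centralizer ℂ (B : Set (K →L[ℂ] K)), adjoint (τ Y) = τ (star Y))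
    (h1 : (1 : H →L[ℂ] H) ∈ Submodule.span ℂ {T | ∃ p q, T = k p ∘L adjoint (k q)})
    (T : H →L[ℂ] H) :
    (∀ Y ∈ StarSubalgebra.centralizer ℂ (B : Set (K →L[ℂ] K)), Commute T (τ Y)) ↔
      ∀ p, T ∘L k p ∈ Submodule.span ℂ {S | ∃ q, ∃ b ∈ B, S = k q ∘L b} := by
  constructor
  · intro h p
    -- insert `1 = ∑ k q (k q')^*` to the left of `T (k p)`; each `(k q')^* T (k p)` lies in `B''`
    have key : ∀ R ∈ Submodule.span ℂ {T | ∃ p q, T = k p ∘L adjoint (k q)},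
        R ∘L (T ∘L k p) ∈ Submodule.span ℂ {S | ∃ q, ∃ b ∈ B, S = k q ∘L b} := by
      intro R hR
      induction hR using Submodule.span_induction with
      | mem R hR =>
        obtain ⟨q, q', rfl⟩ := hR
        refine Submodule.subset_span ⟨q, adjoint (k q') ∘L (T ∘L k p), ?_, rfl⟩
        refine B.mem_of_commute_centralizer fun Y hY => ?_
        have h2 : adjoint (k q') ∘L τ Y = Y ∘L adjoint (k q') := by
          have := congrArg adjoint (hk (star Y) (star_mem hY) q')
          rw [ContinuousLinearMap.adjoint_comp, ContinuousLinearMap.adjoint_comp,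
            hτ _ (star_mem hY), star_star] at this
          rw [this, ContinuousLinearMap.star_eq_adjoint, ContinuousLinearMap.adjoint_adjoint]
        ext x
        have e1 : τ Y (k p x) = k p (Y x) := congrArg (fun S => S x) (hk Y hY p)
        have e2 : T (τ Y (k p x)) = τ Y (T (k p x)) := congrArg (fun S => S (k p x)) (h Y hY)
        have e3 : adjoint (k q') (τ Y (T (k p x))) = Y (adjoint (k q') (T (k p x))) :=
          congrArg (fun S => S (T (k p x))) h2
        change adjoint (k q') (T (k p (Y x))) = Y (adjoint (k q') (T (k p x)))
        rw [← e1, e2, e3]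
      | zero => simp
      | add u v _ _ hu hv => rw [ContinuousLinearMap.add_comp]; exact add_mem hu hv
      | smul c u _ hu => rw [ContinuousLinearMap.smul_comp]; exact Submodule.smul_mem _ _ hu
    exact key 1 h1
  · intro h Y hY
    have h2 : ∀ S ∈ Submodule.span ℂ {S | ∃ q, ∃ b ∈ B, S = k q ∘L b},
        τ Y ∘L S = S ∘L Y := by
      intro S hS
      induction hS using Submodule.span_induction with
      | mem S hS =>
        obtain ⟨q, b, hb, rfl⟩ := hS
        have hYb : Y ∘L b = b ∘L Y := StarSubalgebra.mem_centralizer_iff_commute.mp hY b hb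
        rw [← ContinuousLinearMap.comp_assoc, hk Y hY, ContinuousLinearMap.comp_assoc, hYb,
          ContinuousLinearMap.comp_assoc]
      | zero => simp
      | add u v _ _ hu hv =>
        rw [ContinuousLinearMap.add_comp, ContinuousLinearMap.comp_add, hu, hv]
      | smul c u _ hu => rw [ContinuousLinearMap.smul_comp, ContinuousLinearMap.comp_smul, hu]
    have h3 : ∀ R ∈ Submodule.span ℂ {T | ∃ p q, T = k p ∘L adjoint (k q)},
        (T ∘L τ Y) ∘L R = (τ Y ∘L T) ∘L R := by
      intro R hR
      induction hR using Submodule.span_induction with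
      | mem R hR =>
        obtain ⟨q, q', rfl⟩ := hR
        ext x
        have e1 : τ Y (k q (adjoint (k q') x)) = k q (Y (adjoint (k q') x)) :=
          congrArg (fun S => S (adjoint (k q') x)) (hk Y hY q)
        have e2 : τ Y (T (k q (adjoint (k q') x))) = T (k q (Y (adjoint (k q') x))) :=
          congrArg (fun S => S (adjoint (k q') x)) (h2 _ (h q))
        change T (τ Y (k q (adjoint (k q') x))) = τ Y (T (k q (adjoint (k q') x)))
        rw [e1, e2]
      | zero => simp
      | add u v _ _ hu hv => rw [ContinuousLinearMap.comp_add, ContinuousLinearMap.comp_add, hu, hv]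
      | smul c u _ hu => rw [ContinuousLinearMap.comp_smul, ContinuousLinearMap.comp_smul, hu]
    exact h3 1 h1

end kets

/-! ### Factorizations over a base with a bicyclic vector -/

section factorization
variable {𝔥 : Type*} [NormedAddCommGroup 𝔥] [InnerProductSpace ℂ 𝔥] [CompleteSpace 𝔥]
  {𝔟 : CStarBase 𝔥} {ζ : 𝔥}
  {H : Type*} [NormedAddCommGroup H] [InnerProductSpace ℂ H] [CompleteSpace H]
  {L : Type*} [NormedAddCommGroup L] [InnerProductSpace ℂ L] [CompleteSpace L]

theorem CStarBase.IsBicyclic.flip (h : 𝔟.IsBicyclic ζ) : 𝔟.flip.IsBicyclic ζ := ⟨h.2, h.1⟩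

namespace CFact

theorem comp_mem_space (α : CFact 𝔟 H) {ξ : 𝔥 →L[ℂ] H} (hξ : ξ ∈ α.space) {b : 𝔥 →L[ℂ] 𝔥}
    (hb : b ∈ 𝔟.B) : ξ ∘L b ∈ α.space := by
  rw [← α.span_mul]
  exact Submodule.subset_span ⟨ξ, hξ, b, hb, rfl⟩

omit [CompleteSpace L] in
theorem ext_comp (α : CFact 𝔟 H) {S T : H →L[ℂ] L} (h : ∀ ξ ∈ α.space, S ∘L ξ = T ∘L ξ) :
    S = T := by
  ext x
  obtain ⟨t, rfl⟩ := α.eval_surjective x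
  induction t using TensorProduct.induction_on with
  | zero => simp
  | add a b ha hb => rw [map_add, map_add, map_add, ha, hb]
  | tmul ξ z => exact congrArg (fun f => f z) (h _ (α.op_mem ξ))

variable [FiniteDimensional ℂ H]

theorem rep_star (α : CFact 𝔟 H) {b : 𝔥 →L[ℂ] 𝔥} (hb : b ∈ 𝔟.Bd) :
    α.rep (star b) = adjoint (α.rep b) := by
  refine α.ext_comp fun ξ hξ => ?_
  rw [α.rep_comp (star_mem hb) hξ]
  ext z
  refine α.ext_eval fun ξ' hξ' z' => ?_
  have h1 : α.rep b (ξ' z') = ξ' (b z') := congrArg (fun f => f z') (α.rep_comp hb hξ')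
  have h2 : adjoint ξ' (ξ (star b z)) = star b (adjoint ξ' (ξ z)) :=
    congrArg (fun f => f z) (𝔟.comm _ (α.star_mul_mem hξ' hξ) _ (star_mem hb))
  change ⟪ξ' z', ξ (star b z)⟫_ℂ = ⟪ξ' z', adjoint (α.rep b) (ξ z)⟫_ℂ
  rw [ContinuousLinearMap.adjoint_inner_right, h1, ← ContinuousLinearMap.adjoint_inner_right, h2,
    ContinuousLinearMap.star_eq_adjoint, ContinuousLinearMap.adjoint_inner_right,
    ContinuousLinearMap.adjoint_inner_right]

theorem eq_of_apply_eq (hζ : 𝔟.IsBicyclic ζ) (α : CFact 𝔟 H) {S T : 𝔥 →L[ℂ] H}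
    (hS : ∀ b ∈ 𝔟.Bd, S ∘L b = α.rep b ∘L S) (hT : ∀ b ∈ 𝔟.Bd, T ∘L b = α.rep b ∘L T)
    (h : S ζ = T ζ) : S = T := by
  ext z
  have hz : z ∈ Submodule.span ℂ {v | ∃ b ∈ 𝔟.Bd, v = b ζ} := by rw [hζ.2]; trivial
  induction hz using Submodule.span_induction with
  | mem z hz =>
    obtain ⟨b, hb, rfl⟩ := hz
    have h1 : S (b ζ) = α.rep b (S ζ) := congrArg (fun f => f ζ) (hS b hb)
    have h2 : T (b ζ) = α.rep b (T ζ) := congrArg (fun f => f ζ) (hT b hb)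
    rw [h1, h2, h]
  | zero => simp
  | add u v _ _ hu hv => rw [map_add, map_add, hu, hv]
  | smul c u _ hu => rw [map_smul, map_smul, hu]

theorem apply_bijective (hζ : 𝔟.IsBicyclic ζ) (α : CFact 𝔟 H) :
    Function.Bijective (LinearMap.applyₗ ζ ∘ₗ ContinuousLinearMap.coeLM ℂ ∘ₗ α.op : α.Elt →ₗ[ℂ] H)
    := by
  constructor
  · intro a a' h
    exact α.op_injective (eq_of_apply_eq hζ α (fun b hb => (α.rep_comp hb (α.op_mem a)).symm)
      (fun b hb => (α.rep_comp hb (α.op_mem a')).symm) h)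
  · rw [← LinearMap.range_eq_top, eq_top_iff, ← α.span_apply, Submodule.span_le]
    rintro _ ⟨ξ, hξ, z, rfl⟩
    have hz : z ∈ Submodule.span ℂ {v | ∃ b ∈ 𝔟.B, v = b ζ} := by rw [hζ.1]; trivial
    induction hz using Submodule.span_induction with
    | mem z hz =>
      obtain ⟨b, hb, rfl⟩ := hz
      exact ⟨α.elt (ξ ∘L b) (α.comp_mem_space hξ hb), rfl⟩
    | zero => rw [map_zero]; exact Submodule.zero_mem _
    | add u v _ _ hu hv => rw [map_add]; exact Submodule.add_mem _ hu hv
    | smul c u _ hu => rw [map_smul]; exact Submodule.smul_mem _ _ hu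

/-- The inverse of the evaluation at a bicyclic vector `ζ`: the element of `α` that maps `ζ` to
the given vector of `H`. -/
noncomputable def ofVec (hζ : 𝔟.IsBicyclic ζ) (α : CFact 𝔟 H) : H ≃ₗ[ℂ] α.Elt :=
  (LinearEquiv.ofBijective _ (α.apply_bijective hζ)).symm

theorem op_ofVec_apply (hζ : 𝔟.IsBicyclic ζ) (α : CFact 𝔟 H) (x : H) :
    α.op (α.ofVec hζ x) ζ = x :=
  (LinearEquiv.ofBijective _ (α.apply_bijective hζ)).apply_symm_apply x

theorem ofVec_op_apply (hζ : 𝔟.IsBicyclic ζ) (α : CFact 𝔟 H) (a : α.Elt) :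
    α.ofVec hζ (α.op a ζ) = a :=
  (LinearEquiv.ofBijective _ (α.apply_bijective hζ)).symm_apply_apply a

theorem op_ofVec_eq (hζ : 𝔟.IsBicyclic ζ) (α : CFact 𝔟 H) {T : 𝔥 →L[ℂ] H}
    (hT : ∀ b ∈ 𝔟.Bd, T ∘L b = α.rep b ∘L T) : α.op (α.ofVec hζ (T ζ)) = T :=
  eq_of_apply_eq hζ α (fun _ hb => (α.rep_comp hb (α.op_mem _)).symm) hT (op_ofVec_apply hζ α _)

/-- In the presence of a bicyclic vector, `α` consists of *all* operators that intertwine `B†` with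
its image under `ρ_α`: such an operator is determined by its value at `ζ`, and every value is
attained on `α`. -/
theorem mem_space_of_intertwines (hζ : 𝔟.IsBicyclic ζ) (α : CFact 𝔟 H) {T : 𝔥 →L[ℂ] H}
    (hT : ∀ b ∈ 𝔟.Bd, T ∘L b = α.rep b ∘L T) : T ∈ α.space := by
  rw [← op_ofVec_eq hζ α hT]
  exact α.op_mem _

section equivariant
variable [FiniteDimensional ℂ L]

/-- `X` intertwines the representations `ρ_α` and `ρ_γ` of `B†`. -/
def Equivariant (α : CFact 𝔟 H) (γ : CFact 𝔟 L) (X : H →L[ℂ] L) : Prop :=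
  ∀ b ∈ 𝔟.Bd, X ∘L α.rep b = γ.rep b ∘L X

theorem Equivariant.adjoint {α : CFact 𝔟 H} {γ : CFact 𝔟 L} {X : H →L[ℂ] L}
    (hX : Equivariant α γ X) : Equivariant γ α (adjoint X) := by
  intro b hb
  have h := congrArg ContinuousLinearMap.adjoint (hX _ (star_mem hb))
  rw [ContinuousLinearMap.adjoint_comp, ContinuousLinearMap.adjoint_comp, rep_star _ hb,
    rep_star _ hb, ContinuousLinearMap.adjoint_adjoint, ContinuousLinearMap.adjoint_adjoint] at h
  exact h.symm

theorem Equivariant.comp_mem_space (hζ : 𝔟.IsBicyclic ζ) {α : CFact 𝔟 H} {γ : CFact 𝔟 L}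
    {X : H →L[ℂ] L} (hX : Equivariant α γ X) {ξ : 𝔥 →L[ℂ] H} (hξ : ξ ∈ α.space) :
    X ∘L ξ ∈ γ.space := by
  refine mem_space_of_intertwines hζ γ fun b hb => ?_
  rw [ContinuousLinearMap.comp_assoc, ← α.rep_comp hb hξ, ← ContinuousLinearMap.comp_assoc, hX b hb,
    ContinuousLinearMap.comp_assoc]

theorem Equivariant.compatible (hζ : 𝔟.IsBicyclic ζ) {α : CFact 𝔟 H} {γ : CFact 𝔟 L}
    {X : H →L[ℂ] L} (hX : Equivariant α γ X) : Compatible α γ X :=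
  ⟨fun _ hξ => hX.comp_mem_space hζ hξ, fun _ hξ => hX.adjoint.comp_mem_space hζ hξ⟩

theorem equivariant_of_mem_centralizer {α : CFact 𝔟 H} {A : StarSubalgebra ℂ (H →L[ℂ] H)}
    (hα : α.IsFactOf A) {X : H →L[ℂ] H}
    (hX : X ∈ StarSubalgebra.centralizer ℂ (A : Set (H →L[ℂ] H))) : Equivariant α α X :=
  fun b hb => StarSubalgebra.mem_centralizer_iff_commute.mp hX _ (hα b hb)

end equivariant

/-- If `(e_i)` is a basis of `α`, then `P = ∑ e_i e_i^*` is injective and commutes with `ρ_α(B†)`,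
so that `P⁻¹ e_i ∈ α` and `1 = ∑ (P⁻¹ e_i) e_i^*`. -/
theorem one_mem_span_comp_adjoint [FiniteDimensional ℂ 𝔥] (hζ : 𝔟.IsBicyclic ζ) (α : CFact 𝔟 H) :
    (1 : H →L[ℂ] H) ∈ Submodule.span ℂ {T | ∃ p q : α.Elt, T = α.op p ∘L adjoint (α.op q)} := by
  let e := Module.finBasis ℂ α.Elt
  let P : H →L[ℂ] H := ∑ i, α.op (e i) ∘L adjoint (α.op (e i))
  have hP : ∀ v, P v = ∑ i, α.op (e i) (adjoint (α.op (e i)) v) := fun v => by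
    simp [P]
  have hinj : Function.Injective (P : H →ₗ[ℂ] H) := by
    rw [injective_iff_map_eq_zero]
    intro v hv
    have h1 : ∑ i, ‖adjoint (α.op (e i)) v‖ ^ 2 = 0 := by
      have h2 : ⟪v, P v⟫_ℂ = ∑ i, ((‖adjoint (α.op (e i)) v‖ ^ 2 : ℝ) : ℂ) := by
        rw [hP, inner_sum]
        refine Finset.sum_congr rfl fun i _ => ?_
        rw [← ContinuousLinearMap.adjoint_inner_left, inner_self_eq_norm_sq_to_K]
        push_cast
        rfl
      rw [show P v = 0 from hv, inner_zero_right] at h2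
      exact_mod_cast h2.symm
    have h3 : ∀ i, adjoint (α.op (e i)) v = 0 := fun i => by
      have := (Finset.sum_eq_zero_iff_of_nonneg fun i _ => sq_nonneg _).mp h1 i (Finset.mem_univ i)
      exact norm_eq_zero.mp (pow_eq_zero_iff two_ne_zero |>.mp this)
    have h4 : ∀ a : α.Elt, adjoint (α.op a) v = 0 := fun a => by
      rw [← e.sum_repr a, map_sum, map_sum]
      simp [map_smulₛₗ, h3]
    refine α.ext_eval fun ξ hξ z => ?_
    rw [← ContinuousLinearMap.adjoint_inner_right, inner_zero_right]
    change ⟪z, adjoint (α.op (α.elt ξ hξ)) v⟫_ℂ = 0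
    rw [h4, inner_zero_right]
  have hcomm : ∀ b ∈ 𝔟.Bd, ∀ v, P (α.rep b v) = α.rep b (P v) := by
    intro b hb v
    rw [hP, hP, map_sum]
    refine Finset.sum_congr rfl fun i _ => ?_
    have h1 : ∀ z, α.op (e i) (b z) = α.rep b (α.op (e i) z) := fun z =>
      congrArg (fun f => f z) (α.rep_comp hb (α.op_mem (e i))).symm
    have h2 : adjoint (α.op (e i)) (α.rep b v) = b (adjoint (α.op (e i)) v) := by
      have := congrArg adjoint (α.rep_comp (star_mem hb) (α.op_mem (e i)))
      rw [ContinuousLinearMap.adjoint_comp, ContinuousLinearMap.adjoint_comp, rep_star _ hb,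
        ContinuousLinearMap.adjoint_adjoint, ContinuousLinearMap.star_eq_adjoint,
        ContinuousLinearMap.adjoint_adjoint] at this
      exact congrArg (fun f => f v) this
    rw [h2, h1]
  let Pe : H ≃ₗ[ℂ] H := LinearEquiv.ofInjectiveEndo (P : H →ₗ[ℂ] H) hinj
  have hPe : ∀ v, Pe v = P v := fun v => rfl
  let Q : H →L[ℂ] H := LinearMap.toContinuousLinearMap (Pe.symm : H →ₗ[ℂ] H)
  have hQP : ∀ v, Q (P v) = v := fun v => Pe.symm_apply_apply v
  have hPQ : ∀ v, P (Q v) = v := fun v => Pe.apply_symm_apply v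
  have hQ : Equivariant α α Q := by
    intro b hb
    ext v
    change Q (α.rep b v) = α.rep b (Q v)
    conv_lhs => rw [← hPQ v, ← hcomm b hb, hQP]
  have h1 : (1 : H →L[ℂ] H) = ∑ i, (Q ∘L α.op (e i)) ∘L adjoint (α.op (e i)) := by
    ext v
    conv_lhs => rw [one_apply_eq_self, ← hQP v, hP, map_sum]
    simp
  rw [h1]
  exact Submodule.sum_mem _ fun i _ => Submodule.subset_span
    ⟨α.elt _ (hQ.comp_mem_space hζ (α.op_mem (e i))), e i, rfl⟩

end CFact
end factorization

/-! ### The spatial fiber product as a commutant -/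

section spatialCommutant
variable {𝔥 : Type*} [NormedAddCommGroup 𝔥] [InnerProductSpace ℂ 𝔥] [CompleteSpace 𝔥]
  {𝔟 : CStarBase 𝔥} {ζ : 𝔥}
  {H : Type*} [NormedAddCommGroup H] [InnerProductSpace ℂ H] [CompleteSpace H]
  {K : Type*} [NormedAddCommGroup K] [InnerProductSpace ℂ K] [CompleteSpace K]
  {α : CFact 𝔟 H} {β : CFact 𝔟.flip K}

namespace CFact

theorem tensor_ext {W : Type*} [NormedAddCommGroup W] [NormedSpace ℂ W]
    {S T : Tensor α β →L[ℂ] W} (h : ∀ ξ z η, S (tmul α β ξ z η) = T (tmul α β ξ z η)) :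
    S = T := by
  ext x
  obtain ⟨t, rfl⟩ := Hilb.mk_surjective _ x
  induction t using TensorProduct.induction_on with
  | zero => simp
  | add a b ha hb => rw [map_add, map_add, map_add, ha, hb]
  | tmul a η =>
    induction a using TensorProduct.induction_on with
    | zero => simp
    | add a b ha hb => rw [TensorProduct.add_tmul, map_add, map_add, map_add, ha, hb]
    | tmul ξ z => exact h ξ z η

theorem tensor_eq {x y : Tensor α β} (h : ∀ ξ z η, ⟪tmul α β ξ z η, x⟫_ℂ = ⟪tmul α β ξ z η, y⟫_ℂ) :
    x = y := by
  rw [← sub_eq_zero]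
  refine tensor_eq_zero fun ξ z η => ?_
  rw [inner_sub_right, h, sub_self]

theorem tmul_comp_left (ξ : α.Elt) (z : 𝔥) (η : β.Elt) {b : 𝔥 →L[ℂ] 𝔥} (hb : b ∈ 𝔟.B) :
    tmul α β (α.elt _ (α.comp_mem_space (α.op_mem ξ) hb)) z η = tmul α β ξ (b z) η :=
  tensor_eq fun ξ' z' η' => by rw [inner_tmul', inner_tmul']; rfl

section kets

theorem adjoint_ket₁_tmul [FiniteDimensional ℂ 𝔥] [FiniteDimensional ℂ H] [FiniteDimensional ℂ K]
    (ξ' ξ : α.Elt) (z : 𝔥) (η : β.Elt) :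
    adjoint (ket₁ ξ') (tmul α β ξ z η) = β.op η (adjoint (α.op ξ') (α.op ξ z)) := by
  refine β.ext_eval fun η' hη' z' => ?_
  have h : ket₁ ξ' (η' z') = tmul α β ξ' z' (β.elt η' hη') := ket₁_apply ξ' z' (β.elt η' hη')
  rw [ContinuousLinearMap.adjoint_inner_right, h, inner_tmul', op_elt,
    ContinuousLinearMap.adjoint_inner_right]

theorem adjoint_ket₂_tmul [FiniteDimensional ℂ 𝔥] [FiniteDimensional ℂ H] [FiniteDimensional ℂ K]
    (η' : β.Elt) (ξ : α.Elt) (z : 𝔥) (η : β.Elt) :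
    adjoint (ket₂ η') (tmul α β ξ z η) = α.op ξ (adjoint (β.op η') (β.op η z)) := by
  refine α.ext_eval fun ξ' hξ' z' => ?_
  have h : ket₂ η' (ξ' z') = tmul α β (α.elt ξ' hξ') z' η' := ket₂_apply (α.elt ξ' hξ') z' η'
  rw [ContinuousLinearMap.adjoint_inner_right, h, inner_tmul, op_elt,
    ContinuousLinearMap.adjoint_inner_right]

variable [FiniteDimensional ℂ 𝔥] [FiniteDimensional ℂ H] [FiniteDimensional ℂ K]

/-- The operators `|ξ⟩₁⟨ξ'|₁` act as `ξ ξ'^*` on the first leg. -/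
theorem one_mem_span_ket₁ (hζ : 𝔟.IsBicyclic ζ) (α : CFact 𝔟 H) (β : CFact 𝔟.flip K) :
    (1 : Tensor α β →L[ℂ] Tensor α β) ∈
      Submodule.span ℂ {T | ∃ p q : α.Elt, T = ket₁ p ∘L adjoint (ket₁ q)} := by
  have key : ∀ R ∈ Submodule.span ℂ {T | ∃ p q : α.Elt, T = α.op p ∘L adjoint (α.op q)},
      ∃ S ∈ Submodule.span ℂ {T : Tensor α β →L[ℂ] Tensor α β |
          ∃ p q : α.Elt, T = ket₁ p ∘L adjoint (ket₁ q)},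
        ∀ ξ z η ξ' z' η', ⟪tmul α β ξ' z' η', S (tmul α β ξ z η)⟫_ℂ
          = ⟪z', adjoint (β.op η') (β.op η (adjoint (α.op ξ') (R (α.op ξ z))))⟫_ℂ := by
    intro R hR
    induction hR using Submodule.span_induction with
    | mem R hR =>
      obtain ⟨p, q, rfl⟩ := hR
      refine ⟨_, Submodule.subset_span ⟨p, q, rfl⟩, fun ξ z η ξ' z' η' => ?_⟩
      rw [ContinuousLinearMap.comp_apply, adjoint_ket₁_tmul, ket₁_apply, inner_tmul']
      rfl
    | zero => exact ⟨0, Submodule.zero_mem _, by simp⟩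
    | add R R' _ _ h h' =>
      obtain ⟨S, hS, e⟩ := h
      obtain ⟨S', hS', e'⟩ := h'
      exact ⟨S + S', add_mem hS hS', fun ξ z η ξ' z' η' => by simp [e, e']⟩
    | smul c R _ h =>
      obtain ⟨S, hS, e⟩ := h
      exact ⟨c • S, Submodule.smul_mem _ _ hS, fun ξ z η ξ' z' η' => by simp [e]⟩
  obtain ⟨S, hS, e⟩ := key 1 (one_mem_span_comp_adjoint hζ α)
  have : (1 : Tensor α β →L[ℂ] Tensor α β) = S :=
    tensor_ext fun ξ z η => tensor_eq fun ξ' z' η' => by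
      rw [e, one_apply_eq_self, one_apply_eq_self, inner_tmul']
  rwa [this]

/-- The operators `|η⟩₂⟨η'|₂` act as `η η'^*` on the second leg. -/
theorem one_mem_span_ket₂ (hζ : 𝔟.IsBicyclic ζ) (α : CFact 𝔟 H) (β : CFact 𝔟.flip K) :
    (1 : Tensor α β →L[ℂ] Tensor α β) ∈
      Submodule.span ℂ {T | ∃ p q : β.Elt, T = ket₂ p ∘L adjoint (ket₂ q)} := by
  have key : ∀ R ∈ Submodule.span ℂ {T | ∃ p q : β.Elt, T = β.op p ∘L adjoint (β.op q)},
      ∃ S ∈ Submodule.span ℂ {T : Tensor α β →L[ℂ] Tensor α β |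
          ∃ p q : β.Elt, T = ket₂ p ∘L adjoint (ket₂ q)},
        ∀ ξ z η ξ' z' η', ⟪tmul α β ξ' z' η', S (tmul α β ξ z η)⟫_ℂ
          = ⟪z', adjoint (α.op ξ') (α.op ξ (adjoint (β.op η') (R (β.op η z))))⟫_ℂ := by
    intro R hR
    induction hR using Submodule.span_induction with
    | mem R hR =>
      obtain ⟨p, q, rfl⟩ := hR
      refine ⟨_, Submodule.subset_span ⟨p, q, rfl⟩, fun ξ z η ξ' z' η' => ?_⟩
      rw [ContinuousLinearMap.comp_apply, adjoint_ket₂_tmul, ket₂_apply, inner_tmul]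
      rfl
    | zero => exact ⟨0, Submodule.zero_mem _, by simp⟩
    | add R R' _ _ h h' =>
      obtain ⟨S, hS, e⟩ := h
      obtain ⟨S', hS', e'⟩ := h'
      exact ⟨S + S', add_mem hS hS', fun ξ z η ξ' z' η' => by simp [e, e']⟩
    | smul c R _ h =>
      obtain ⟨S, hS, e⟩ := h
      exact ⟨c • S, Submodule.smul_mem _ _ hS, fun ξ z η ξ' z' η' => by simp [e]⟩
  obtain ⟨S, hS, e⟩ := key 1 (one_mem_span_comp_adjoint hζ.flip β)
  have : (1 : Tensor α β →L[ℂ] Tensor α β) = S :=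
    tensor_ext fun ξ z η => tensor_eq fun ξ' z' η' => by
      rw [e, one_apply_eq_self, one_apply_eq_self, inner_tmul]
  rwa [this]

end kets

section tensorMap
theorem compatible_one (α : CFact 𝔟 H) : Compatible α α (1 : H →L[ℂ] H) :=
  ⟨fun ξ hξ => hξ, fun ξ hξ => by
    rw [← ContinuousLinearMap.star_eq_adjoint, star_one]; exact hξ⟩

theorem push_one (h : ∀ ξ ∈ α.space, (1 : H →L[ℂ] H) ∘L ξ ∈ α.space) (ξ : α.Elt) :
    push (1 : H →L[ℂ] H) h ξ = ξ :=
  α.op_injective (by ext; rfl)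

theorem Compatible.star {X : H →L[ℂ] H} (hX : Compatible α α X) : Compatible α α (star X) :=
  ⟨hX.2, by rw [← ContinuousLinearMap.star_eq_adjoint, star_star]; exact hX.1⟩

variable [FiniteDimensional ℂ 𝔥] [FiniteDimensional ℂ H] [FiniteDimensional ℂ K]

theorem adjoint_tensorMap {X : H →L[ℂ] H} {Y : K →L[ℂ] K} (hX : Compatible α α X)
    (hY : Compatible β β Y) :
    adjoint (tensorMap α β α β X Y) = tensorMap α β α β (star X) (star Y) := by
  refine tensor_ext fun ξ z η => tensor_eq fun ξ' z' η' => ?_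
  rw [ContinuousLinearMap.adjoint_inner_right, tensorMap_tmul hX hY,
    tensorMap_tmul hX.star hY.star, inner_tmul, inner_tmul]
  change ⟪z', adjoint (X ∘L α.op ξ') (α.op ξ (adjoint (Y ∘L β.op η') (β.op η z)))⟫_ℂ
    = ⟪z', adjoint (α.op ξ') (adjoint X (α.op ξ (adjoint (β.op η') (adjoint Y (β.op η z)))))⟫_ℂ
  rw [ContinuousLinearMap.adjoint_comp, ContinuousLinearMap.adjoint_comp]
  rfl

theorem tensorMap_eq_mul {X : H →L[ℂ] H} {Y : K →L[ℂ] K} (hX : Compatible α α X)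
    (hY : Compatible β β Y) :
    tensorMap α β α β X Y = tensorMap α β α β X 1 * tensorMap α β α β 1 Y := by
  refine tensor_ext fun ξ z η => ?_
  change _ = tensorMap α β α β X 1 (tensorMap α β α β 1 Y (tmul α β ξ z η))
  rw [tensorMap_tmul hX hY, tensorMap_tmul (compatible_one α) hY,
    tensorMap_tmul hX (compatible_one β), push_one, push_one]

theorem tensorMap_comp_ket₁ {Y : K →L[ℂ] K} (hY : Compatible β β Y) (ξ : α.Elt) :
    tensorMap α β α β 1 Y ∘L ket₁ ξ = ket₁ ξ ∘L Y := by
  refine β.ext_comp fun η hη => ?_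
  ext z
  have h1 : ket₁ ξ (η z) = tmul α β ξ z (β.elt η hη) := ket₁_apply ξ z (β.elt η hη)
  have h2 : ket₁ ξ (Y (η z)) = tmul α β ξ z (push Y hY.1 (β.elt η hη)) :=
    ket₁_apply ξ z (push Y hY.1 (β.elt η hη))
  change tensorMap α β α β 1 Y (ket₁ ξ (η z)) = ket₁ ξ (Y (η z))
  rw [h1, h2, tensorMap_tmul (compatible_one α) hY, push_one]

theorem tensorMap_comp_ket₂ {X : H →L[ℂ] H} (hX : Compatible α α X) (η : β.Elt) :
    tensorMap α β α β X 1 ∘L ket₂ η = ket₂ η ∘L X := by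
  refine α.ext_comp fun ξ hξ => ?_
  ext z
  have h1 : ket₂ η (ξ z) = tmul α β (α.elt ξ hξ) z η := ket₂_apply (α.elt ξ hξ) z η
  have h2 : ket₂ η (X (ξ z)) = tmul α β (push X hX.1 (α.elt ξ hξ)) z η :=
    ket₂_apply (push X hX.1 (α.elt ξ hξ)) z η
  change tensorMap α β α β X 1 (ket₂ η (ξ z)) = ket₂ η (X (ξ z))
  rw [h1, h2, tensorMap_tmul hX (compatible_one β), push_one]

variable {A : StarSubalgebra ℂ (H →L[ℂ] H)} {B : StarSubalgebra ℂ (K →L[ℂ] K)}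

theorem preservesKets_iff (hζ : 𝔟.IsBicyclic ζ) (hα : α.IsFactOf A) (hβ : β.IsFactOf B)
    (T : Tensor α β →L[ℂ] Tensor α β) :
    PreservesKets α β A B T ↔
      ∀ X ∈ StarSubalgebra.centralizer ℂ (A : Set (H →L[ℂ] H)),
      ∀ Y ∈ StarSubalgebra.centralizer ℂ (B : Set (K →L[ℂ] K)),
        Commute T (tensorMap α β α β X Y) := by
  have cα : ∀ X ∈ StarSubalgebra.centralizer ℂ (A : Set (H →L[ℂ] H)), Compatible α α X :=
    fun X hX => (equivariant_of_mem_centralizer hα hX).compatible hζ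
  have cβ : ∀ Y ∈ StarSubalgebra.centralizer ℂ (B : Set (K →L[ℂ] K)), Compatible β β Y :=
    fun Y hY => (equivariant_of_mem_centralizer hβ hY).compatible hζ.flip
  have h₁ := commute_iff_comp_mem_span (B := B) (k := fun ξ : α.Elt => ket₁ (β := β) ξ)
    (τ := fun Y => tensorMap α β α β 1 Y) (fun Y hY ξ => tensorMap_comp_ket₁ (cβ Y hY) ξ)
    (fun Y hY => by rw [adjoint_tensorMap (compatible_one α) (cβ Y hY), star_one])
    (one_mem_span_ket₁ hζ α β) T
  have h₂ := commute_iff_comp_mem_span (B := A) (k := fun η : β.Elt => ket₂ (α := α) η)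
    (τ := fun X => tensorMap α β α β X 1) (fun X hX η => tensorMap_comp_ket₂ (cα X hX) η)
    (fun X hX => by rw [adjoint_tensorMap (cα X hX) (compatible_one β), star_one])
    (one_mem_span_ket₂ hζ α β) T
  constructor
  · intro h X hX Y hY
    rw [tensorMap_eq_mul (cα X hX) (cβ Y hY)]
    exact (h₂.mpr h.2 X hX).mul_right (h₁.mpr h.1 Y hY)
  · intro h
    exact ⟨h₁.mp fun Y hY => h 1 (one_mem _) Y hY, h₂.mp fun X hX => h X hX 1 (one_mem _)⟩

/-- The spatial fiber product is the commutant of the operators `X ⊗ Y` with `X ∈ A'` and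
`Y ∈ B'`. -/
theorem mem_spatialFiberProduct_iff (hζ : 𝔟.IsBicyclic ζ) (hα : α.IsFactOf A) (hβ : β.IsFactOf B)
    (T : Tensor α β →L[ℂ] Tensor α β) :
    T ∈ spatialFiberProduct α β A B ↔
      ∀ X ∈ StarSubalgebra.centralizer ℂ (A : Set (H →L[ℂ] H)),
      ∀ Y ∈ StarSubalgebra.centralizer ℂ (B : Set (K →L[ℂ] K)),
        Commute T (tensorMap α β α β X Y) := by
  rw [← preservesKets_iff hζ hα hβ]
  refine ⟨fun h => h.1, fun h => ⟨h, ?_⟩⟩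
  rw [preservesKets_iff hζ hα hβ] at h ⊢
  intro X hX Y hY
  have h1 := (h _ (star_mem hX) _ (star_mem hY)).star_star
  rwa [← adjoint_tensorMap ((equivariant_of_mem_centralizer hα hX).compatible hζ)
    ((equivariant_of_mem_centralizer hβ hY).compatible hζ.flip),
    ← ContinuousLinearMap.star_eq_adjoint, star_star] at h1

end tensorMap
end CFact
end spatialCommutant

/-! ### Homomorphisms determined by intertwining operators -/

section extension
variable {V W : Type*} [NormedAddCommGroup V] [InnerProductSpace ℂ V] [CompleteSpace V]
  [NormedAddCommGroup W] [InnerProductSpace ℂ W] [CompleteSpace W]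

omit [CompleteSpace V] [CompleteSpace W] in
theorem eq_of_comp_eq {ι X : Type*} [NormedAddCommGroup X] [NormedSpace ℂ X] {Z : ι → V →L[ℂ] W}
    (hZ : Submodule.span ℂ {w | ∃ i v, w = Z i v} = ⊤) {R R' : W →L[ℂ] X}
    (h : ∀ i, R ∘L Z i = R' ∘L Z i) : R = R' := by
  ext w
  have hw : w ∈ Submodule.span ℂ {w | ∃ i v, w = Z i v} := by rw [hZ]; trivial
  induction hw using Submodule.span_induction with
  | mem w hw =>
    obtain ⟨i, v, rfl⟩ := hw
    exact congrArg (fun f => f v) (h i)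
  | zero => simp
  | add u v _ _ hu hv => rw [map_add, map_add, hu, hv]
  | smul c u _ hu => rw [map_smul, map_smul, hu]

theorem eq_of_adjoint_apply_eq {ι : Type*} {Z : ι → V →L[ℂ] W}
    (hZ : Submodule.span ℂ {w | ∃ i v, w = Z i v} = ⊤) {x y : W}
    (h : ∀ i, adjoint (Z i) x = adjoint (Z i) y) : x = y := by
  have : innerSL ℂ x = innerSL ℂ y := eq_of_comp_eq hZ fun i => by
    ext v
    change ⟪x, Z i v⟫_ℂ = ⟪y, Z i v⟫_ℂ
    rw [← ContinuousLinearMap.adjoint_inner_left, h, ContinuousLinearMap.adjoint_inner_left]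
  exact ext_inner_right ℂ fun v => congrArg (fun f => f v) this

variable [FiniteDimensional ℂ W]

theorem exists_comp_eq {ι : Type*} {Z : ι → V →L[ℂ] W}
    (hZ : Submodule.span ℂ {w | ∃ i v, w = Z i v} = ⊤) {S : V →L[ℂ] V}
    (hS : ∀ i j, Commute S (adjoint (Z i) ∘L Z j)) : ∃ R : W →L[ℂ] W, ∀ i, R ∘L Z i = Z i ∘L S := by
  let f : (ι →₀ V) →ₗ[ℂ] W := Finsupp.lsum ℂ fun i => (Z i : V →ₗ[ℂ] W)
  have hf : ∀ i v, f (Finsupp.single i v) = Z i v := fun i v => by simp [f]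
  let g : (ι →₀ V) →ₗ[ℂ] W := Finsupp.lsum ℂ fun i => (Z i ∘L S : V →L[ℂ] W).toLinearMap
  have hg : ∀ i v, g (Finsupp.single i v) = Z i (S v) := fun i v => by simp [g]
  have hsurj : Function.Surjective f := by
    rw [← LinearMap.range_eq_top, eq_top_iff, ← hZ, Submodule.span_le]
    rintro _ ⟨i, v, rfl⟩
    exact ⟨Finsupp.single i v, hf i v⟩
  obtain ⟨R, hR⟩ := exists_clm_of_surjective f hsurj g (by
    intro t ht
    refine eq_of_adjoint_apply_eq hZ fun i => ?_
    have key : adjoint (Z i) (g t) = S (adjoint (Z i) (f t)) := by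
      clear ht
      induction t using Finsupp.induction_linear with
      | zero => simp
      | add u v hu hv => simp only [map_add, hu, hv]
      | single j v =>
        rw [hf, hg]
        exact (congrArg (fun k => k v) (hS i j)).symm
    rw [key, ht, map_zero, map_zero])
  refine ⟨R, fun i => ?_⟩
  ext v
  have := hR (Finsupp.single i v)
  rwa [hf, hg] at this

/-- If the ranges of the operators `Z i : V → W` span `W` and the operators `(Z i)^* Z j` commute
with `𝒟`, then the relation `F(S) (Z i) = (Z i) S` determines a `*`-homomorphism `F` on `𝒟`. -/
theorem existsUnique_starHom_comp_eq {ι : Type*} {Z : ι → V →L[ℂ] W}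
    (hZ : Submodule.span ℂ {w | ∃ i v, w = Z i v} = ⊤)
    {𝒟 : StarSubalgebra ℂ (V →L[ℂ] V)} {ℰ : StarSubalgebra ℂ (W →L[ℂ] W)}
    (h𝒟 : ∀ S ∈ 𝒟, ∀ i j, Commute S (adjoint (Z i) ∘L Z j))
    (hℰ : ∀ S ∈ 𝒟, ∀ R : W →L[ℂ] W, (∀ i, R ∘L Z i = Z i ∘L S) → R ∈ ℰ) :
    ∃! F : 𝒟 →⋆ₙₐ[ℂ] ℰ, ∀ (S : 𝒟) i,
      (F S : W →L[ℂ] W) ∘L Z i = Z i ∘L (S : V →L[ℂ] V) := by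
  choose R hR using fun S : 𝒟 => exists_comp_eq hZ (h𝒟 S S.2)
  have hR' : ∀ (S : 𝒟) i v, R S (Z i v) = Z i ((S : V →L[ℂ] V) v) := fun S i v =>
    congrArg (fun f => f v) (hR S i)
  let F : 𝒟 →⋆ₙₐ[ℂ] ℰ :=
    { toFun := fun S => ⟨R S, hℰ S S.2 _ (hR S)⟩
      map_smul' := fun c S => Subtype.ext (eq_of_comp_eq hZ fun i => by
        ext v
        change R (c • S) (Z i v) = c • R S (Z i v)
        rw [hR', hR']
        exact map_smul (Z i) c _)
      map_zero' := Subtype.ext (eq_of_comp_eq hZ fun i => by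
        ext v
        change R 0 (Z i v) = 0
        rw [hR']
        exact map_zero (Z i))
      map_add' := fun S T => Subtype.ext (eq_of_comp_eq hZ fun i => by
        ext v
        change R (S + T) (Z i v) = R S (Z i v) + R T (Z i v)
        rw [hR', hR', hR']
        exact map_add (Z i) _ _)
      map_mul' := fun S T => Subtype.ext (eq_of_comp_eq hZ fun i => by
        ext v
        change R (S * T) (Z i v) = R S (R T (Z i v))
        rw [hR', hR', hR']
        rfl)
      map_star' := fun S => Subtype.ext (eq_of_comp_eq hZ fun i => by
        ext v
        refine eq_of_adjoint_apply_eq hZ fun j => ?_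
        change adjoint (Z j) (R (star S) (Z i v)) = adjoint (Z j) (adjoint (R S) (Z i v))
        have h1 := congrArg (fun f => adjoint f (Z i v)) (hR S j)
        simp only [ContinuousLinearMap.adjoint_comp] at h1
        rw [hR']
        exact (congrArg (fun f => f v) (h𝒟 _ (star_mem S.2) j i)).symm.trans h1.symm) }
  refine ⟨F, hR, fun F₁ hF₁ => ?_⟩
  ext1 S
  exact Subtype.ext (eq_of_comp_eq hZ fun i => (hF₁ S i).trans (hR S i).symm)

end extension

/-! ### The classical fiber product -/

namespace GNSRep
variable {N : Type*} [CStarAlgebra N] {μ : FaithfulState N}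
  {E : Type*} [NormedAddCommGroup E] [InnerProductSpace ℂ E] [CompleteSpace E]
  [FiniteDimensional ℂ E] (G : GNSRep μ E)
  {H : Type*} [NormedAddCommGroup H] [InnerProductSpace ℂ H] [CompleteSpace H]
  {K : Type*} [NormedAddCommGroup K] [InnerProductSpace ℂ K] [CompleteSpace K]
  {ρ : Nᵐᵒᵖ →⋆ₐ[ℂ] (H →L[ℂ] H)} {σ : N →⋆ₐ[ℂ] (K →L[ℂ] K)}

theorem rel_ext {W : Type*} [NormedAddCommGroup W] [NormedSpace ℂ W]
    {S T : G.RelTensor ρ σ →L[ℂ] W} (h : ∀ ξ η, S (G.rtmul ρ σ ξ η) = T (G.rtmul ρ σ ξ η)) :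
    S = T := by
  ext x
  obtain ⟨t, rfl⟩ := Hilb.mk_surjective _ x
  induction t using TensorProduct.induction_on with
  | zero => simp
  | add a b ha hb => rw [map_add, map_add, map_add, ha, hb]
  | tmul ξ η => exact h ξ η

theorem rel_eq {x y : G.RelTensor ρ σ}
    (h : ∀ ξ η, ⟪G.rtmul ρ σ ξ η, x⟫_ℂ = ⟪G.rtmul ρ σ ξ η, y⟫_ℂ) : x = y := by
  rw [← sub_eq_zero]
  refine G.rel_eq_zero ρ σ fun ξ η => ?_
  rw [inner_sub_right, h, sub_self]

variable [FiniteDimensional ℂ H] [FiniteDimensional ℂ K]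
  {L : Type*} [NormedAddCommGroup L] [InnerProductSpace ℂ L] [CompleteSpace L]
  [FiniteDimensional ℂ L]
  {M : Type*} [NormedAddCommGroup M] [InnerProductSpace ℂ M] [CompleteSpace M]
  [FiniteDimensional ℂ M]
  {H' : Type*} [NormedAddCommGroup H'] [InnerProductSpace ℂ H'] [CompleteSpace H']
  {K' : Type*} [NormedAddCommGroup K'] [InnerProductSpace ℂ K'] [CompleteSpace K']
  {υ : Nᵐᵒᵖ →⋆ₐ[ℂ] (L →L[ℂ] L)} {ω : N →⋆ₐ[ℂ] (M →L[ℂ] M)}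
  {ρ' : Nᵐᵒᵖ →⋆ₐ[ℂ] (H' →L[ℂ] H')} {σ' : N →⋆ₐ[ℂ] (K' →L[ℂ] K')}

theorem relMap_comp {X : H →L[ℂ] L} {Y : K →L[ℂ] M} {X' : L →L[ℂ] H'} {Y' : M →L[ℂ] K'}
    (hX : ∀ n, X ∘L ρ n = υ n ∘L X) (hY : ∀ n, Y ∘L σ n = ω n ∘L Y)
    (hX' : ∀ n, X' ∘L υ n = ρ' n ∘L X') (hY' : ∀ n, Y' ∘L ω n = σ' n ∘L Y') :
    G.relMap υ ω ρ' σ' X' Y' ∘L G.relMap ρ σ υ ω X Y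
      = G.relMap ρ σ ρ' σ' (X' ∘L X) (Y' ∘L Y) := by
  refine G.rel_ext fun ξ η => ?_
  rw [ContinuousLinearMap.comp_apply, G.relMap_rtmul hX hY, G.relMap_rtmul hX' hY',
    G.relMap_rtmul (fun n => ?_) (fun n => ?_)]
  · rfl
  · rw [ContinuousLinearMap.comp_assoc, hX, ← ContinuousLinearMap.comp_assoc, hX',
      ContinuousLinearMap.comp_assoc]
  · rw [ContinuousLinearMap.comp_assoc, hY, ← ContinuousLinearMap.comp_assoc, hY',
      ContinuousLinearMap.comp_assoc]

theorem adjoint_relMap {X : H →L[ℂ] L} {Y : K →L[ℂ] M}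
    (hX : ∀ n, X ∘L ρ n = υ n ∘L X) (hY : ∀ n, Y ∘L σ n = ω n ∘L Y) :
    adjoint (G.relMap ρ σ υ ω X Y) = G.relMap υ ω ρ σ (adjoint X) (adjoint Y) := by
  have hX' : ∀ n, adjoint X ∘L υ n = ρ n ∘L adjoint X :=
    adjoint_intertwine (fun x => map_star ρ x) (fun x => map_star υ x) (fun x => hX _)
  have hY' : ∀ n, adjoint Y ∘L ω n = σ n ∘L adjoint Y :=
    adjoint_intertwine (fun x => map_star σ x) (fun x => map_star ω x) (fun x => hY _)
  refine G.rel_ext fun ξ η => G.rel_eq fun ξ' η' => ?_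
  rw [ContinuousLinearMap.adjoint_inner_right, G.relMap_rtmul hX hY, G.relMap_rtmul hX' hY',
    inner_rtmul, inner_rtmul, G.Rop_intertwine hX, G.Rop_intertwine hX', G.R_intertwine hY,
    G.R_intertwine hY', ContinuousLinearMap.adjoint_comp, ContinuousLinearMap.adjoint_comp,
    ContinuousLinearMap.adjoint_adjoint]
  rfl

theorem star_relMap {X : H →L[ℂ] H} {Y : K →L[ℂ] K} (hX : ∀ n, X ∘L ρ n = ρ n ∘L X)
    (hY : ∀ n, Y ∘L σ n = σ n ∘L Y) :
    star (G.relMap ρ σ ρ σ X Y) = G.relMap ρ σ ρ σ (star X) (star Y) :=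
  G.adjoint_relMap hX hY

section fiberProduct
variable {A : StarSubalgebra ℂ (H →L[ℂ] H)} {B : StarSubalgebra ℂ (K →L[ℂ] K)}
  {C : StarSubalgebra ℂ (L →L[ℂ] L)} {D : StarSubalgebra ℂ (M →L[ℂ] M)}
  {ρ : Nᵐᵒᵖ →⋆ₐ[ℂ] A} {σ : N →⋆ₐ[ℂ] B} {υ : Nᵐᵒᵖ →⋆ₐ[ℂ] C} {ω : N →⋆ₐ[ℂ] D}

theorem mem_fiberProduct_iff
    (S : G.RelTensor (A.subtype.comp ρ) (B.subtype.comp σ) →L[ℂ]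
      G.RelTensor (A.subtype.comp ρ) (B.subtype.comp σ)) :
    S ∈ G.fiberProduct ρ σ ↔
      ∀ X ∈ StarSubalgebra.centralizer ℂ (A : Set (H →L[ℂ] H)),
      ∀ Y ∈ StarSubalgebra.centralizer ℂ (B : Set (K →L[ℂ] K)),
        Commute S (G.relMap (A.subtype.comp ρ) (B.subtype.comp σ) (A.subtype.comp ρ)
          (B.subtype.comp σ) X Y) := by
  rw [fiberProduct, StarSubalgebra.mem_centralizer_iff]
  constructor
  · intro h X hX Y hY
    exact (h _ ⟨X, hX, Y, hY, rfl⟩).1.symm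
  · rintro h _ ⟨X, hX, Y, hY, rfl⟩
    have hX' : ∀ n, X ∘L A.subtype.comp ρ n = A.subtype.comp ρ n ∘L X :=
      fun n => StarSubalgebra.mem_centralizer_iff_commute.mp hX _ (ρ n).2
    have hY' : ∀ n, Y ∘L B.subtype.comp σ n = B.subtype.comp σ n ∘L Y :=
      fun n => StarSubalgebra.mem_centralizer_iff_commute.mp hY _ (σ n).2
    refine ⟨(h X hX Y hY).symm.eq, ?_⟩
    rw [G.star_relMap hX' hY']
    exact (h _ (star_mem hX) _ (star_mem hY)).symm.eq

end fiberProduct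
end GNSRep

namespace GNSRep
variable {N : Type*} [CStarAlgebra N] {μ : FaithfulState N}
  {E : Type*} [NormedAddCommGroup E] [InnerProductSpace ℂ E] [CompleteSpace E]
  [FiniteDimensional ℂ E] (G : GNSRep μ E)
  {H : Type*} [NormedAddCommGroup H] [InnerProductSpace ℂ H] [CompleteSpace H]
  [FiniteDimensional ℂ H]
  {K : Type*} [NormedAddCommGroup K] [InnerProductSpace ℂ K] [CompleteSpace K]
  [FiniteDimensional ℂ K]
  {L : Type*} [NormedAddCommGroup L] [InnerProductSpace ℂ L] [CompleteSpace L]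
  [FiniteDimensional ℂ L]
  {M : Type*} [NormedAddCommGroup M] [InnerProductSpace ℂ M] [CompleteSpace M]
  [FiniteDimensional ℂ M]
  {ρ : Nᵐᵒᵖ →⋆ₐ[ℂ] (H →L[ℂ] H)} {σ : N →⋆ₐ[ℂ] (K →L[ℂ] K)}
  {υ : Nᵐᵒᵖ →⋆ₐ[ℂ] (L →L[ℂ] L)} {ω : N →⋆ₐ[ℂ] (M →L[ℂ] M)}

omit [FiniteDimensional ℂ L] [FiniteDimensional ℂ M] in
/-- If the ranges of the intertwiners in `𝒳` and `𝒴` span `L` and `M`, then the ranges of the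
operators `X ⊗ Y` span the relative tensor product. -/
theorem span_relMap_apply {𝒳 : Set (H →L[ℂ] L)} {𝒴 : Set (K →L[ℂ] M)}
    (h𝒳 : ∀ X ∈ 𝒳, ∀ n, X ∘L ρ n = υ n ∘L X) (h𝒴 : ∀ Y ∈ 𝒴, ∀ n, Y ∘L σ n = ω n ∘L Y)
    (hL : Submodule.span ℂ {w | ∃ X ∈ 𝒳, ∃ v, w = X v} = ⊤)
    (hM : Submodule.span ℂ {w | ∃ Y ∈ 𝒴, ∃ v, w = Y v} = ⊤) :
    Submodule.span ℂ {w | ∃ (i : 𝒳 × 𝒴) (v : _), w = G.relMap ρ σ υ ω i.1 i.2 v} = ⊤ := by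
  refine Submodule.eq_top_iff'.mpr fun w => ?_
  set T := Submodule.span ℂ {w | ∃ (i : 𝒳 × 𝒴) (v : _), w = G.relMap ρ σ υ ω i.1 i.2 v}
  obtain ⟨t, rfl⟩ := Hilb.mk_surjective _ w
  induction t using TensorProduct.induction_on with
  | zero => rw [map_zero]; exact T.zero_mem
  | add a b ha hb => rw [map_add]; exact T.add_mem ha hb
  | tmul x y =>
    have hx : x ∈ Submodule.span ℂ {w | ∃ X ∈ 𝒳, ∃ v, w = X v} := by rw [hL]; trivial
    have hy : y ∈ Submodule.span ℂ {w | ∃ Y ∈ 𝒴, ∃ v, w = Y v} := by rw [hM]; trivial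
    induction hx using Submodule.span_induction with
    | zero => rw [TensorProduct.zero_tmul, map_zero]; exact T.zero_mem
    | add a b _ _ ha hb => rw [TensorProduct.add_tmul, map_add]; exact T.add_mem ha hb
    | smul c a _ ha => rw [← TensorProduct.smul_tmul', map_smul]; exact T.smul_mem c ha
    | mem x hx =>
      obtain ⟨X, hX, ξ, rfl⟩ := hx
      induction hy using Submodule.span_induction with
      | zero => rw [TensorProduct.tmul_zero, map_zero]; exact T.zero_mem
      | add a b _ _ ha hb => rw [TensorProduct.tmul_add, map_add]; exact T.add_mem ha hb
      | smul c a _ ha => rw [TensorProduct.tmul_smul, map_smul]; exact T.smul_mem c ha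
      | mem y hy =>
        obtain ⟨Y, hY, η, rfl⟩ := hy
        exact Submodule.subset_span ⟨(⟨X, hX⟩, ⟨Y, hY⟩), G.rtmul _ _ ξ η,
          (G.relMap_rtmul (h𝒳 X hX) (h𝒴 Y hY) ξ η).symm⟩

/-- Spanning sets `𝒳`, `𝒴` of intertwiners, with `𝒳^* 𝒳 ⊆ 𝒮`, `𝒴^* 𝒴 ⊆ 𝒯` and `𝒮' 𝒳 ⊆ 𝒳`,
`𝒯' 𝒴 ⊆ 𝒴`, induce a unique `*`-homomorphism from the commutant `𝒟` of all `S ⊗ T` with `S ∈ 𝒮`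
and `T ∈ 𝒯` to the commutant `ℰ` of all `S ⊗ T` with `S ∈ 𝒮'` and `T ∈ 𝒯'`. -/
theorem existsUnique_starHom_relMap {𝒳 : Set (H →L[ℂ] L)} {𝒴 : Set (K →L[ℂ] M)}
    (h𝒳 : ∀ X ∈ 𝒳, ∀ n, X ∘L ρ n = υ n ∘L X) (h𝒴 : ∀ Y ∈ 𝒴, ∀ n, Y ∘L σ n = ω n ∘L Y)
    (hL : Submodule.span ℂ {w | ∃ X ∈ 𝒳, ∃ v, w = X v} = ⊤)
    (hM : Submodule.span ℂ {w | ∃ Y ∈ 𝒴, ∃ v, w = Y v} = ⊤)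
    {𝒮 : Set (H →L[ℂ] H)} {𝒯 : Set (K →L[ℂ] K)} {𝒮' : Set (L →L[ℂ] L)} {𝒯' : Set (M →L[ℂ] M)}
    (h𝒮 : ∀ X ∈ 𝒳, ∀ X' ∈ 𝒳, adjoint X ∘L X' ∈ 𝒮)
    (h𝒯 : ∀ Y ∈ 𝒴, ∀ Y' ∈ 𝒴, adjoint Y ∘L Y' ∈ 𝒯)
    (h𝒮' : ∀ S ∈ 𝒮', ∀ X ∈ 𝒳, S ∘L X ∈ 𝒳) (h𝒯' : ∀ T ∈ 𝒯', ∀ Y ∈ 𝒴, T ∘L Y ∈ 𝒴)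
    (hυ : ∀ S ∈ 𝒮', ∀ n, S ∘L υ n = υ n ∘L S) (hω : ∀ T ∈ 𝒯', ∀ n, T ∘L ω n = ω n ∘L T)
    {𝒟 : StarSubalgebra ℂ (G.RelTensor ρ σ →L[ℂ] G.RelTensor ρ σ)}
    {ℰ : StarSubalgebra ℂ (G.RelTensor υ ω →L[ℂ] G.RelTensor υ ω)}
    (h𝒟 : ∀ R, R ∈ 𝒟 ↔ ∀ S ∈ 𝒮, ∀ T ∈ 𝒯, Commute R (G.relMap ρ σ ρ σ S T))
    (hℰ : ∀ R, R ∈ ℰ ↔ ∀ S ∈ 𝒮', ∀ T ∈ 𝒯', Commute R (G.relMap υ ω υ ω S T)) :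
    ∃! F : 𝒟 →⋆ₙₐ[ℂ] ℰ, ∀ (S : 𝒟) (i : 𝒳 × 𝒴),
      (F S : G.RelTensor υ ω →L[ℂ] G.RelTensor υ ω) ∘L G.relMap ρ σ υ ω i.1 i.2
        = G.relMap ρ σ υ ω i.1 i.2 ∘L (S : G.RelTensor ρ σ →L[ℂ] G.RelTensor ρ σ) := by
  have hspan := G.span_relMap_apply h𝒳 h𝒴 hL hM
  refine existsUnique_starHom_comp_eq hspan ?_ ?_
  · rintro S hS ⟨⟨X, hX⟩, ⟨Y, hY⟩⟩ ⟨⟨X', hX'⟩, ⟨Y', hY'⟩⟩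
    rw [G.adjoint_relMap (h𝒳 X hX) (h𝒴 Y hY), G.relMap_comp (h𝒳 X' hX') (h𝒴 Y' hY')
      (adjoint_intertwine (fun x => map_star ρ x) (fun x => map_star υ x) (fun x => h𝒳 X hX _))
      (adjoint_intertwine (fun x => map_star σ x) (fun x => map_star ω x) (fun x => h𝒴 Y hY _))]
    exact (h𝒟 S).mp hS _ (h𝒮 X hX X' hX') _ (h𝒯 Y hY Y' hY')
  · intro R hR R' hR'
    rw [hℰ]
    intro S hS T hT
    refine eq_of_comp_eq hspan ?_
    rintro ⟨⟨X, hX⟩, ⟨Y, hY⟩⟩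
    have h1 := G.relMap_comp (h𝒳 X hX) (h𝒴 Y hY) (hυ S hS) (hω T hT)
    have h2 := hR' (⟨X, hX⟩, ⟨Y, hY⟩)
    have h3 := hR' (⟨S ∘L X, h𝒮' S hS X hX⟩, ⟨T ∘L Y, h𝒯' T hT Y hY⟩)
    dsimp only at h2 h3
    rw [ContinuousLinearMap.mul_def, ContinuousLinearMap.mul_def, ContinuousLinearMap.comp_assoc,
      ContinuousLinearMap.comp_assoc, h1, h2, h3, ← h1, ContinuousLinearMap.comp_assoc]

end GNSRep

/-! ### Comparison of the relative tensor products -/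

theorem Hilb.exists_linearIsometryEquiv {V W : Type*} [AddCommGroup V] [Module ℂ V]
    [FiniteDimensional ℂ V] [NormedAddCommGroup W] [InnerProductSpace ℂ W]
    (c : PreInnerProductSpace.Core ℂ V) (f : V →ₗ[ℂ] W) (hf : Function.Surjective f)
    (h : ∀ v w, ⟪f v, f w⟫_ℂ = c.inner v w) :
    ∃ Φ : Hilb c ≃ₗᵢ[ℂ] W, ∀ v, Φ (Hilb.mk c v) = f v := by
  obtain ⟨T, hT⟩ := exists_clm_of_surjective (Hilb.mk c) (Hilb.mk_surjective c) f fun v hv => by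
    rw [← inner_self_eq_zero (𝕜 := ℂ), h, ← Hilb.inner_mk, hv, inner_zero_left]
  let Φ₀ : Hilb c →ₗᵢ[ℂ] W := T.toLinearMap.isometryOfInner fun x y => by
    obtain ⟨v, rfl⟩ := Hilb.mk_surjective c x
    obtain ⟨w, rfl⟩ := Hilb.mk_surjective c y
    change ⟪T _, T _⟫_ℂ = _
    rw [hT, hT, h, Hilb.inner_mk]
  have hΦ₀ : ∀ v, Φ₀ (Hilb.mk c v) = f v := hT
  refine ⟨LinearIsometryEquiv.ofSurjective Φ₀ fun w => ?_, hT⟩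
  obtain ⟨v, rfl⟩ := hf w
  exact ⟨_, hΦ₀ v⟩

section comparison
variable {N : Type*} [CStarAlgebra N] {μ : FaithfulState N}
  {E : Type*} [NormedAddCommGroup E] [InnerProductSpace ℂ E] [CompleteSpace E]
  [FiniteDimensional ℂ E] (G : GNSRep μ E)
  {𝔥 : Type*} [NormedAddCommGroup 𝔥] [InnerProductSpace ℂ 𝔥] [CompleteSpace 𝔥]
  {𝔟 : CStarBase 𝔥} {ζ : 𝔥} {U : 𝔥 ≃ₗᵢ[ℂ] E}
  {H : Type*} [NormedAddCommGroup H] [InnerProductSpace ℂ H] [CompleteSpace H]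
  [FiniteDimensional ℂ H]
  {K : Type*} [NormedAddCommGroup K] [InnerProductSpace ℂ K] [CompleteSpace K]
  [FiniteDimensional ℂ K]

omit [CompleteSpace E] [FiniteDimensional ℂ E] [CompleteSpace 𝔥] in
theorem Ad_symm_Ad (T : 𝔥 →L[ℂ] 𝔥) : Ad U.symm (Ad U T) = T := by
  ext x
  change U.symm (U (T (U.symm (U x)))) = T x
  simp

omit [FiniteDimensional ℂ E] [FiniteDimensional ℂ H] in
theorem adjoint_comp_isometry_apply (T : E →L[ℂ] H) (x : H) :
    adjoint (T ∘L (U : 𝔥 →L[ℂ] E)) x = U.symm (adjoint T x) := by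
  refine ext_inner_left ℂ fun v => ?_
  rw [ContinuousLinearMap.adjoint_inner_right, ← U.inner_map_map, U.apply_symm_apply,
    ContinuousLinearMap.adjoint_inner_right]
  rfl

theorem CFact.op_ofVec_eq_Rop (hζ : 𝔟.IsBicyclic ζ) (hUζ : U ζ = G.ζ)
    (hU : Ad U '' 𝔟.Bd = Set.range G.πop) {α : CFact 𝔟 H} {ρ : Nᵐᵒᵖ →⋆ₐ[ℂ] (H →L[ℂ] H)}
    (hρ : ∀ n, ρ n = α.rep (Ad U.symm (G.πop n))) (ξ : H) :
    α.op (α.ofVec hζ ξ) = G.Rop ρ ξ ∘L (U : 𝔥 →L[ℂ] E) := by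
  have h1 : (G.Rop ρ ξ ∘L (U : 𝔥 →L[ℂ] E)) ζ = ξ := by
    have h2 : G.πop 1 G.ζ = G.ζ := by simp [G.πop_ζ, G.modularConj_ζ]
    change G.Rop ρ ξ (U ζ) = ξ
    rw [hUζ]
    conv_lhs => rw [← h2]
    rw [G.Rop_apply, map_one]
    rfl
  have h3 := op_ofVec_eq hζ α (T := G.Rop ρ ξ ∘L (U : 𝔥 →L[ℂ] E)) fun b hb => by
    obtain ⟨n, hn⟩ : Ad U b ∈ Set.range G.πop := hU ▸ Set.mem_image_of_mem _ hb
    have hb' : α.rep b = ρ n := by rw [hρ, hn, Ad_symm_Ad]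
    ext z
    have h4 : G.πop n (U z) = U (b z) := by
      rw [hn]
      change U (b (U.symm (U z))) = _
      rw [U.symm_apply_apply]
    change G.Rop ρ ξ (U (b z)) = α.rep b (G.Rop ρ ξ (U z))
    rw [hb', ← h4, G.Rop_πop]
  rwa [h1] at h3

theorem CFact.op_ofVec_eq_R (hζ : 𝔟.IsBicyclic ζ) (hUζ : U ζ = G.ζ)
    (hU : Ad U '' 𝔟.Bd = Set.range G.π) {β : CFact 𝔟 K} {σ : N →⋆ₐ[ℂ] (K →L[ℂ] K)}
    (hσ : ∀ n, σ n = β.rep (Ad U.symm (G.π n))) (η : K) :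
    β.op (β.ofVec hζ η) = G.R σ η ∘L (U : 𝔥 →L[ℂ] E) := by
  have h1 : (G.R σ η ∘L (U : 𝔥 →L[ℂ] E)) ζ = η := by
    have h2 : G.π 1 G.ζ = G.ζ := by simp
    change G.R σ η (U ζ) = η
    rw [hUζ]
    conv_lhs => rw [← h2]
    rw [G.R_apply, map_one]
    rfl
  have h3 := op_ofVec_eq hζ β (T := G.R σ η ∘L (U : 𝔥 →L[ℂ] E)) fun b hb => by
    obtain ⟨n, hn⟩ : Ad U b ∈ Set.range G.π := hU ▸ Set.mem_image_of_mem _ hb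
    have hb' : β.rep b = σ n := by rw [hσ, hn, Ad_symm_Ad]
    ext z
    have h4 : G.π n (U z) = U (b z) := by
      rw [hn]
      change U (b (U.symm (U z))) = _
      rw [U.symm_apply_apply]
    change G.R σ η (U (b z)) = β.rep b (G.R σ η (U z))
    rw [hb', ← h4, G.R_π]
  rwa [h1] at h3

namespace CFact
variable (hζ : 𝔟.IsBicyclic ζ) (α : CFact 𝔟 H) (β : CFact 𝔟.flip K)

/-- The map `ξ ⊗ η ↦ a ⊗ ζ ⊗ b`, where `a ∈ α` and `b ∈ β` satisfy `a ζ = ξ` and `b ζ = η`. -/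
noncomputable def ofVecTensor : H ⊗[ℂ] K →ₗ[ℂ] Tensor α β :=
  Hilb.mk (tensorCore α β) ∘ₗ LinearMap.rTensor β.Elt ((TensorProduct.mk ℂ α.Elt 𝔥).flip ζ) ∘ₗ
    TensorProduct.map (α.ofVec hζ).toLinearMap (β.ofVec hζ.flip).toLinearMap

theorem ofVecTensor_tmul (ξ : H) (η : K) :
    ofVecTensor hζ α β (ξ ⊗ₜ η) = tmul α β (α.ofVec hζ ξ) ζ (β.ofVec hζ.flip η) := rfl

theorem ofVecTensor_surjective : Function.Surjective (ofVecTensor hζ α β) := by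
  rw [← LinearMap.range_eq_top]
  refine Submodule.eq_top_iff'.mpr fun w => ?_
  set T := LinearMap.range (ofVecTensor hζ α β)
  obtain ⟨t, rfl⟩ := Hilb.mk_surjective _ w
  induction t using TensorProduct.induction_on with
  | zero => rw [map_zero]; exact T.zero_mem
  | add a b ha hb => rw [map_add]; exact T.add_mem ha hb
  | tmul a η =>
    induction a using TensorProduct.induction_on with
    | zero => rw [TensorProduct.zero_tmul, map_zero]; exact T.zero_mem
    | add a b ha hb => rw [TensorProduct.add_tmul, map_add]; exact T.add_mem ha hb
    | tmul ξ z =>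
      have hz : z ∈ Submodule.span ℂ {v | ∃ b ∈ 𝔟.B, v = b ζ} := by rw [hζ.1]; trivial
      induction hz using Submodule.span_induction with
      | zero => rw [TensorProduct.tmul_zero, TensorProduct.zero_tmul, map_zero]; exact T.zero_mem
      | add u v _ _ hu hv =>
        rw [TensorProduct.tmul_add, TensorProduct.add_tmul, map_add]; exact T.add_mem hu hv
      | smul c u _ hu =>
        rw [TensorProduct.tmul_smul, ← TensorProduct.smul_tmul', map_smul]; exact T.smul_mem c hu
      | mem z hz =>
        obtain ⟨b, hb, rfl⟩ := hz
        -- move `b` to the first leg, so that the middle leg becomes `ζ`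
        refine ⟨α.op (α.elt _ (α.comp_mem_space (α.op_mem ξ) hb)) ζ ⊗ₜ β.op η ζ, ?_⟩
        rw [ofVecTensor_tmul, ofVec_op_apply, ofVec_op_apply, tmul_comp_left ξ ζ η hb]
        rfl

end CFact

variable {α : CFact 𝔟 H} {β : CFact 𝔟.flip K}
  {ρ : Nᵐᵒᵖ →⋆ₐ[ℂ] (H →L[ℂ] H)} {σ : N →⋆ₐ[ℂ] (K →L[ℂ] K)}

theorem inner_ofVecTensor (hζ : 𝔟.IsBicyclic ζ) (hUζ : U ζ = G.ζ)
    (hUB : Ad U '' 𝔟.B = Set.range G.π) (hUBd : Ad U '' 𝔟.Bd = Set.range G.πop)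
    (hρ : ∀ n, ρ n = α.rep (Ad U.symm (G.πop n))) (hσ : ∀ n, σ n = β.rep (Ad U.symm (G.π n)))
    (s t : H ⊗[ℂ] K) :
    ⟪CFact.ofVecTensor hζ α β s, CFact.ofVecTensor hζ α β t⟫_ℂ = G.relForm ρ σ s t := by
  induction s using TensorProduct.induction_on with
  | zero => simp
  | add a b ha hb => simp [ha, hb]
  | tmul ξ η =>
    induction t using TensorProduct.induction_on with
    | zero => simp
    | add a b ha hb => simp [ha, hb]
    | tmul ξ' η' =>
      rw [CFact.ofVecTensor_tmul, CFact.ofVecTensor_tmul, CFact.inner_tmul, G.relForm_tmul,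
        CFact.op_ofVec_eq_Rop G hζ hUζ hUBd hρ, CFact.op_ofVec_eq_Rop G hζ hUζ hUBd hρ,
        CFact.op_ofVec_eq_R G hζ.flip hUζ hUB hσ, CFact.op_ofVec_eq_R G hζ.flip hUζ hUB hσ,
        ContinuousLinearMap.adjoint_inner_right, ← ContinuousLinearMap.adjoint_inner_left]
      rw [adjoint_comp_isometry_apply, adjoint_comp_isometry_apply, U.symm.inner_map_map]
      change ⟪adjoint (G.Rop ρ ξ') (G.Rop ρ ξ (U ζ)), adjoint (G.R σ η) (G.R σ η' (U ζ))⟫_ℂ = _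
      rw [hUζ]

/-- The comparison unitary `ξ ⊗ η ↦ R^ρ(ξ)U ⊗ ζ ⊗ R^σ(η)U`; here `R^ρ(ξ)U` is the element of `α`
that maps `ζ` to `ξ`. -/
theorem exists_comparison (hζ : 𝔟.IsBicyclic ζ) (hUζ : U ζ = G.ζ)
    (hUB : Ad U '' 𝔟.B = Set.range G.π) (hUBd : Ad U '' 𝔟.Bd = Set.range G.πop)
    (hρ : ∀ n, ρ n = α.rep (Ad U.symm (G.πop n))) (hσ : ∀ n, σ n = β.rep (Ad U.symm (G.π n))) :
    ∃ Φ : G.RelTensor ρ σ ≃ₗᵢ[ℂ] CFact.Tensor α β, IsComparison G ζ U Φ ∧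
      ∀ ξ η, Φ (G.rtmul ρ σ ξ η) = CFact.tmul α β (α.ofVec hζ ξ) ζ (β.ofVec hζ.flip η) := by
  obtain ⟨Φ, hΦ⟩ := Hilb.exists_linearIsometryEquiv (G.relCore ρ σ) (CFact.ofVecTensor hζ α β)
    (CFact.ofVecTensor_surjective hζ α β) (inner_ofVecTensor G hζ hUζ hUB hUBd hρ hσ)
  exact ⟨Φ, fun ξ η => ⟨_, _, CFact.op_ofVec_eq_Rop G hζ hUζ hUBd hρ ξ,
    CFact.op_ofVec_eq_R G hζ.flip hUζ hUB hσ η, hΦ _⟩, fun ξ η => hΦ _⟩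

variable {L : Type*} [NormedAddCommGroup L] [InnerProductSpace ℂ L] [CompleteSpace L]
  [FiniteDimensional ℂ L]
  {M : Type*} [NormedAddCommGroup M] [InnerProductSpace ℂ M] [CompleteSpace M]
  [FiniteDimensional ℂ M]
  {γ : CFact 𝔟 L} {δ : CFact 𝔟.flip M}
  {υ : Nᵐᵒᵖ →⋆ₐ[ℂ] (L →L[ℂ] L)} {ω : N →⋆ₐ[ℂ] (M →L[ℂ] M)}

theorem CFact.push_ofVec (hζ : 𝔟.IsBicyclic ζ) {X : H →L[ℂ] L}
    (hX : ∀ ξ ∈ α.space, X ∘L ξ ∈ γ.space) (ξ : H) :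
    push X hX (α.ofVec hζ ξ) = γ.ofVec hζ (X ξ) := by
  have h := ofVec_op_apply hζ γ (push X hX (α.ofVec hζ ξ))
  have h' : γ.op (push X hX (α.ofVec hζ ξ)) ζ = X (α.op (α.ofVec hζ ξ) ζ) := rfl
  rw [← h, h', op_ofVec_apply]

/-- The comparison unitaries intertwine `X ⊗_μ Y` and `X ⊗_𝔥 Y`. -/
theorem tensorMap_comparison [FiniteDimensional ℂ 𝔥] (hζ : 𝔟.IsBicyclic ζ)
    {Φ₁ : G.RelTensor ρ σ ≃ₗᵢ[ℂ] CFact.Tensor α β} {Φ₂ : G.RelTensor υ ω ≃ₗᵢ[ℂ] CFact.Tensor γ δ}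
    (h₁ : ∀ ξ η, Φ₁ (G.rtmul ρ σ ξ η) = CFact.tmul α β (α.ofVec hζ ξ) ζ (β.ofVec hζ.flip η))
    (h₂ : ∀ ξ η, Φ₂ (G.rtmul υ ω ξ η) = CFact.tmul γ δ (γ.ofVec hζ ξ) ζ (δ.ofVec hζ.flip η))
    {X : H →L[ℂ] L} {Y : K →L[ℂ] M}
    (hX : ∀ n, X ∘L ρ n = υ n ∘L X) (hY : ∀ n, Y ∘L σ n = ω n ∘L Y)
    (hX' : CFact.Compatible α γ X) (hY' : CFact.Compatible β δ Y) (v : G.RelTensor ρ σ) :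
    CFact.tensorMap α β γ δ X Y (Φ₁ v) = Φ₂ (G.relMap ρ σ υ ω X Y v) := by
  have : CFact.tensorMap α β γ δ X Y ∘L (Φ₁ : G.RelTensor ρ σ →L[ℂ] CFact.Tensor α β)
      = (Φ₂ : G.RelTensor υ ω →L[ℂ] CFact.Tensor γ δ) ∘L G.relMap ρ σ υ ω X Y := by
    refine G.rel_ext fun ξ η => ?_
    change CFact.tensorMap α β γ δ X Y (Φ₁ _) = Φ₂ (G.relMap ρ σ υ ω X Y _)
    rw [h₁, G.relMap_rtmul hX hY, h₂, CFact.tensorMap_tmul hX' hY', CFact.push_ofVec,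
      CFact.push_ofVec]
  exact congrArg (fun f => f v) this

end comparison

/-! ### Conjugation by unitaries -/

section conjugation
variable {V W : Type*} [NormedAddCommGroup V] [InnerProductSpace ℂ V] [CompleteSpace V]
  [NormedAddCommGroup W] [InnerProductSpace ℂ W] [CompleteSpace W]

omit [CompleteSpace V] [CompleteSpace W] in
theorem Ad_apply (Φ : V ≃ₗᵢ[ℂ] W) (S : V →L[ℂ] V) (v : V) : Ad Φ S (Φ v) = Φ (S v) := by
  change Φ (S (Φ.symm (Φ v))) = _
  rw [Φ.symm_apply_apply]

omit [CompleteSpace V] [CompleteSpace W] in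
theorem comp_eq_comp_iff_of_eq_Ad {V' W' : Type*} [NormedAddCommGroup V'] [InnerProductSpace ℂ V']
    [NormedAddCommGroup W'] [InnerProductSpace ℂ W'] {Φ : V ≃ₗᵢ[ℂ] W} {Φ' : V' ≃ₗᵢ[ℂ] W'}
    {S : V →L[ℂ] V} {S' : V' →L[ℂ] V'} {Z : V →L[ℂ] V'} {Z' : W →L[ℂ] W'} {T : W →L[ℂ] W}
    {T' : W' →L[ℂ] W'} (hT : T = Ad Φ S) (hT' : T' = Ad Φ' S') (hZ : ∀ v, Z' (Φ v) = Φ' (Z v)) :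
    T' ∘L Z' = Z' ∘L T ↔ S' ∘L Z = Z ∘L S := by
  subst hT hT'
  constructor
  · intro h
    ext v
    apply Φ'.injective
    have := congrArg (fun f => f (Φ v)) h
    change Ad Φ' S' (Z' (Φ v)) = Z' (Ad Φ S (Φ v)) at this
    rw [hZ, Ad_apply, Ad_apply, hZ] at this
    exact this
  · intro h
    ext w
    obtain ⟨v, rfl⟩ := Φ.surjective w
    change Ad Φ' S' (Z' (Φ v)) = Z' (Ad Φ S (Φ v))
    rw [hZ, Ad_apply, Ad_apply, hZ]
    exact congrArg (fun f => Φ' (f v)) h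

theorem star_Ad (Φ : V ≃ₗᵢ[ℂ] W) (S : V →L[ℂ] V) : star (Ad Φ S) = Ad Φ (star S) := by
  ext w
  obtain ⟨v, rfl⟩ := Φ.surjective w
  refine ext_inner_left ℂ fun w' => ?_
  obtain ⟨v', rfl⟩ := Φ.surjective w'
  rw [ContinuousLinearMap.star_eq_adjoint, ContinuousLinearMap.adjoint_inner_right, Ad_apply,
    Ad_apply, Φ.inner_map_map, Φ.inner_map_map, ContinuousLinearMap.star_eq_adjoint,
    ContinuousLinearMap.adjoint_inner_right]

theorem exists_starAlgEquiv_Ad (Φ : V ≃ₗᵢ[ℂ] W) {𝒟 : StarSubalgebra ℂ (V →L[ℂ] V)}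
    {ℰ : StarSubalgebra ℂ (W →L[ℂ] W)} (h : ∀ S, Ad Φ S ∈ ℰ ↔ S ∈ 𝒟) :
    ∃ θ : 𝒟 ≃⋆ₐ[ℂ] ℰ, ∀ S, (θ S : W →L[ℂ] W) = Ad Φ S := by
  have hsymm : ∀ T, Ad Φ (Ad Φ.symm T) = T := fun T => Ad_symm_Ad (U := Φ.symm) T
  refine ⟨{ toFun := fun S => ⟨Ad Φ S, (h S).mpr S.2⟩
            invFun := fun T => ⟨Ad Φ.symm T, (h _).mp (by rw [hsymm]; exact T.2)⟩
            left_inv := fun S => Subtype.ext (Ad_symm_Ad _)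
            right_inv := fun T => Subtype.ext (hsymm _)
            map_mul' := fun S T => Subtype.ext ?_
            map_add' := fun S T => Subtype.ext ?_
            map_star' := fun S => Subtype.ext (star_Ad Φ S).symm
            map_smul' := fun c S => Subtype.ext ?_ }, fun S => rfl⟩
  · ext w
    obtain ⟨v, rfl⟩ := Φ.surjective w
    change Ad Φ ((S : V →L[ℂ] V) * T) (Φ v) = Ad Φ S (Ad Φ T (Φ v))
    rw [Ad_apply, Ad_apply, Ad_apply]
    rfl
  · ext w
    exact map_add Φ _ _
  · ext w
    exact map_smul Φ c _

end conjugation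

/-- Isomorphisms `θ₁`, `θ₂` transport a unique homomorphism with property `P` to a unique
homomorphism with the corresponding property `Q`. -/
theorem exists_starHom_transport {D₁ D₂ E₁ E₂ : Type*} [Semiring D₁] [Algebra ℂ D₁] [Star D₁]
    [Semiring D₂] [Algebra ℂ D₂] [Star D₂] [Semiring E₁] [Algebra ℂ E₁] [Star E₁] [Semiring E₂]
    [Algebra ℂ E₂] [Star E₂] (θ₁ : D₁ ≃⋆ₐ[ℂ] E₁) (θ₂ : D₂ ≃⋆ₐ[ℂ] E₂)
    {P : (D₁ →⋆ₙₐ[ℂ] D₂) → Prop} {Q : (E₁ →⋆ₙₐ[ℂ] E₂) → Prop}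
    (h : ∀ F F', (∀ S, θ₂ (F S) = F' (θ₁ S)) → (P F ↔ Q F')) (hP : ∃! F, P F) :
    ∃ F F', (P F ∧ ∀ F₁, P F₁ → F₁ = F) ∧ (Q F' ∧ ∀ F₁, Q F₁ → F₁ = F') ∧
      ∀ S, θ₂ (F S) = F' (θ₁ S) := by
  obtain ⟨F, hF, huniq⟩ := hP
  let F' : E₁ →⋆ₙₐ[ℂ] E₂ := (θ₂ : D₂ →⋆ₙₐ[ℂ] E₂).comp (F.comp (θ₁.symm : E₁ →⋆ₙₐ[ℂ] D₁))
  have hF' : ∀ S, θ₂ (F S) = F' (θ₁ S) := fun S => by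
    change _ = θ₂ (F (θ₁.symm (θ₁ S)))
    rw [θ₁.symm_apply_apply]
  refine ⟨F, F', ⟨hF, huniq⟩, ⟨(h F F' hF').mp hF, fun F₁ hF₁ => ?_⟩, hF'⟩
  let F₀ : D₁ →⋆ₙₐ[ℂ] D₂ := (θ₂.symm : E₂ →⋆ₙₐ[ℂ] D₂).comp (F₁.comp (θ₁ : D₁ →⋆ₙₐ[ℂ] E₁))
  have hF₀ : ∀ S, θ₂ (F₀ S) = F₁ (θ₁ S) := fun S => θ₂.apply_symm_apply _
  have h0 : F₀ = F := huniq _ ((h F₀ F₁ hF₀).mpr hF₁)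
  ext T
  obtain ⟨S, rfl⟩ := θ₁.surjective T
  exact (hF₀ S).symm.trans ((congrArg (fun k => θ₂ (k S)) h0).trans (hF' S))

/-- The comparison unitary carries the commutant of the operators `X ⊗_μ Y`, with `X ∈ A'` and
`Y ∈ B'`, to the spatial fiber product. -/
theorem Ad_comparison_mem_iff {N : Type*} [CStarAlgebra N] {μ : FaithfulState N}
    {E : Type*} [NormedAddCommGroup E] [InnerProductSpace ℂ E] [CompleteSpace E]
    [FiniteDimensional ℂ E] (G : GNSRep μ E)
    {𝔥 : Type*} [NormedAddCommGroup 𝔥] [InnerProductSpace ℂ 𝔥] [CompleteSpace 𝔥]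
    [FiniteDimensional ℂ 𝔥] {𝔟 : CStarBase 𝔥} {ζ : 𝔥}
    {H : Type*} [NormedAddCommGroup H] [InnerProductSpace ℂ H] [CompleteSpace H]
    [FiniteDimensional ℂ H]
    {K : Type*} [NormedAddCommGroup K] [InnerProductSpace ℂ K] [CompleteSpace K]
    [FiniteDimensional ℂ K]
    {A : StarSubalgebra ℂ (H →L[ℂ] H)} {B : StarSubalgebra ℂ (K →L[ℂ] K)}
    {α : CFact 𝔟 H} {β : CFact 𝔟.flip K} (hα : α.IsFactOf A) (hβ : β.IsFactOf B)
    {ρ : Nᵐᵒᵖ →⋆ₐ[ℂ] (H →L[ℂ] H)} {σ : N →⋆ₐ[ℂ] (K →L[ℂ] K)}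
    (hρ : ∀ n, ρ n ∈ A) (hσ : ∀ n, σ n ∈ B) (hζ : 𝔟.IsBicyclic ζ)
    {Φ : G.RelTensor ρ σ ≃ₗᵢ[ℂ] CFact.Tensor α β}
    (hΦ : ∀ ξ η, Φ (G.rtmul ρ σ ξ η) = CFact.tmul α β (α.ofVec hζ ξ) ζ (β.ofVec hζ.flip η))
    (S : G.RelTensor ρ σ →L[ℂ] G.RelTensor ρ σ) :
    Ad Φ S ∈ CFact.spatialFiberProduct α β A B ↔
      ∀ X ∈ StarSubalgebra.centralizer ℂ (A : Set (H →L[ℂ] H)),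
      ∀ Y ∈ StarSubalgebra.centralizer ℂ (B : Set (K →L[ℂ] K)),
        Commute S (G.relMap ρ σ ρ σ X Y) := by
  rw [CFact.mem_spatialFiberProduct_iff hζ hα hβ]
  refine forall₂_congr fun X hX => forall₂_congr fun Y hY => ?_
  exact comp_eq_comp_iff_of_eq_Ad rfl rfl (tensorMap_comparison G hζ hΦ hΦ
    (fun n => StarSubalgebra.mem_centralizer_iff_commute.mp hX _ (hρ n))
    (fun n => StarSubalgebra.mem_centralizer_iff_commute.mp hY _ (hσ n))
    ((CFact.equivariant_of_mem_centralizer hα hX).compatible hζ)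
    ((CFact.equivariant_of_mem_centralizer hβ hY).compatible hζ.flip))

/-! ### Intertwiners and morphisms -/

section intertwiners
variable {H : Type*} [NormedAddCommGroup H] [InnerProductSpace ℂ H] [CompleteSpace H]
  {L : Type*} [NormedAddCommGroup L] [InnerProductSpace ℂ L] [CompleteSpace L]
  {A : StarSubalgebra ℂ (H →L[ℂ] H)} {C : StarSubalgebra ℂ (L →L[ℂ] L)} {φ : A →⋆ₐ[ℂ] C}

theorem Intertwines.adjoint_comp {X X' : H →L[ℂ] L} (hX : Intertwines φ X)
    (hX' : Intertwines φ X') :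
    adjoint X ∘L X' ∈ StarSubalgebra.centralizer ℂ (A : Set (H →L[ℂ] H)) := by
  have hX₂ : ∀ a : A, adjoint X ∘L (φ a : L →L[ℂ] L) = (a : H →L[ℂ] H) ∘L adjoint X :=
    adjoint_intertwine (n := A) (ρ := fun a => (a : H →L[ℂ] H)) (υ := fun a => (φ a : L →L[ℂ] L))
      (fun a => rfl) (fun a => by rw [map_star]; rfl) (fun a => hX _)
  rw [StarSubalgebra.mem_centralizer_iff_commute]
  intro a ha
  change (adjoint X ∘L X') ∘L a = a ∘L (adjoint X ∘L X')
  rw [ContinuousLinearMap.comp_assoc, hX' ⟨a, ha⟩, ← ContinuousLinearMap.comp_assoc, hX₂,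
    ContinuousLinearMap.comp_assoc]

theorem Intertwines.comp_left {X : H →L[ℂ] L} (hX : Intertwines φ X) {T : L →L[ℂ] L}
    (hT : T ∈ StarSubalgebra.centralizer ℂ (C : Set (L →L[ℂ] L))) : Intertwines φ (T ∘L X) := by
  intro a
  have h : T ∘L (φ a : L →L[ℂ] L) = (φ a : L →L[ℂ] L) ∘L T :=
    StarSubalgebra.mem_centralizer_iff_commute.mp hT _ (φ a).2
  rw [ContinuousLinearMap.comp_assoc, hX, ← ContinuousLinearMap.comp_assoc, h,
    ContinuousLinearMap.comp_assoc]

theorem Intertwines.comp_eq {R : Type*} {r : R → A} {s : R → C} (h : ∀ n, φ (r n) = s n)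
    {X : H →L[ℂ] L} (hX : Intertwines φ X) (n : R) :
    X ∘L (r n : H →L[ℂ] H) = (s n : L →L[ℂ] L) ∘L X := by
  rw [hX, h]

end intertwiners

section morphism
variable {𝔥 : Type*} [NormedAddCommGroup 𝔥] [InnerProductSpace ℂ 𝔥] [CompleteSpace 𝔥]
  {𝔟 : CStarBase 𝔥}
  {H : Type*} [NormedAddCommGroup H] [InnerProductSpace ℂ H] [CompleteSpace H]
  [FiniteDimensional ℂ H]
  {L : Type*} [NormedAddCommGroup L] [InnerProductSpace ℂ L] [CompleteSpace L]
  [FiniteDimensional ℂ L]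
  {A : StarSubalgebra ℂ (H →L[ℂ] H)} {C : StarSubalgebra ℂ (L →L[ℂ] L)}
  {φ : A →⋆ₐ[ℂ] C} {α : CFact 𝔟 H} {γ : CFact 𝔟 L}

/-- A morphism `φ` satisfies `φ ∘ ρ_α = ρ_γ`. -/
theorem IsMorphism.apply_eq_rep (h : IsMorphism α γ φ) {b : 𝔥 →L[ℂ] 𝔥} (hb : b ∈ 𝔟.Bd) {a : A}
    (ha : (a : H →L[ℂ] H) = α.rep b) : (φ a : L →L[ℂ] L) = γ.rep b := by
  refine γ.ext_comp fun T hT => ?_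
  rw [γ.rep_comp hb hT]
  rw [← h] at hT
  induction hT using Submodule.span_induction with
  | mem T hT =>
    obtain ⟨V, hV, -, ξ, hξ, rfl⟩ := hT
    rw [← ContinuousLinearMap.comp_assoc, ← hV a, ContinuousLinearMap.comp_assoc, ha,
      α.rep_comp hb hξ, ContinuousLinearMap.comp_assoc]
  | zero => simp
  | add u v _ _ hu hv => rw [ContinuousLinearMap.comp_add, hu, hv, ContinuousLinearMap.add_comp]
  | smul c u _ hu => rw [ContinuousLinearMap.comp_smul, hu, ContinuousLinearMap.smul_comp]

end morphism

theorem mainTheorem6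
    -- finite-dimensional Hilbert spaces `H`, `K`, `L`, `M`
    {H : Type*} [NormedAddCommGroup H] [InnerProductSpace ℂ H] [CompleteSpace H]
    [FiniteDimensional ℂ H]
    {K : Type*} [NormedAddCommGroup K] [InnerProductSpace ℂ K] [CompleteSpace K]
    [FiniteDimensional ℂ K]
    {L : Type*} [NormedAddCommGroup L] [InnerProductSpace ℂ L] [CompleteSpace L]
    [FiniteDimensional ℂ L]
    {M : Type*} [NormedAddCommGroup M] [InnerProductSpace ℂ M] [CompleteSpace M]
    [FiniteDimensional ℂ M]
    -- nondegenerate `C^*`-algebras of operators and unital `*`-homomorphisms `φ`, `ψ`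
    {A : StarSubalgebra ℂ (H →L[ℂ] H)} {B : StarSubalgebra ℂ (K →L[ℂ] K)}
    {C : StarSubalgebra ℂ (L →L[ℂ] L)} {D : StarSubalgebra ℂ (M →L[ℂ] M)}
    (φ : A →⋆ₐ[ℂ] C) (ψ : B →⋆ₐ[ℂ] D)
    -- a `C^*`-algebra `N` with a faithful state `μ` and a GNS representation on `E`
    {N : Type*} [CStarAlgebra N] (μ : FaithfulState N)
    {E : Type*} [NormedAddCommGroup E] [InnerProductSpace ℂ E] [CompleteSpace E]
    [FiniteDimensional ℂ E] (G : GNSRep μ E)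
    -- injective unital `*`-homomorphisms
    (ρ : Nᵐᵒᵖ →⋆ₐ[ℂ] A) (σ : N →⋆ₐ[ℂ] B) (υ : Nᵐᵒᵖ →⋆ₐ[ℂ] C) (ω : N →⋆ₐ[ℂ] D)
    (hρ : Function.Injective ρ) (hσ : Function.Injective σ)
    (hυ : Function.Injective υ) (hω : Function.Injective ω)
    -- a standard `C^*`-base with a bicyclic vector `ζ`
    {𝔥 : Type*} [NormedAddCommGroup 𝔥] [InnerProductSpace ℂ 𝔥] [CompleteSpace 𝔥]
    [FiniteDimensional ℂ 𝔥] (𝔟 : CStarBase 𝔥) (ζ : 𝔥) (hζ : 𝔟.IsBicyclic ζ)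
    -- `C^*`-factorizations
    (α : CFact 𝔟 H) (β : CFact 𝔟.flip K) (γ : CFact 𝔟 L) (δ : CFact 𝔟.flip M)
    (hα : α.IsFactOf A) (hβ : β.IsFactOf B) (hγ : γ.IsFactOf C) (hδ : δ.IsFactOf D)
    -- an equivalence `U` of `C^*`-bases with `Uζ = ζ_μ`
    (U : 𝔥 ≃ₗᵢ[ℂ] E) (hUB : Ad U '' 𝔟.B = Set.range G.π)
    (hUBd : Ad U '' 𝔟.Bd = Set.range G.πop) (hUζ : U ζ = G.ζ)
    -- compatibility of the factorizations with the representations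
    (hρα : ∀ n, (ρ n : H →L[ℂ] H) = α.rep (Ad U.symm (G.πop n)))
    (hσβ : ∀ n, (σ n : K →L[ℂ] K) = β.rep (Ad U.symm (G.π n)))
    (hυγ : ∀ n, (υ n : L →L[ℂ] L) = γ.rep (Ad U.symm (G.πop n)))
    (hωδ : ∀ n, (ω n : M →L[ℂ] M) = δ.rep (Ad U.symm (G.π n)))
    -- one of the two (equivalent) equivariance conditions
    (hequiv : ((∀ n, φ (ρ n) = υ n) ∧ ∀ n, ψ (σ n) = ω n) ∨
      (IsMorphism α γ φ ∧ IsMorphism β δ ψ)) :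
    ∃ (Φ₁ : G.RelTensor (A.subtype.comp ρ) (B.subtype.comp σ) ≃ₗᵢ[ℂ] CFact.Tensor α β)
      (Φ₂ : G.RelTensor (C.subtype.comp υ) (D.subtype.comp ω) ≃ₗᵢ[ℂ] CFact.Tensor γ δ),
      IsComparison G ζ U Φ₁ ∧ IsComparison G ζ U Φ₂ ∧
    ∃ (θ₁ : G.fiberProduct ρ σ ≃⋆ₐ[ℂ] CFact.spatialFiberProduct α β A B)
      (θ₂ : G.fiberProduct υ ω ≃⋆ₐ[ℂ] CFact.spatialFiberProduct γ δ C D),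
      (∀ S, (θ₁ S : CFact.Tensor α β →L[ℂ] CFact.Tensor α β) = Ad Φ₁ S) ∧
      (∀ S, (θ₂ S : CFact.Tensor γ δ →L[ℂ] CFact.Tensor γ δ) = Ad Φ₂ S) ∧
    ∃ (F : G.fiberProduct ρ σ →⋆ₙₐ[ℂ] G.fiberProduct υ ω)
      (F' : CFact.spatialFiberProduct α β A B →⋆ₙₐ[ℂ] CFact.spatialFiberProduct γ δ C D),
      (IsClassicalFiberMap G φ ψ F ∧ ∀ F₁, IsClassicalFiberMap G φ ψ F₁ → F₁ = F) ∧
      (IsSpatialFiberMap φ ψ F' ∧ ∀ F₁, IsSpatialFiberMap φ ψ F₁ → F₁ = F') ∧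
      ∀ S, θ₂ (F S) = F' (θ₁ S) := by
  -- both conditions amount to `φ ∘ ρ_α = ρ_γ` and `ψ ∘ ρ_β = ρ_δ`
  have memBd : ∀ n, Ad U.symm (G.πop n) ∈ 𝔟.Bd := fun n => by
    obtain ⟨b, hb, h⟩ : G.πop n ∈ Ad U '' 𝔟.Bd := hUBd ▸ Set.mem_range_self n
    rw [← h, Ad_symm_Ad]; exact hb
  have memB : ∀ n, Ad U.symm (G.π n) ∈ 𝔟.B := fun n => by
    obtain ⟨b, hb, h⟩ : G.π n ∈ Ad U '' 𝔟.B := hUB ▸ Set.mem_range_self n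
    rw [← h, Ad_symm_Ad]; exact hb
  have hφψ : (∀ n, φ (ρ n) = υ n) ∧ ∀ n, ψ (σ n) = ω n := by
    rcases hequiv with h | ⟨h, h'⟩
    · exact h
    · exact ⟨fun n => Subtype.ext ((h.apply_eq_rep (memBd n) (hρα n)).trans (hυγ n).symm),
        fun n => Subtype.ext ((h'.apply_eq_rep (memB n) (hσβ n)).trans (hωδ n).symm)⟩
  have hφ := hφψ.1
  have hψ := hφψ.2
  -- intertwiners of `φ` and `ψ` are compatible with the factorizations
  have eqφ : ∀ X, Intertwines φ X → CFact.Compatible α γ X := fun X hX =>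
    CFact.Equivariant.compatible hζ fun b hb => by
      obtain ⟨n, hn⟩ : Ad U b ∈ Set.range G.πop := hUBd ▸ Set.mem_image_of_mem _ hb
      have hb' : b = Ad U.symm (G.πop n) := by rw [hn, Ad_symm_Ad]
      rw [hb', ← hρα, ← hυγ]
      exact Intertwines.comp_eq hφ hX n
  have eqψ : ∀ Y, Intertwines ψ Y → CFact.Compatible β δ Y := fun Y hY =>
    CFact.Equivariant.compatible hζ.flip fun b hb => by
      obtain ⟨n, hn⟩ : Ad U b ∈ Set.range G.π := hUB ▸ Set.mem_image_of_mem _ hb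
      have hb' : b = Ad U.symm (G.π n) := by rw [hn, Ad_symm_Ad]
      rw [hb', ← hσβ, ← hωδ]
      exact Intertwines.comp_eq hψ hY n
  have exΦ₁ := exists_comparison G (ρ := A.subtype.comp ρ) (σ := B.subtype.comp σ)
    hζ hUζ hUB hUBd hρα hσβ
  have exΦ₂ := exists_comparison G (ρ := C.subtype.comp υ) (σ := D.subtype.comp ω)
    hζ hUζ hUB hUBd hυγ hωδ
  have hΦ₁ := exΦ₁.choose_spec.2
  have hΦ₂ := exΦ₂.choose_spec.2
  have exθ₁ := exists_starAlgEquiv_Ad exΦ₁.choose (𝒟 := G.fiberProduct ρ σ)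
    (ℰ := CFact.spatialFiberProduct α β A B) fun S =>
      (Ad_comparison_mem_iff G hα hβ (fun n => (ρ n).2) (fun n => (σ n).2) hζ hΦ₁ S).trans
        (G.mem_fiberProduct_iff S).symm
  have exθ₂ := exists_starAlgEquiv_Ad exΦ₂.choose (𝒟 := G.fiberProduct υ ω)
    (ℰ := CFact.spatialFiberProduct γ δ C D) fun S =>
      (Ad_comparison_mem_iff G hγ hδ (fun n => (υ n).2) (fun n => (ω n).2) hζ hΦ₂ S).trans
        (G.mem_fiberProduct_iff S).symm
  let θ₁ := exθ₁.choose
  let θ₂ := exθ₂.choose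
  have hθ₁ : ∀ S, _ := exθ₁.choose_spec
  have hθ₂ : ∀ S, _ := exθ₂.choose_spec
  have key := G.existsUnique_starHom_relMap
    (ρ := A.subtype.comp ρ) (σ := B.subtype.comp σ) (υ := C.subtype.comp υ) (ω := D.subtype.comp ω)
    (𝒳 := {X | Intertwines φ X}) (𝒴 := {Y | Intertwines ψ Y})
    (fun X hX => Intertwines.comp_eq hφ hX) (fun Y hY => Intertwines.comp_eq hψ hY)
    (span_intertwines_apply φ) (span_intertwines_apply ψ)
    (fun X hX X' hX' => Intertwines.adjoint_comp hX hX')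
    (fun Y hY Y' hY' => Intertwines.adjoint_comp hY hY')
    (fun S hS X hX => Intertwines.comp_left hX hS) (fun T hT Y hY => Intertwines.comp_left hY hT)
    (fun S hS n => StarSubalgebra.mem_centralizer_iff_commute.mp hS _ (υ n).2)
    (fun T hT n => StarSubalgebra.mem_centralizer_iff_commute.mp hT _ (ω n).2)
    G.mem_fiberProduct_iff G.mem_fiberProduct_iff
  have key' : ∃! F : G.fiberProduct ρ σ →⋆ₙₐ[ℂ] G.fiberProduct υ ω, IsClassicalFiberMap G φ ψ F :=
    (existsUnique_congr fun F => ⟨fun h X Y hX hY S => h S (⟨X, hX⟩, ⟨Y, hY⟩),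
      fun h S i => h _ _ i.1.2 i.2.2 S⟩).mp key
  -- corresponding maps satisfy the defining relations simultaneously
  have hiff : ∀ (F : G.fiberProduct ρ σ →⋆ₙₐ[ℂ] G.fiberProduct υ ω)
      (F' : CFact.spatialFiberProduct α β A B →⋆ₙₐ[ℂ] CFact.spatialFiberProduct γ δ C D),
      (∀ S, θ₂ (F S) = F' (θ₁ S)) → (IsClassicalFiberMap G φ ψ F ↔ IsSpatialFiberMap φ ψ F') := by
    intro F F' hF
    refine forall₂_congr fun X Y => forall₂_congr fun hX hY => ?_
    refine Iff.trans (forall_congr' fun S => ?_) θ₁.surjective.forall.symm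
    exact (comp_eq_comp_iff_of_eq_Ad (hθ₁ S) ((congrArg Subtype.val (hF S)).symm.trans (hθ₂ (F S)))
      (tensorMap_comparison G hζ hΦ₁ hΦ₂ (Intertwines.comp_eq hφ hX)
        (Intertwines.comp_eq hψ hY) (eqφ X hX) (eqψ Y hY))).symm
  exact ⟨exΦ₁.choose, exΦ₂.choose, exΦ₁.choose_spec.1, exΦ₂.choose_spec.1, θ₁, θ₂, hθ₁, hθ₂,
    exists_starHom_transport θ₁ θ₂ hiff key'⟩
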